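/- Let $\mathbb F_q$ be a finite field with $q$ elements, $X$ a Noetherian scheme over $\mathbb F_q$, $\sigma$ its $q$-power Frobenius, $\Lambda$ an $\mathbb F_q$-algebra essentially of finite type, $C=\operatorname{Spec}\Lambda$ and $X\times C$ the fibre product over $\mathbb F_q$. A $\kappa$-sheaf on $X$ (over $\Lambda$) is a quasi-coherent sheaf $V$ on $X\times C$ with an $\mathcal O_{X\times C}$-linear map $\kappa:(\sigma\times\mathrm{id})_*V\to V$; morphisms are the $\mathcal O$-linear maps commuting with $\kappa$. Put $\kappa^{0}=\mathrm{id}$ and $\kappa^{n+1}=\kappa\circ(\sigma\times\mathrm{id})_*\kappa^{n}$. $V$ is nilpotent if $\kappa^n=0$ for some $n$, locally nilpotent if it is the union of its nilpotent $\kappa$-subsheaves, coherent if the underlying sheaf is coherent, and ind-coherent if it is the union of its coherent $\kappa$-subsheaves. A complex of $\kappa$-sheaves is cohomologically nilpotent if all its cohomology $\kappa$-sheaves are locally nilpotent. For $x\in X$ let $A_x$ be the coordinate ring of $\operatorname{Spec}\mathcal O_{X,x}\times C$, let $\varphi:A_x\to A_x$ be the endomorphism given by $\sigma\times\mathrm{id}$,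 let $B_x=A_x/\mathfrak m_xA_x$ be the coordinate ring of $x\times C$ with the induced endomorphism, and for a $\kappa$-sheaf or a cohomologically bounded below complex of $\kappa$-sheaves $V$ let $V_x$ be the pullback of $V$ to $\operatorname{Spec}\mathcal O_{X,x}\times C$, with its map $\kappa:\varphi_*V_x\to V_x$. Put $$R^a i_x^!V=R^a\operatorname{Hom}_{A_x}(B_x,V_x)=\operatorname{Hom}_{D(A_x)}(B_x,V_x[a])\qquad(a\in\mathbb Z),$$ a $B_x$-module, with the map $\kappa$ that sends $e$ to the composite $B_x\to\varphi_*B_x\xrightarrow{\varphi_*e}\varphi_*V_x[a]\xrightarrow{\kappa[a]}V_x[a]$. It is locally nilpotent if it is the union of its $\kappa$-stable $B_x$-submodules on which some power of $\kappa$ is zero, and $i_x^!V$ is cohomologically nilpotent if $R^ai_x^!V$ is locally nilpotent for all $a$. (1) Let $V$ be an ind-coherent $\kappa$-sheaf, or any $\kappa$-sheaf if $\sigma$ is finite. The following are equivalent: (a) $V$ is locally nilpotent; (b) $R^0i_x^!V$ is locally nilpotent for all $x\in X$; (c) $i_x^!V$ is cohomologically nilpotent for all $x\in X$. (2) Let $V^\bullet$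 be a complex of $\kappa$-sheaves whose cohomology is bounded below. Assume that all terms $V^i$ are ind-coherent, or that $\sigma$ is finite. Then $V^\bullet$ is cohomologically nilpotent if and only if $i_x^!V^\bullet$ is cohomologically nilpotent for all $x\in X$. (3) Let $V^\bullet$ be a complex of $\kappa$-sheaves whose cohomology is bounded below and whose cohomology $\kappa$-sheaves are all ind-coherent ($\sigma$ need not be finite). If $i_x^!V^\bullet$ is cohomologically nilpotent for all $x\in X$, then $V^\bullet$ is cohomologically nilpotent. -/

import Mathlib

open CategoryTheory AlgebraicGeometry Limits TopologicalSpace Opposite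
universe u v u' v'
namespace CartierSheaf
noncomputable section

set_option linter.unusedSectionVars false

/-- The `q`-power map of a ring over a field with `q` elements. -/
def powHom {F R : Type u} [Field F] [Finite F] [CommRing R] (i : F →+* R) : R →+* R :=
  letI := i.toAlgebra
  letI := Fintype.ofFinite F
  (FiniteField.frobeniusAlgHom F R).toRingHom

lemma powHom_apply {F R : Type u} [Field F] [Finite F] [CommRing R] (i : F →+* R) (r : R) :
    powHom i r = r ^ Nat.card F := by
  let := Fintype.ofFinite F
  rw [Nat.card_eq_fintype_card]
  rfl

section Frobenius

variable {F : Type u} [Field F] [Finite F] {X Y : Scheme.{u}} (f : X ⟶ Spec (CommRingCat.of F))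

/-- The structure map of the `F`-algebra of functions on an open subset. -/
def scalarHom (U : X.Opens) : F →+* Γ(X, U) :=
  ((Scheme.ΓSpecIso (CommRingCat.of F)).inv ≫ f.appTop ≫ X.presheaf.map (homOfLE le_top).op).hom

/-- The `q`-power Frobenius `σ_X` of an `F`-scheme `X`, where `q = #F`. -/
def frob : X ⟶ X where
  base := 𝟙 _
  c := { app := fun U => CommRingCat.ofHom (powHom (scalarHom f U.unop))
         naturality := by
          intro U V i
          ext r
          change powHom (scalarHom f V.unop) (X.presheaf.map i r) =
            X.presheaf.map i (powHom (scalarHom f U.unop) r)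
          rw [powHom_apply, powHom_apply, map_pow] }
  prop := by
    intro x
    constructor
    intro a ha
    obtain ⟨U, hxU, s, rfl⟩ := X.presheaf.exists_germ_eq a
    erw [PresheafedSpace.stalkMap_germ_apply] at ha
    change IsUnit (X.presheaf.germ U x hxU (powHom (scalarHom f U) s)) at ha
    rw [powHom_apply, map_pow, isUnit_pow_iff Nat.card_pos.ne'] at ha
    exact ha

lemma frob_base : (frob f).base = 𝟙 _ := rfl

@[simp] lemma frob_preimage (U : X.Opens) : (frob f) ⁻¹ᵁ U = U := rfl

lemma frob_app (U : X.Opens) (s : Γ(X, U)) :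
   (frob f).app U s = (s ^ Nat.card F : Γ(X, U)) := powHom_apply (scalarHom f U) s

lemma frob_naturality (h : Y ⟶ X) : h ≫ frob f = frob (h ≫ f) ≫ h := by
  refine Scheme.Hom.ext rfl fun U => ?_
  ext s
  change Y.presheaf.map (𝟙 _) (h.app U ((frob f).app U s)) =
    (frob (h ≫ f)).app (h ⁻¹ᵁ U) (h.app U s)
  rw [frob_app, frob_app, map_pow, Y.presheaf.map_id]
  rfl

lemma frob_comp : frob f ≫ f = f := by
  refine ext_of_isAffine ?_
  ext s
  rw [Scheme.Hom.comp_appTop]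
  change (frob f).app ⊤ (f.appTop s) = f.appTop s
  obtain ⟨a, rfl⟩ := (Scheme.ΓSpecIso (CommRingCat.of F)).commRingCatIsoToRingEquiv.symm.surjective s
  let := Fintype.ofFinite F
  erw [frob_app]
  rw [← map_pow, ← map_pow, Nat.card_eq_fintype_card, FiniteField.pow_card]

variable (Λ : Type u) [CommRing Λ] [Algebra F Λ]

/-- The product `X × C` over `F`, where `C = Spec Λ`. -/
abbrev prodC : Scheme.{u} :=
  pullback f (Spec.map (CommRingCat.ofHom (algebraMap F Λ)))

/-- The projection `X × C ⟶ X`. -/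
abbrev prX : prodC f Λ ⟶ X := pullback.fst _ _

/-- The endomorphism `σ × id` of `X × C`. -/
def sigma : prodC f Λ ⟶ prodC f Λ :=
  pullback.lift (pullback.fst _ _ ≫ frob f) (pullback.snd _ _)
    (by rw [Category.assoc, frob_comp, pullback.condition])

/-- The endomorphism `id × σ` of `X × C`. -/
def sigma' : prodC f Λ ⟶ prodC f Λ :=
  pullback.lift (pullback.fst _ _)
    (pullback.snd _ _ ≫ frob (Spec.map (CommRingCat.ofHom (algebraMap F Λ))))
    (by rw [Category.assoc, frob_comp, pullback.condition])

lemma sigma_prX : sigma f Λ ≫ prX f Λ = prX f Λ ≫ frob f := pullback.lift_fst _ _ _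

lemma sigma_snd : sigma f Λ ≫ pullback.snd _ _ = pullback.snd _ _ := pullback.lift_snd _ _ _

lemma sigma'_prX : sigma' f Λ ≫ prX f Λ = prX f Λ := pullback.lift_fst _ _ _

lemma sigma'_snd : sigma' f Λ ≫ pullback.snd _ _ =
    pullback.snd _ _ ≫ frob (Spec.map (CommRingCat.ofHom (algebraMap F Λ))) :=
  pullback.lift_snd _ _ _

lemma sigma_comp_sigma' : sigma f Λ ≫ sigma' f Λ = frob (prX f Λ ≫ f) := by
  apply pullback.hom_ext
  · rw [Category.assoc, sigma'_prX, sigma_prX, frob_naturality]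
  · rw [Category.assoc, sigma'_snd, ← Category.assoc, sigma_snd, frob_naturality,
      pullback.condition]

lemma sigma'_comp_sigma : sigma' f Λ ≫ sigma f Λ = frob (prX f Λ ≫ f) := by
  apply pullback.hom_ext
  · rw [Category.assoc, sigma_prX, ← Category.assoc, sigma'_prX, frob_naturality]
  · rw [Category.assoc, sigma_snd, sigma'_snd, frob_naturality, pullback.condition]

lemma isHomeomorph_sigma : IsHomeomorph (sigma f Λ) := by
  rw [isHomeomorph_iff_exists_inverse]
  refine ⟨(sigma f Λ).continuous, sigma' f Λ, ?_, ?_, (sigma' f Λ).continuous⟩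
  · intro x
    rw [← Scheme.Hom.comp_apply, sigma_comp_sigma']
    rfl
  · intro x
    rw [← Scheme.Hom.comp_apply, sigma'_comp_sigma]
    rfl

end Frobenius


lemma toSheaf_epi {C : Type u'} [Category.{v'} C] {J : GrothendieckTopology C}
    (R : Sheaf J RingCat.{u}) [HasSheafify J AddCommGrpCat.{v}]
    [J.WEqualsLocallyBijective AddCommGrpCat.{v}] {M N : SheafOfModules.{v} R} (g : M ⟶ N)
    [Epi g] : Epi ((SheafOfModules.toSheaf R).map g) := by
  let S := PresheafOfModules.sheafification.{v} (𝟙 R.obj)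
  let G := SheafOfModules.forget.{v} R ⋙ PresheafOfModules.restrictScalars (𝟙 R.obj)
  let adj : S ⊣ G := PresheafOfModules.sheafificationAdjunction.{v} (𝟙 R.obj)
  have hc : IsIso adj.counit :=
    inferInstanceAs (IsIso (PresheafOfModules.sheafificationAdjunction.{v} (𝟙 R.obj)).counit)
  let p : G.obj M ⟶ G.obj N := G.map g
  have h : S.map p ≫ adj.counit.app N = adj.counit.app M ≫ g := adj.counit.naturality g
  have h' : S.map p = adj.counit.app M ≫ g ≫ inv (adj.counit.app N) := by
    rw [← Category.assoc, IsIso.eq_comp_inv]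
    exact h
  have h3 : g = inv (adj.counit.app M) ≫ S.map p ≫ adj.counit.app N := by
    rw [IsIso.eq_inv_comp]
    exact h.symm
  have hp : Epi (S.map p) := by
    rw [h']
    infer_instance
  have hfac : S.map p = S.map (Abelian.factorThruImage p) ≫ S.map (Abelian.image.ι p) := by
    rw [← Functor.map_comp, Abelian.image.fac]
  have hl : PreservesFiniteLimits S :=
    inferInstanceAs (PreservesFiniteLimits (PresheafOfModules.sheafification.{v} (𝟙 R.obj)))
  have hi : IsIso (S.map (Abelian.image.ι p)) := by
    have : Epi (S.map (Abelian.image.ι p)) := by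
      rw [hfac] at hp
      exact epi_of_epi (S.map (Abelian.factorThruImage p)) _
    exact isIso_of_mono_of_epi _
  let e : S ⋙ SheafOfModules.toSheaf R ≅
      PresheafOfModules.toPresheaf R.obj ⋙ presheafToSheaf J AddCommGrpCat :=
    PresheafOfModules.sheafificationCompToSheaf (𝟙 R.obj)
  have h0 : Epi ((S ⋙ SheafOfModules.toSheaf R).map (Abelian.factorThruImage p)) := by
    rw [← NatIso.naturality_2 e (Abelian.factorThruImage p)]
    have : Epi ((PresheafOfModules.toPresheaf R.obj ⋙ presheafToSheaf J AddCommGrpCat).map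
        (Abelian.factorThruImage p)) := by
      dsimp only [Functor.comp_map]
      infer_instance
    infer_instance
  have h0' : Epi ((SheafOfModules.toSheaf R).map (S.map (Abelian.factorThruImage p))) := h0
  have h1 : Epi ((SheafOfModules.toSheaf R).map (S.map p)) := by
    rw [hfac, Functor.map_comp]
    infer_instance
  rw [h3, Functor.map_comp, Functor.map_comp (SheafOfModules.toSheaf R) (S.map p)]
  infer_instance

lemma epi_iff_locally_surjective {X : Scheme.{u}} {M N : X.Modules} (g : M ⟶ N) :
    Epi g ↔ TopCat.Presheaf.IsLocallySurjective g.mapPresheaf := by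
  have : Epi g ↔ Epi ((SheafOfModules.toSheaf X.ringCatSheaf).map g) :=
    ⟨fun h => @toSheaf_epi _ _ _ X.ringCatSheaf _ _ _ _ g h, fun h => (SheafOfModules.toSheaf X.ringCatSheaf).epi_of_epi_map h⟩
  rw [this, ← Sheaf.isLocallySurjective_iff_epi']
  rfl

lemma pushforward_preservesEpi {X Y : Scheme.{u}} (h : X ⟶ Y) (hh : IsHomeomorph h) {M N : X.Modules}
    (g : M ⟶ N) [Epi g] : Epi ((Scheme.Modules.pushforward h).map g) := by
  have := (epi_iff_locally_surjective g).1 inferInstance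
  rw [TopCat.Presheaf.isLocallySurjective_iff] at this
  rw [epi_iff_locally_surjective, TopCat.Presheaf.isLocallySurjective_iff]
  intro U t y hy
  obtain ⟨x, rfl⟩ := hh.surjective y
  obtain ⟨V, hV, ⟨s, hs⟩, hx⟩ := this (h ⁻¹ᵁ U) t x hy
  obtain ⟨W, hW⟩ : ∃ W : Y.Opens, h ⁻¹ᵁ W = V := by
    refine ⟨⟨h '' V, hh.isOpenMap _ V.2⟩, ?_⟩
    ext z
    exact hh.injective.mem_set_image
  subst hW
  refine ⟨W, ?_, ⟨s, ?_⟩, hx⟩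
  · intro z hz
    obtain ⟨z, rfl⟩ := hh.surjective z
    exact hV hz
  · exact hs

lemma pushforward_preservesHomology {X Y : Scheme.{u}} (h : X ⟶ Y) (hh : IsHomeomorph h) :
    (Scheme.Modules.pushforward h).PreservesHomology := by
  refine ((Functor.exact_tfae (Scheme.Modules.pushforward h)).out 0 2).1 fun S hS => ?_
  have := hS.mono_f
  have := hS.epi_g
  have hP : PreservesFiniteLimits (Scheme.Modules.pushforward h) := inferInstance
  have h2 := (Functor.preservesFiniteLimits_iff_forall_exact_map_and_mono
    (Scheme.Modules.pushforward h)).1 hP S hS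
  have : Mono (S.map (Scheme.Modules.pushforward h)).f := h2.2
  have : Epi (S.map (Scheme.Modules.pushforward h)).g := pushforward_preservesEpi h hh S.g
  exact ⟨h2.1⟩


/-! Local nilpotence of algebras of an additive endofunctor, and complexes of such algebras. -/

section Endo
variable {C : Type u'} [Category.{v'} C] {G : C ⥤ C}

/-- The `n`-fold iterate `G^n M`. -/
def powObj (G : C ⥤ C) (M : C) : ℕ → C
  | 0 => M
  | n + 1 => G.obj (powObj G M n)

/-- The iterate `κ^n : G^n M ⟶ M` of a structure map `κ : G M ⟶ M`:
`κ^0 = id` and `κ^(n+1) = κ ∘ G (κ^n)`. -/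
def kpow (V : Endofunctor.Algebra G) : ∀ n, powObj G V.a n ⟶ V.a
  | 0 => 𝟙 _
  | n + 1 => G.map (kpow V n) ≫ V.str

/-- Some iterate of the structure map vanishes. -/
def IsNilp [HasZeroMorphisms C] (V : Endofunctor.Algebra G) : Prop :=
  ∃ n, kpow V n = 0

variable [Preadditive C] [G.Additive]

/-- The underlying complex of a complex of algebras. -/
abbrev underlying (K : CochainComplex (Endofunctor.Algebra G) ℤ) : CochainComplex C ℤ :=
  ((Endofunctor.Algebra.forget G).mapHomologicalComplex _).obj K

/-- The structure maps of a complex of algebras, as a morphism of complexes. -/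
def strHom (K : CochainComplex (Endofunctor.Algebra G) ℤ) :
    (G.mapHomologicalComplex _).obj (underlying K) ⟶ underlying K where
  f i := (K.X i).str
  comm' i j _ := (K.d i j).h.symm

end Endo

/-- The cohomology of a complex of algebras of an exact endofunctor, with the induced structure
map. -/
def cohomologyAlg {C : Type u'} [Category.{v'} C] [Abelian C] {G : C ⥤ C} [G.Additive]
    [G.PreservesHomology] (K : CochainComplex (Endofunctor.Algebra G) ℤ) (i : ℤ) :
    Endofunctor.Algebra G where
  a := (underlying K).homology i
  str := (((underlying K).sc i).mapHomologyIso G).inv ≫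
    HomologicalComplex.homologyMap (strHom K) i

/-! The algebraic side. -/

section Alg
variable {A : Type u} [CommRing A] (φ : A →+* A) (I : Ideal A)

instance : HasDerivedCategory.{u + 1} (ModuleCat.{u} A) := HasDerivedCategory.standard _

/-- The category of pairs of a module `M` and an additive map `κ : M → M` with
`κ (φ a • m) = a • κ m`. -/
abbrev KMod := Endofunctor.Algebra (ModuleCat.restrictScalars.{u} φ)

/-- The category of pairs of an object `K` of `D(A)` and a morphism `κ : φ_* K ⟶ K` in `D(A)`. -/
abbrev DKMod := Endofunctor.Algebra (ModuleCat.restrictScalars.{u} φ).mapDerivedCategory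

variable {φ}

/-- A complex of pairs, as an object of the derived category. -/
def toDKMod (K : CochainComplex (KMod φ) ℤ) : DKMod φ where
  a := DerivedCategory.Q.obj (underlying K)
  str := (ModuleCat.restrictScalars φ).mapDerivedCategoryFactors.hom.app _ ≫
    DerivedCategory.Q.map (strHom K)

/-- A single pair, as an object of the derived category concentrated in degree `0`. -/
def singleDKMod (M : KMod φ) : DKMod φ where
  a := (DerivedCategory.singleFunctor _ 0).obj M.a
  str := ((ModuleCat.restrictScalars φ).mapDerivedCategorySingleFunctor 0).hom.app _ ≫
    (DerivedCategory.singleFunctor _ 0).map M.str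

variable (hI : I ≤ I.comap φ)

/-- The map `A/I → φ_*(A/I)` induced by `φ`. -/
def quotFrob : ModuleCat.of A (A ⧸ I) ⟶
    (ModuleCat.restrictScalars φ).obj (ModuleCat.of A (A ⧸ I)) :=
  ModuleCat.ofHom (Y := (ModuleCat.restrictScalars φ).obj (ModuleCat.of A (A ⧸ I)))
    { toFun := fun b => Ideal.quotientMap I φ hI b
      map_add' := map_add _
      map_smul' := by
        intro a b
        obtain ⟨b, rfl⟩ := Ideal.Quotient.mk_surjective b
        exact (Ideal.quotientMap_mk (f := φ) (I := I) (H := hI) (x := a * b)).trans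
          (by rw [map_mul]; rfl) }

/-- The `A`-module (killed by `I`) `R^a Hom_A(A/I, K)`. -/
abbrev RHomQuot (K : DKMod φ) (a : ℤ) : Type _ :=
  ShiftedHom ((DerivedCategory.singleFunctor _ 0).obj (ModuleCat.of A (A ⧸ I))) K.a a

/-- The `κ`-structure on `R^a Hom_A(A/I, K)`: the image of `e : A/I ⟶ K⟦a⟧` is the composite
`A/I ⟶ φ_*(A/I) ⟶ φ_* K⟦a⟧ ⟶ K⟦a⟧`. -/
def kappaRHom (K : DKMod φ) (a : ℤ) (e : RHomQuot I K a) : RHomQuot I K a :=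
  ((DerivedCategory.singleFunctor _ 0).map (quotFrob I hI) ≫
    ((ModuleCat.restrictScalars φ).mapDerivedCategorySingleFunctor 0).inv.app _) ≫
      e.map (ModuleCat.restrictScalars φ).mapDerivedCategory ≫ K.str⟦a⟧'

lemma kappaRHom_add (K : DKMod φ) (a : ℤ) (e e' : RHomQuot I K a) :
    kappaRHom I hI K a (e + e') = kappaRHom I hI K a e + kappaRHom I hI K a e' := by
  simp [kappaRHom]

lemma mapDerived_smul_id (r : A) (L : DerivedCategory (ModuleCat.{u} A)) :
    (ModuleCat.restrictScalars φ).mapDerivedCategory.map (φ r • 𝟙 L) = r • 𝟙 _ := by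
  let F' := (ModuleCat.restrictScalars φ).mapDerivedCategory
  have key (M : CochainComplex (ModuleCat.{u} A) ℤ) :
      F'.map (φ r • 𝟙 (DerivedCategory.Q.obj M)) = r • 𝟙 _ := by
    have h := (ModuleCat.restrictScalars φ).mapDerivedCategoryFactors_hom_naturality
      (φ r • 𝟙 M)
    have h2 : ((ModuleCat.restrictScalars φ).mapHomologicalComplex (ComplexShape.up ℤ)).map
        (φ r • 𝟙 M) = r • 𝟙 _ := by
      ext i x
      rfl
    rw [h2, Functor.map_smul DerivedCategory.Q, Functor.map_smul DerivedCategory.Q,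
      CategoryTheory.Functor.map_id DerivedCategory.Q, CategoryTheory.Functor.map_id DerivedCategory.Q,
      Linear.comp_smul] at h
    rw [← cancel_mono ((ModuleCat.restrictScalars φ).mapDerivedCategoryFactors.hom.app M)]
    refine (h.trans (congrArg (fun z => r • z) (Category.comp_id _))).trans ?_
    rw [Linear.smul_comp, Category.id_comp]
  let e := DerivedCategory.Q.objObjPreimageIso L
  have h1 : φ r • 𝟙 L = e.inv ≫ (φ r • 𝟙 _) ≫ e.hom := by simp
  change F'.map _ = _
  rw [h1, Functor.map_comp, Functor.map_comp, key, Linear.smul_comp, Linear.comp_smul,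
    Category.id_comp, ← Functor.map_comp, e.inv_hom_id, CategoryTheory.Functor.map_id]

lemma kappaRHom_smul (K : DKMod φ) (a : ℤ) (r : A) (e : RHomQuot I K a) :
    kappaRHom I hI K a (φ r • e) = r • kappaRHom I hI K a e := by
  have h : (ModuleCat.restrictScalars φ).mapDerivedCategory.map (φ r • e) =
      r • (ModuleCat.restrictScalars φ).mapDerivedCategory.map e := by
    have : φ r • e = (φ r • 𝟙 _) ≫ e := by simp
    rw [this, Functor.map_comp, mapDerived_smul_id, Linear.smul_comp, Category.id_comp]
  simp [kappaRHom, ShiftedHom.map, h]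

/-- A module with a self-map `κ` is the union of its `κ`-stable submodules on which `κ` is
nilpotent. -/
def LocNilMap (A : Type*) [CommRing A] {E : Type*} [AddCommGroup E] [Module A E] (k : E → E) :
    Prop :=
  ∀ v : E, ∃ N : Submodule A E, v ∈ N ∧ (∀ m ∈ N, k m ∈ N) ∧ ∃ n : ℕ, ∀ m ∈ N, k^[n] m = 0

end Alg

/-! `κ`-modules on `X × C` and their stalks along `X × C ⟶ X`. -/

section Stalk
variable {F : Type u} [Field F] [Finite F] {X : Scheme.{u}} (f : X ⟶ Spec (CommRingCat.of F))
variable (Λ : Type u) [CommRing Λ] [Algebra F Λ]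

instance : (Scheme.Modules.pushforward (sigma f Λ)).PreservesHomology :=
  pushforward_preservesHomology _ (isHomeomorph_sigma f Λ)

/-- `𝒪`-modules `V` on `X × C` with an `𝒪`-linear map `κ : (σ × id)_* V ⟶ V`. -/
abbrev KappaMod := Endofunctor.Algebra (Scheme.Modules.pushforward (sigma f Λ))

lemma sigma_preimage (U : X.Opens) : sigma f Λ ⁻¹ᵁ prX f Λ ⁻¹ᵁ U = prX f Λ ⁻¹ᵁ U := by
  change (sigma f Λ ≫ prX f Λ) ⁻¹ᵁ U = _
  rw [sigma_prX]
  rfl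

/-- The sheaf of rings `pr_{1,*} 𝒪` on `X`. -/
abbrev ringX : TopCat.Presheaf CommRingCat.{u} X :=
  (Opens.map (prX f Λ).base).op ⋙ (prodC f Λ).presheaf

/-- The `q`-Frobenius `σ × id` as an endomorphism of `pr_{1,*} 𝒪`. -/
def ringXFrob : ringX f Λ ⟶ ringX f Λ where
  app U := (sigma f Λ).appLE (prX f Λ ⁻¹ᵁ U.unop) (prX f Λ ⁻¹ᵁ U.unop)
    (sigma_preimage f Λ U.unop).ge
  naturality U V i := by
    exact (Scheme.Hom.map_appLE _ _ _).trans (Scheme.Hom.appLE_map _ _ _).symm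

/-- The stalk `A_x` of `pr_{1,*} 𝒪` at `x`, i.e. the coordinate ring of `Spec 𝒪_{X,x} × C`. -/
abbrev ringAt (x : X) : CommRingCat.{u} := (ringX f Λ).stalk x

/-- The endomorphism of `A_x` induced by `σ × id`. -/
def frobAt (x : X) : ringAt f Λ x →+* ringAt f Λ x :=
  ((TopCat.Presheaf.stalkFunctor CommRingCat x).map (ringXFrob f Λ)).hom

/-- The presheaf of modules `pr_{1,*} M` on `X`. -/
abbrev modX (M : (prodC f Λ).Modules) : PresheafOfModules (ringX f Λ ⋙ forget₂ _ _) :=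
  (PresheafOfModules.pushforward₀OfCommRingCat (Opens.map (prX f Λ).base) _).obj M.val

/-- The stalk at `x` of `pr_{1,*} M`, i.e. the pullback of `M` to `Spec 𝒪_{X,x} × C`. -/
abbrev stalkMod (M : (prodC f Λ).Modules) (x : X) : ModuleCat.{u} (ringAt f Λ x) :=
  ModuleCat.of _ (TopCat.Presheaf.stalk (C := Ab.{u}) (modX f Λ M).presheaf x)

/-- The class in the stalk at `x` of a section over the preimage of a neighbourhood of `x`. -/
def germAt (M : (prodC f Λ).Modules) (x : X) (U : X.Opens) (hx : x ∈ U) :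
    Γ(M, prX f Λ ⁻¹ᵁ U) →+ stalkMod f Λ M x :=
  (TopCat.Presheaf.germ (modX f Λ M).presheaf U x hx).hom

lemma germAt_smul (M : (prodC f Λ).Modules) (x : X) (U : X.Opens) (hx : x ∈ U)
    (r : Γ(prodC f Λ, prX f Λ ⁻¹ᵁ U)) (m : Γ(M, prX f Λ ⁻¹ᵁ U)) :
    germAt f Λ M x U hx (r • m) =
      ((ringX f Λ).germ U x hx).hom r • germAt f Λ M x U hx m :=
  PresheafOfModules.germ_smul (R := ringX f Λ) (modX f Λ M) x U hx r m

lemma exists_germAt (M : (prodC f Λ).Modules) (x : X) (r : ringAt f Λ x)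
    (m : stalkMod f Λ M x) :
    ∃ (U : X.Opens) (hx : x ∈ U) (r' : Γ(prodC f Λ, prX f Λ ⁻¹ᵁ U))
      (m' : Γ(M, prX f Λ ⁻¹ᵁ U)),
      ((ringX f Λ).germ U x hx).hom r' = r ∧ germAt f Λ M x U hx m' = m := by
  obtain ⟨U, hU, r', rfl⟩ := TopCat.Presheaf.exists_germ_eq (ringX f Λ) r
  obtain ⟨V, hV, m', rfl⟩ := TopCat.Presheaf.exists_germ_eq (C := Ab.{u})
    (modX f Λ M).presheaf m
  refine ⟨U ⊓ V, ⟨hU, hV⟩, (ringX f Λ).map (homOfLE inf_le_left).op r',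
    (modX f Λ M).presheaf.map (homOfLE inf_le_right).op m', ?_, ?_⟩
  · exact TopCat.Presheaf.germ_res_apply (ringX f Λ) _ _ _ _
  · exact TopCat.Presheaf.germ_res_apply (C := Ab.{u}) (modX f Λ M).presheaf _ _ _ _

lemma frobAt_germ (x : X) (U : X.Opens) (hx : x ∈ U) (r : Γ(prodC f Λ, prX f Λ ⁻¹ᵁ U)) :
    frobAt f Λ x (((ringX f Λ).germ U x hx).hom r) =
      ((ringX f Λ).germ U x hx).hom (((ringXFrob f Λ).app (op U)).hom r) :=
  TopCat.Presheaf.stalkFunctor_map_germ_apply U x hx (ringXFrob f Λ) r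

/-- The map of presheaves on `X` induced by a morphism of modules. -/
abbrev modXMap {M N : (prodC f Λ).Modules} (g : M ⟶ N) :
    (modX f Λ M).presheaf ⟶ (modX f Λ N).presheaf :=
  (PresheafOfModules.toPresheaf _).map
    ((PresheafOfModules.pushforward₀OfCommRingCat (Opens.map (prX f Λ).base) _).map g.val)

/-- The map on stalks induced by a morphism of modules. -/
def stalkModMap {M N : (prodC f Λ).Modules} (g : M ⟶ N) (x : X) :
    stalkMod f Λ M x →+ stalkMod f Λ N x :=
  ((TopCat.Presheaf.stalkFunctor Ab.{u} x).map (modXMap f Λ g)).hom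

lemma stalkModMap_germ {M N : (prodC f Λ).Modules} (g : M ⟶ N) (x : X) (U : X.Opens)
    (hx : x ∈ U) (m : Γ(M, prX f Λ ⁻¹ᵁ U)) :
    stalkModMap f Λ g x (germAt f Λ M x U hx m) =
      germAt f Λ N x U hx (g.app (prX f Λ ⁻¹ᵁ U) m) :=
  TopCat.Presheaf.stalkFunctor_map_germ_apply (C := Ab.{u}) (F := (modX f Λ M).presheaf)
    (G := (modX f Λ N).presheaf) U x hx (modXMap f Λ g) m

/-- The map `Γ(U × C, V) = Γ(U × C, (σ × id)_* V) → Γ(U × C, V)` induced by `κ`. -/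
def kappaOn (V : KappaMod f Λ) (U : X.Opens) :
    Γ(V.a, prX f Λ ⁻¹ᵁ U) →+ Γ(V.a, prX f Λ ⁻¹ᵁ U) :=
  (V.str.app (prX f Λ ⁻¹ᵁ U)).hom.comp
    (V.a.presheaf.map (homOfLE (sigma_preimage f Λ U).le).op).hom

lemma kappaOn_smul (V : KappaMod f Λ) (U : X.Opens) (r m) :
    kappaOn f Λ V U ((sigma f Λ).appLE (prX f Λ ⁻¹ᵁ U) (prX f Λ ⁻¹ᵁ U)
      (sigma_preimage f Λ U).ge r • m) = r • kappaOn f Λ V U m := by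
  refine Eq.trans ?_ (V.str.app_smul r _)
  refine congrArg (V.str.app (prX f Λ ⁻¹ᵁ U)) ?_
  refine (V.a.map_smul _ _ _).trans ?_
  refine congrArg (fun z => z • (show Γ(V.a, sigma f Λ ⁻¹ᵁ prX f Λ ⁻¹ᵁ U) from
    V.a.presheaf.map (homOfLE (sigma_preimage f Λ U).le).op m)) ?_
  exact congr($(((sigma f Λ).appLE_map _ _).trans (sigma f Λ).appLE_eq_app) r)

lemma kappaOn_res (V : KappaMod f Λ) {U U' : X.Opens} (i : U' ⟶ U) (m) :
    kappaOn f Λ V U' (V.a.presheaf.map ((Opens.map (prX f Λ).base).map i).op m) =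
      V.a.presheaf.map ((Opens.map (prX f Λ).base).map i).op (kappaOn f Λ V U m) := by
  have h := congr($(V.str.mapPresheaf.naturality ((Opens.map (prX f Λ).base).map i).op)
    (V.a.presheaf.map (homOfLE (sigma_preimage f Λ U).le).op m))
  refine Eq.trans ?_ h
  refine congrArg (V.str.app (prX f Λ ⁻¹ᵁ U')) ?_
  have h2 : ∀ {U₁ U₂ U₂' U₃ : (prodC f Λ).Opens} (a : U₂ ⟶ U₁) (b : U₃ ⟶ U₂) (a' : U₂' ⟶ U₁)
      (b' : U₃ ⟶ U₂') (z : Γ(V.a, U₁)),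
      V.a.presheaf.map b.op (V.a.presheaf.map a.op z) =
        V.a.presheaf.map b'.op (V.a.presheaf.map a'.op z) := by
    intro U₁ U₂ U₂' U₃ a b a' b' z
    rw [← CategoryTheory.comp_apply, ← CategoryTheory.comp_apply, ← Functor.map_comp,
      ← Functor.map_comp]
    rfl
  exact h2 ((Opens.map (prX f Λ).base).map i) (homOfLE (sigma_preimage f Λ U').le)
    (homOfLE (sigma_preimage f Λ U).le) _ m

lemma kappaOn_naturality {V W : KappaMod f Λ} (g : V ⟶ W) (U : X.Opens) (m) :
    kappaOn f Λ W U (g.f.app (prX f Λ ⁻¹ᵁ U) m) = g.f.app (prX f Λ ⁻¹ᵁ U) (kappaOn f Λ V U m) := by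
  have h := congr($(congrArg (fun z => Scheme.Modules.Hom.app z (prX f Λ ⁻¹ᵁ U)) g.h)
    (V.a.presheaf.map (homOfLE (sigma_preimage f Λ U).le).op m))
  refine Eq.trans ?_ h
  refine congrArg (W.str.app (prX f Λ ⁻¹ᵁ U)) ?_
  exact congr($((g.f.mapPresheaf.naturality (homOfLE (sigma_preimage f Λ U).le).op).symm) m)

/-- The maps `kappaOn` form a map of presheaves on `X`. -/
def kappaPre (V : KappaMod f Λ) : (modX f Λ V.a).presheaf ⟶ (modX f Λ V.a).presheaf where
  app U := AddCommGrpCat.ofHom (kappaOn f Λ V U.unop)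
  naturality U U' i := by
    ext m
    exact kappaOn_res f Λ V i.unop m

/-- The structure map on the stalk at `x`. -/
def kappaAt (V : KappaMod f Λ) (x : X) : stalkMod f Λ V.a x →+ stalkMod f Λ V.a x :=
  ((TopCat.Presheaf.stalkFunctor Ab.{u} x).map (kappaPre f Λ V)).hom

lemma kappaAt_germ (V : KappaMod f Λ) (x : X) (U : X.Opens)
    (hx : x ∈ U) (m : Γ(V.a, prX f Λ ⁻¹ᵁ U)) :
    kappaAt f Λ V x (germAt f Λ V.a x U hx m) =
      germAt f Λ V.a x U hx (kappaOn f Λ V U m) :=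
  TopCat.Presheaf.stalkFunctor_map_germ_apply (C := Ab.{u}) (F := (modX f Λ V.a).presheaf)
    (G := (modX f Λ V.a).presheaf) U x hx (kappaPre f Λ V) m

/-- The stalk at `x` of a `κ`-module. -/
def stalkK (V : KappaMod f Λ) (x : X) : KMod (frobAt f Λ x) where
  a := stalkMod f Λ V.a x
  str := ModuleCat.ofHom (X := (ModuleCat.restrictScalars (frobAt f Λ x)).obj (stalkMod f Λ V.a x))
    { toFun := kappaAt f Λ V x
      map_add' := map_add _
      map_smul' := by
        intro r m
        obtain ⟨U, hx, r, m, rfl, rfl⟩ := exists_germAt f Λ V.a x r m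
        change kappaAt f Λ V x (frobAt f Λ x _ • germAt f Λ V.a x U hx m) =
          _ • kappaAt f Λ V x (germAt f Λ V.a x U hx m)
        rw [RingHom.id_apply, frobAt_germ, ← germAt_smul, kappaAt_germ, kappaAt_germ, ← germAt_smul]
        exact congrArg _ (kappaOn_smul f Λ V U r m) }

lemma stalkModMap_eq {M N : (prodC f Λ).Modules} (g : M ⟶ N) (x : X)
    (k : stalkMod f Λ M x →+ stalkMod f Λ N x)
    (hk : ∀ (U : X.Opens) (hx : x ∈ U) (m : Γ(M, prX f Λ ⁻¹ᵁ U)),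
      k (germAt f Λ M x U hx m) = germAt f Λ N x U hx (g.app (prX f Λ ⁻¹ᵁ U) m)) :
    stalkModMap f Λ g x = k := by
  refine AddMonoidHom.ext fun m => ?_
  obtain ⟨U, hx, -, m, -, rfl⟩ := exists_germAt f Λ M x 0 m
  rw [stalkModMap_germ, hk]

lemma stalkModMap_id (M : (prodC f Λ).Modules) (x : X) :
    stalkModMap f Λ (𝟙 M) x = AddMonoidHom.id _ :=
  stalkModMap_eq _ _ _ _ _ fun _ _ _ => rfl

lemma stalkModMap_comp {M N P : (prodC f Λ).Modules} (g : M ⟶ N) (h : N ⟶ P) (x : X) :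
    stalkModMap f Λ (g ≫ h) x = (stalkModMap f Λ h x).comp (stalkModMap f Λ g x) := by
  refine stalkModMap_eq _ _ _ _ _ fun U hx m => ?_
  rw [AddMonoidHom.comp_apply, stalkModMap_germ, stalkModMap_germ]
  exact congrArg _ (CategoryTheory.comp_apply (g.app _) (h.app _) m).symm

lemma stalkModMap_add {M N : (prodC f Λ).Modules} (g h : M ⟶ N) (x : X) :
    stalkModMap f Λ (g + h) x = stalkModMap f Λ g x + stalkModMap f Λ h x := by
  refine stalkModMap_eq _ _ _ _ _ fun U hx m => ?_
  rw [AddMonoidHom.add_apply, stalkModMap_germ, stalkModMap_germ, ← map_add]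
  rfl

/-- The linear map on stalks induced by a morphism of modules. -/
def stalkModLin {M N : (prodC f Λ).Modules} (g : M ⟶ N) (x : X) :
    stalkMod f Λ M x ⟶ stalkMod f Λ N x :=
  ModuleCat.ofHom
    { toFun := stalkModMap f Λ g x
      map_add' := map_add _
      map_smul' := by
        intro r m
        obtain ⟨U, hx, r, m, rfl, rfl⟩ := exists_germAt f Λ M x r m
        rw [RingHom.id_apply, ← germAt_smul, stalkModMap_germ, stalkModMap_germ, ← germAt_smul,
          Scheme.Modules.Hom.app_smul] }

lemma stalkMod_hom_ext {x : X} {M N : (prodC f Λ).Modules}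
    {g h : stalkMod f Λ M x ⟶ stalkMod f Λ N x} (H : ∀ m, g.hom m = h.hom m) : g = h :=
  ModuleCat.hom_ext (LinearMap.ext H)

lemma stalkK_comm {V W : KappaMod f Λ} (g : V ⟶ W) (x : X) (m : stalkMod f Λ V.a x) :
    kappaAt f Λ W x (stalkModMap f Λ g.f x m) = stalkModMap f Λ g.f x (kappaAt f Λ V x m) := by
  obtain ⟨U, hx, -, m, -, rfl⟩ := exists_germAt f Λ V.a x 0 m
  rw [stalkModMap_germ, kappaAt_germ, kappaAt_germ, stalkModMap_germ, kappaOn_naturality]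

/-- The map on stalks induced by a morphism of `κ`-modules. -/
def stalkKMap {V W : KappaMod f Λ} (g : V ⟶ W) (x : X) : stalkK f Λ V x ⟶ stalkK f Λ W x where
  f := stalkModLin f Λ g.f x
  h := ModuleCat.hom_ext (LinearMap.ext (stalkK_comm f Λ g x))

/-- Passage to stalks at `x`, as a functor on `κ`-modules. -/
def stalkKFunctor (x : X) : KappaMod f Λ ⥤ KMod (frobAt f Λ x) where
  obj V := stalkK f Λ V x
  map g := stalkKMap f Λ g x
  map_id V := Endofunctor.Algebra.ext
    (stalkMod_hom_ext f Λ fun m => congr($(stalkModMap_id f Λ V.a x) m))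
  map_comp g h := Endofunctor.Algebra.ext
    (stalkMod_hom_ext f Λ fun m => congr($(stalkModMap_comp f Λ g.f h.f x) m))

instance (x : X) : (stalkKFunctor f Λ x).Additive where
  map_add {_ _ g h} := Endofunctor.Algebra.ext
    (stalkMod_hom_ext f Λ fun m => congr($(stalkModMap_add f Λ g.f h.f x) m))

/-- The map of sheaves of rings `𝒪_X → pr_{1,*} 𝒪`. -/
def toRingX : X.presheaf ⟶ ringX f Λ := (prX f Λ).c

/-- The ring homomorphism `𝒪_{X,x} → A_x`. -/
def toRingAt (x : X) : X.presheaf.stalk x →+* ringAt f Λ x :=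
  ((TopCat.Presheaf.stalkFunctor CommRingCat x).map (toRingX f Λ)).hom

lemma frobAt_toRingAt (x : X) (a : X.presheaf.stalk x) :
    frobAt f Λ x (toRingAt f Λ x a) = toRingAt f Λ x a ^ Nat.card F := by
  obtain ⟨U, hx, a, rfl⟩ := TopCat.Presheaf.exists_germ_eq X.presheaf a
  have h1 : toRingAt f Λ x (X.presheaf.germ U x hx a) =
      ((ringX f Λ).germ U x hx).hom ((prX f Λ).app U a) :=
    TopCat.Presheaf.stalkFunctor_map_germ_apply U x hx (toRingX f Λ) a
  rw [h1, frobAt_germ, ← map_pow]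
  refine congrArg _ ?_
  have h2 : (prX f Λ).app U ≫ (sigma f Λ).appLE _ (prX f Λ ⁻¹ᵁ U) (sigma_preimage f Λ U).ge =
      (frob f).app U ≫ (prX f Λ).app U := by
    have e1 : prX f Λ ⁻¹ᵁ U ≤ (sigma f Λ ≫ prX f Λ) ⁻¹ᵁ U := (sigma_preimage f Λ U).ge
    have e2 : prX f Λ ⁻¹ᵁ U ≤ (prX f Λ ≫ frob f) ⁻¹ᵁ U := le_rfl
    have e3 : (sigma f Λ ≫ prX f Λ).appLE U _ e1 = (prX f Λ ≫ frob f).appLE U _ e2 := by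
      simp only [sigma_prX]
    rw [Scheme.Hom.comp_appLE, Scheme.Hom.comp_appLE] at e3
    rw [e3, Scheme.Hom.app_eq_appLE (prX f Λ)]
    rfl
  refine congr($h2 a).trans ?_
  change (prX f Λ).app U ((frob f).app U a) = _
  rw [frob_app, map_pow]

/-- The ideal `𝔪_x A_x` of `A_x`, which defines the closed subscheme `x × C`. -/
def idealAt (x : X) : Ideal (ringAt f Λ x) :=
  (IsLocalRing.maximalIdeal (X.presheaf.stalk x)).map (toRingAt f Λ x)

lemma idealAt_le_comap (x : X) : idealAt f Λ x ≤ (idealAt f Λ x).comap (frobAt f Λ x) := by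
  rw [idealAt, Ideal.map_le_iff_le_comap]
  intro a ha
  rw [Ideal.mem_comap, Ideal.mem_comap, frobAt_toRingAt]
  exact Ideal.pow_mem_of_mem _ (Ideal.mem_map_of_mem _ ha) _ Nat.card_pos

/-- Let `K` be an object of the derived category of `A_x`-modules with a `κ`-structure.
Then `R^a Hom (A_x/𝔪_x A_x, K)`, the value of `R^a` of the `!`-pullback to `x × C`, is locally
nilpotent. (Its submodules over `A_x` are those over `A_x/𝔪_x A_x`.) -/
def LocNilShriek (x : X) (K : DKMod (frobAt f Λ x)) (a : ℤ) : Prop :=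
  LocNilMap (ringAt f Λ x) (kappaRHom (idealAt f Λ x) (idealAt_le_comap f Λ x) K a)

/-- `R^a i_x^! V` is locally nilpotent, for a `κ`-module `V`. -/
def LocNilAt (V : KappaMod f Λ) (x : X) (a : ℤ) : Prop :=
  LocNilShriek f Λ x (singleDKMod (stalkK f Λ V x)) a

/-- `R^a i_x^! V` is locally nilpotent, for a complex `V` of `κ`-modules. -/
def ComplexLocNilAt (V : CochainComplex (KappaMod f Λ) ℤ) (x : X) (a : ℤ) : Prop :=
  LocNilShriek f Λ x (toDKMod (((stalkKFunctor f Λ x).mapHomologicalComplex _).obj V)) a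

/-- A `κ`-sheaf is a `κ`-module whose underlying module is quasi-coherent. -/
def IsKappaSheaf (V : KappaMod f Λ) : Prop :=
  V.a.IsQuasicoherent

/-- The underlying sheaf is coherent (`X × C` is Noetherian in all cases of interest). -/
def IsCoh (V : KappaMod f Λ) : Prop :=
  V.a.IsQuasicoherent ∧ V.a.IsFiniteType

/-- `V` is the union of its `κ`-subsheaves with the property `P`: every section lies, locally,
in such a subsheaf. -/
def IsUnionOf (P : KappaMod f Λ → Prop) (V : KappaMod f Λ) : Prop :=
  ∀ (U : (prodC f Λ).Opens) (s : Γ(V.a, U)) (z : prodC f Λ), z ∈ U →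
    ∃ (W : (prodC f Λ).Opens) (h : W ≤ U) (N : KappaMod f Λ) (i : N ⟶ V),
      z ∈ W ∧ IsKappaSheaf f Λ N ∧ P N ∧ Mono i.f ∧
        ∃ t : Γ(N.a, W), i.f.app W t = V.a.presheaf.map (homOfLE h).op s

/-- `V` is locally nilpotent: it is the union of its nilpotent `κ`-subsheaves. -/
def IsLocNil (V : KappaMod f Λ) : Prop :=
  IsUnionOf f Λ IsNilp V

/-- `V` is ind-coherent: it is the union of its coherent `κ`-subsheaves. -/
def IsIndCoh (V : KappaMod f Λ) : Prop :=
  IsUnionOf f Λ (IsCoh f Λ) V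

/-- A complex of `κ`-sheaves whose cohomology is bounded below. -/
def IsKappaComplex (V : CochainComplex (KappaMod f Λ) ℤ) : Prop :=
  (∀ i, IsKappaSheaf f Λ (V.X i)) ∧ ∃ n : ℤ, ∀ i < n, (underlying V).ExactAt i

/-- All cohomology sheaves of the complex are locally nilpotent. -/
def IsCohNil (V : CochainComplex (KappaMod f Λ) ℤ) : Prop :=
  ∀ i, IsLocNil f Λ (cohomologyAlg V i)

end Stalk

end

end CartierSheaf

/-! Everything is read off from elements. On an affine open U of X let A be the ring of functions on
U × C, φ its endomorphism induced by σ × id, and k the additive map given by κ, so that k(φ(a)v) = a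
k(v). On functions r pulled back from X the map φ is the q-power map, hence k^n(r^(q^n) v) = r
k^n(v): denominators from X pass through iterates, and iteration turns high powers of r into r. A
section v is `LN` if some k^n kills Av. Ind-coherence and finiteness of σ serve one purpose: all
submodules k^n(Av) are finitely generated (`QK`). Under this condition the largest subsheaf killed
by κ^n is quasi-coherent, and local nilpotence of the sheaf amounts to `LN` for its sections over
affine U (`IsLocNil.ln`, `isLocNil_of_ln`).

Reduction to points (`LN.of_forall_prime`): the annihilators of k^n(Av) in the functions on U
increase with n and stabilize. If the stable value were proper, locally at a minimal prime p above
it its radical would be p; further iteration turns powers of elements of p into these elements, so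
that k^n(av) for large n is killed by p locally at p. It is therefore enough to know nilpotence at
each point x for elements killed by the maximal ideal of x, that is, for elements of Hom(B_x, V_x).
This settles single sheaves with R^0 alone.

For complexes, resolve B_x over the Noetherian ring A_x by finite projective modules P in degrees ≤
0 and lift B_x → φ_*B_x to θ : P → φ_*P. Then R^a Hom consists of homotopy classes of maps g : P →
V_x[a], and κ acts by g ↦ κ ∘ φ_*g ∘ θ (`kappaRHom_psi`). If the cohomology is locally nilpotent,
the top component of g takes cycles as values, these become boundaries after iteration, and a
homotopy removes the component; this continues down to the degrees where the complex is exact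
(`evNil_psi`). Conversely, suppose the cohomology below degree i is locally nilpotent. A class h in
degree i killed by the maximal ideal is extended to a map out of P degree by degree; each
obstruction is a family of lower cohomology classes and dies after iteration (`evNil_of_extends`).
Nilpotence of the resulting map gives nilpotence of h, and induction on i finishes, as the
cohomology is bounded below.

In both arguments the exponent at each stage depends on the multipliers chosen before, so they yield
only the transfinite notion `EvNil`; finite generation turns it into `LN` (`EvNil.ln`). Finiteness
is used for the terms of the complex in the first argument and only for its cohomology in the
second, which accounts for the single implication when just the cohomology is ind-coherent. -/

namespace CartierSheaf

/-! ### Semilinear algebra: nilpotence, finite generation and reduction to primes -/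

section Semilinear

variable {A : Type*} [CommRing A] {φ : A →+* A} {E E' : Type*} [AddCommGroup E] [Module A E]
  [AddCommGroup E'] [Module A E']

/-- An additive self-map `k` with `k (φ a • v) = a • k v`. -/
def IsKappa (φ : A →+* A) (k : E →+ E) : Prop := ∀ a v, k (φ a • v) = a • k v

lemma IsKappa.iterate_smul {k : E →+ E} (hk : IsKappa φ k) (n : ℕ) (a : A) (v : E) :
    k^[n] (φ^[n] a • v) = a • k^[n] v := by
  induction n generalizing v with
  | zero => rfl
  | succ n ih => rw [Function.iterate_succ_apply, Function.iterate_succ_apply',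
      Function.iterate_succ_apply, hk, ih]

lemma iterate_add (k : E →+ E) (n : ℕ) (v w : E) : k^[n] (v + w) = k^[n] v + k^[n] w :=
  iterate_map_add k n v w

lemma iterate_sum (k : E →+ E) (n : ℕ) {ι : Type*} (T : Finset ι) (f : ι → E) :
    k^[n] (∑ t ∈ T, f t) = ∑ t ∈ T, k^[n] (f t) := by
  classical
  induction T using Finset.induction_on with
  | empty => simp [iterate_map_zero]
  | insert a s ha ih => rw [Finset.sum_insert ha, Finset.sum_insert ha, iterate_add, ih]

lemma iterate_eq_zero_of_le (k : E →+ E) {m n : ℕ} (h : m ≤ n) {v : E} (hv : k^[m] v = 0) :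
    k^[n] v = 0 := by
  obtain ⟨d, rfl⟩ := Nat.exists_eq_add_of_le' h
  rw [Function.iterate_add_apply, hv, iterate_map_zero]

lemma iterate_comm_apply {k : E →+ E} {k' : E' →+ E'} {F : Type*} [FunLike F E E'] (g : F)
    (h : ∀ v, g (k v) = k' (g v)) (n : ℕ) (v : E) : g (k^[n] v) = k'^[n] (g v) := by
  induction n generalizing v with
  | zero => rfl
  | succ n ih => rw [Function.iterate_succ_apply, Function.iterate_succ_apply, ih, h]

/-- The submodule `k^n (M)`. -/
def IsKappa.powMap {k : E →+ E} (hk : IsKappa φ k) (n : ℕ) (M : Submodule A E) :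
    Submodule A E where
  carrier := {w | ∃ v ∈ M, k^[n] v = w}
  add_mem' := by
    rintro _ _ ⟨a, ha, rfl⟩ ⟨b, hb, rfl⟩
    exact ⟨a + b, M.add_mem ha hb, iterate_add k n _ _⟩
  zero_mem' := ⟨0, M.zero_mem, iterate_map_zero k n⟩
  smul_mem' := by
    rintro a _ ⟨b, hb, rfl⟩
    exact ⟨φ^[n] a • b, M.smul_mem _ hb, hk.iterate_smul n a b⟩

/-- The submodule `k^n (A v)`. -/
def IsKappa.powSpan {k : E →+ E} (hk : IsKappa φ k) (n : ℕ) (v : E) : Submodule A E :=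
  hk.powMap n (Submodule.span A {v})

lemma IsKappa.mem_powSpan {k : E →+ E} (hk : IsKappa φ k) {n : ℕ} {v w : E} :
    w ∈ hk.powSpan n v ↔ ∃ a : A, k^[n] (a • v) = w := by
  constructor
  · rintro ⟨_, h, rfl⟩
    obtain ⟨a, rfl⟩ := Submodule.mem_span_singleton.1 h
    exact ⟨a, rfl⟩
  · rintro ⟨a, rfl⟩
    exact ⟨_, Submodule.smul_mem _ _ (Submodule.mem_span_singleton_self _), rfl⟩

variable (A) in
/-- Some iterate of `k` vanishes on the submodule generated by `v`. -/
def LN (k : E → E) (v : E) : Prop := ∃ n : ℕ, ∀ a : A, k^[n] (a • v) = 0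

/-- Local nilpotence, transfinitely iterated. -/
inductive EvNil (A : Type*) [CommRing A] {E : Type*} [AddCommGroup E] [Module A E]
    (k : E → E) : E → Prop
  | zero : EvNil A k 0
  | step (v : E) (n : ℕ) (h : ∀ a : A, EvNil A k (k^[n] (a • v))) : EvNil A k v

lemma LN.evNil {k : E → E} {v : E} (h : LN A k v) : EvNil A k v := by
  obtain ⟨n, hn⟩ := h
  exact .step v n fun a => by rw [hn a]; exact .zero

lemma LN.sum_span {k : E →+ E} {T : Set E} (hT : T.Finite) (h : ∀ w ∈ T, LN A k w) :
    ∃ n : ℕ, ∀ v ∈ Submodule.span A T, k^[n] v = 0 := by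
  choose! n hn using h
  obtain ⟨N, hN⟩ := (hT.image n).bddAbove
  refine ⟨N, fun v hv => ?_⟩
  have key : ∀ a : A, k^[N] (a • v) = 0 := by
    induction hv using Submodule.span_induction with
    | mem w hw => exact fun a => iterate_eq_zero_of_le k (hN ⟨w, hw, rfl⟩) (hn w hw a)
    | zero => intro a; rw [smul_zero, iterate_map_zero]
    | add x y _ _ hx hy => intro a; rw [smul_add, iterate_add, hx, hy, add_zero]
    | smul b x _ hx => intro a; rw [smul_smul]; exact hx _
  simpa using key 1

/-- The module k^n(Av) is generated by finitely many elements k^n(av), each `LN` by induction. A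
single exponent m then kills all of it, so m + n works for v. Stability of S keeps these elements
within reach of the finiteness hypothesis. -/
lemma EvNil.ln {k : E →+ E} (hk : IsKappa φ k) (S : Submodule A E) (hS : ∀ v ∈ S, k v ∈ S)
    (hfg : ∀ v ∈ S, ∀ n, (hk.powSpan n v).FG) {v : E} (hv : EvNil A k v) (hvS : v ∈ S) :
    LN A k v := by
  induction hv with
  | zero => exact ⟨0, fun a => by simp⟩
  | step v n _ ih =>
    have hS' : ∀ m : ℕ, ∀ w ∈ S, k^[m] w ∈ S := by
      intro m
      induction m with
      | zero => exact fun _ h => h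
      | succ m ih => exact fun w hw => by rw [Function.iterate_succ_apply]; exact ih _ (hS _ hw)
    obtain ⟨T, hT⟩ := hfg v hvS n
    obtain ⟨m, hm⟩ := LN.sum_span (A := A) (k := k) T.finite_toSet fun w hw => by
      have : w ∈ hk.powSpan n v := hT ▸ Submodule.subset_span hw
      obtain ⟨a, rfl⟩ := hk.mem_powSpan.1 this
      exact ih a (hS' _ _ (S.smul_mem _ hvS))
    refine ⟨m + n, fun a => ?_⟩
    rw [Function.iterate_add_apply]
    exact hm _ (hT ▸ hk.mem_powSpan.2 ⟨a, rfl⟩)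

/-- The sum of all k^j(Av) is the smallest stable submodule containing v, and k^n commutes with k^j,
so an exponent that works on Av works on this sum. -/
lemma locNilMap_iff {k : E →+ E} (hk : IsKappa φ k) : LocNilMap A k ↔ ∀ v, LN A k v := by
  constructor
  · intro h v
    obtain ⟨N, hv, -, n, hn⟩ := h v
    exact ⟨n, fun a => hn _ (N.smul_mem a hv)⟩
  · intro h v
    obtain ⟨n, hn⟩ := h v
    let N : Submodule A E := ⨆ j : ℕ, hk.powSpan j v
    have hle : ∀ j, hk.powSpan j v ≤ N := le_iSup _
    refine ⟨N, hle 0 (hk.mem_powSpan.2 ⟨1, one_smul _ _⟩), fun m hm => ?_, n, fun m hm => ?_⟩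
    · induction hm using Submodule.iSup_induction' with
      | mem j x hx =>
        obtain ⟨a, rfl⟩ := hk.mem_powSpan.1 hx
        exact hle (j + 1) (hk.mem_powSpan.2 ⟨a, Function.iterate_succ_apply' _ _ _⟩)
      | zero => rw [map_zero]; exact N.zero_mem
      | add x y _ _ hx hy => rw [map_add]; exact N.add_mem hx hy
    · induction hm using Submodule.iSup_induction' with
      | mem j x hx =>
        obtain ⟨a, rfl⟩ := hk.mem_powSpan.1 hx
        rw [← Function.iterate_add_apply, add_comm, Function.iterate_add_apply, hn,
          iterate_map_zero]
      | zero => rw [iterate_map_zero]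
      | add x y _ _ hx hy => rw [iterate_add, hx, hy, add_zero]

lemma IsKappa.powMap_map {k : E →+ E} {k' : E' →+ E'} (hk : IsKappa φ k) (hk' : IsKappa φ k')
    (g : E →ₗ[A] E') (h : ∀ v, g (k v) = k' (g v)) (n : ℕ) (v : E) :
    hk'.powSpan n (g v) = (hk.powSpan n v).map g := by
  ext w
  rw [hk'.mem_powSpan, Submodule.mem_map]
  constructor
  · rintro ⟨a, rfl⟩
    exact ⟨_, hk.mem_powSpan.2 ⟨a, rfl⟩, by rw [iterate_comm_apply g h, map_smul]⟩
  · rintro ⟨_, hv, rfl⟩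
    obtain ⟨a, rfl⟩ := hk.mem_powSpan.1 hv
    exact ⟨a, by rw [iterate_comm_apply g h, map_smul]⟩

/-- If T generates A over itself via φ, semilinearity gives k(Av) = Σ A k(tv) over t ∈ T, and so
k^(n+1)(Av) is the sum of the modules k^n(A k(tv)). -/
lemma IsKappa.powSpan_fg_of_finite {k : E →+ E} (hk : IsKappa φ k) (hφ : φ.Finite) (n : ℕ)
    (v : E) : (hk.powSpan n v).FG := by
  induction n generalizing v with
  | zero =>
    refine ⟨{v}, le_antisymm ?_ fun w hw => ?_⟩
    · rw [Submodule.span_le]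
      intro w hw
      rw [Finset.mem_coe, Finset.mem_singleton] at hw
      exact hk.mem_powSpan.2 ⟨1, by rw [hw]; exact one_smul _ _⟩
    · obtain ⟨a, rfl⟩ := hk.mem_powSpan.1 hw
      exact Submodule.smul_mem _ _ (Submodule.subset_span (by simp))
  | succ n ih =>
    obtain ⟨T, hT⟩ : ∃ T : Finset A, ∀ a : A, ∃ c : A → A, a = ∑ t ∈ T, φ (c t) * t := by
      let _ := φ.toAlgebra
      let _ : Module A A := φ.toAlgebra.toModule
      obtain ⟨T, hT⟩ := @Module.Finite.fg_top A A _ _ φ.toAlgebra.toModule hφ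
      refine ⟨T, fun a => ?_⟩
      obtain ⟨c, -, hc⟩ := (@Submodule.mem_span_finset A A _ _ φ.toAlgebra.toModule _ _).1
        (hT.symm ▸ @Submodule.mem_top A A _ _ φ.toAlgebra.toModule a)
      exact ⟨c, hc.symm⟩
    have : hk.powSpan (n + 1) v = ⨆ t ∈ T, hk.powSpan n (k (t • v)) := by
      refine le_antisymm (fun w hw => ?_) (iSup₂_le fun t _ w hw => ?_)
      · obtain ⟨a, rfl⟩ := hk.mem_powSpan.1 hw
        obtain ⟨c, rfl⟩ := hT a
        rw [Function.iterate_succ_apply, Finset.sum_smul, map_sum, iterate_sum]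
        refine Submodule.sum_mem _ fun t ht => ?_
        rw [mul_smul, hk]
        exact (le_iSup₂ (f := fun t (_ : t ∈ T) => hk.powSpan n (k (t • v))) t ht)
          (hk.mem_powSpan.2 ⟨_, rfl⟩)
      · obtain ⟨a, rfl⟩ := hk.mem_powSpan.1 hw
        refine hk.mem_powSpan.2 ⟨φ a * t, ?_⟩
        rw [Function.iterate_succ_apply, mul_smul, hk]
    rw [this]
    exact Submodule.fg_biSup _ _ fun t _ => ih _

lemma IsKappa.powSpan_fg_of_mem {k : E →+ E} [IsNoetherianRing A] (hk : IsKappa φ k)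
    {M : Submodule A E} (hM : M.FG) (hkM : ∀ v ∈ M, k v ∈ M) {v : E} (hv : v ∈ M) (n : ℕ) :
    (hk.powSpan n v).FG := by
  have := isNoetherian_of_fg_of_noetherian M hM
  refine Submodule.FG.of_le (T := M) hM fun w hw => ?_
  obtain ⟨a, rfl⟩ := hk.mem_powSpan.1 hw
  have : ∀ m : ℕ, ∀ w ∈ M, k^[m] w ∈ M := by
    intro m
    induction m with
    | zero => exact fun _ h => h
    | succ m ih => exact fun w hw => by rw [Function.iterate_succ_apply]; exact ih _ (hkM _ hw)
  exact this n _ (M.smul_mem a hv)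

/-- If, for every prime `p` of `R`, the elements which locally at `p` are killed by `p` are
locally nilpotent locally at `p`, then local nilpotence holds. -/
theorem LN.of_forall_prime {R : Type*} [CommRing R] [IsNoetherianRing R] [Algebra R A]
    [Module R E] [IsScalarTower R A E] {q : ℕ} (hq : 1 < q)
    (hφ : ∀ r : R, φ (algebraMap R A r) = algebraMap R A r ^ q)
    {k : E →+ E} (hk : IsKappa φ k) {v : E} (hfg : ∀ n, (hk.powSpan n v).FG)
    (H : ∀ (p : Ideal R) [p.IsPrime] (w : E), (∀ r ∈ p, ∃ s ∉ p, s • r • w = 0) →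
      ∃ n, ∀ a : A, ∃ s ∉ p, s • k^[n] (a • w) = 0) : LN A k v := by
  classical
  have hφn (n : ℕ) (r : R) : φ^[n] (algebraMap R A r) = algebraMap R A (r ^ q ^ n) := by
    induction n generalizing r with
    | zero => simp
    | succ n ih => rw [Function.iterate_succ_apply, hφ, ← map_pow, ih, ← pow_mul, pow_succ']
  have hkR (n : ℕ) (r : R) (w : E) : k^[n] (r ^ q ^ n • w) = r • k^[n] w := by
    rw [← algebraMap_smul A, ← hφn, hk.iterate_smul, algebraMap_smul]
  -- the annihilators
  let J : ℕ →o Ideal R :=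
    { toFun n :=
        { carrier := {r | ∀ a : A, r • k^[n] (a • v) = 0}
          add_mem' := fun ha hb a => by rw [add_smul, ha, hb, add_zero]
          zero_mem' := fun a => zero_smul _ _
          smul_mem' := fun c r hr a => by rw [smul_assoc, hr, smul_zero] }
      -- Here r k(w) = k(r^q w), and r^q is a multiple of r because q ≥ 1.
      monotone' := monotone_nat_of_le_succ fun n r hr a => by
        obtain ⟨d, hd⟩ := Nat.exists_eq_add_of_le' hq.le
        have h1 := hkR 1 r (k^[n] (a • v))
        rw [pow_one, hd, pow_succ, mul_smul, hr a, smul_zero, iterate_map_zero] at h1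
        rw [Function.iterate_succ_apply']
        exact h1.symm }
  have hJ (n r) : r ∈ J n ↔ ∀ a : A, r • k^[n] (a • v) = 0 := Iff.rfl
  obtain ⟨n₀, hn₀⟩ := monotone_stabilizes_iff_noetherian.2 ‹IsNoetherianRing R› J
  by_cases htop : J n₀ = ⊤
  · refine ⟨n₀, fun a => ?_⟩
    have : (1 : R) ∈ J n₀ := htop ▸ Submodule.mem_top
    simpa using (hJ _ _).1 this a
  exfalso
  -- The stable annihilator being proper, take a minimal prime p over it. Locally at p its radical
  -- is p, which is `hrad`. The contradiction will be an element of the stable annihilator outside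
  -- p.
  obtain ⟨p, hp⟩ := Ideal.nonempty_minimalPrimes htop
  have hpp : p.IsPrime := hp.1.1
  have hrad : ∀ r ∈ p, ∃ s ∉ p, ∃ N : ℕ, s * r ^ N ∈ J n₀ := by
    intro r hr
    by_contra! hcon
    obtain ⟨P, hP, hJP, hdis⟩ := Ideal.exists_le_prime_disjoint (J n₀)
      (p.primeCompl ⊔ Submonoid.powers r) <| by
        rw [Set.disjoint_left]
        intro x hx hx'
        obtain ⟨s, hs, _, ⟨N, rfl⟩, rfl⟩ := Submonoid.mem_sup.1 hx'
        exact hcon s hs N hx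
    have hPp : P ≤ p := fun x hx => by
      by_contra hxp
      exact Set.disjoint_left.1 hdis hx (Submonoid.mem_sup_left hxp)
    exact Set.disjoint_left.1 hdis (hp.2 ⟨hP, hJP⟩ hPp hr)
      (Submonoid.mem_sup_right (Submonoid.mem_powers r))
  obtain ⟨T, hT⟩ := (inferInstance : IsNoetherianRing R).noetherian p
  have hTp : ∀ t ∈ T, t ∈ p := fun t ht => hT ▸ Submodule.subset_span ht
  choose! s hs N hN using fun t ht => hrad t (hTp t ht)
  obtain ⟨M, hM⟩ := (T.finite_toSet.image N).bddAbove
  have hMj : M ≤ q ^ M := (Nat.lt_pow_self hq).le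
  -- Since k^M(x^(q^M) w) = x k^M(w) and q^M is at least every N t, the relation s t^N ∈ J n₀ gives
  -- that s t kills k^(M+n₀)(av). So these elements are killed by p locally at p, and `H` applies to
  -- them.
  have hkill (a : A) : ∀ r ∈ p, ∃ s ∉ p, s • r • k^[M] (k^[n₀] (a • v)) = 0 := by
    intro r hr
    rw [← hT] at hr
    induction hr using Submodule.span_induction with
    | mem t ht =>
      refine ⟨s t, hs t ht, ?_⟩
      rw [← mul_smul, ← hkR]
      have : (s t * t) ^ q ^ M ∈ J n₀ := by
        have h1 : 1 ≤ q ^ M := Nat.one_le_pow _ _ (by lia)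
        have h2 : N t ≤ q ^ M := (hM ⟨t, ht, rfl⟩).trans hMj
        rw [mul_pow, ← Nat.sub_add_cancel h1, pow_succ, Nat.sub_add_cancel h1,
          ← Nat.sub_add_cancel h2, pow_add, Nat.sub_add_cancel h2]
        convert! Ideal.mul_mem_left _ (s t ^ (q ^ M - 1) * t ^ (q ^ M - N t)) (hN t ht) using 1
        ring
      rw [(hJ _ _).1 this, iterate_map_zero]
    | zero => exact ⟨1, p.ne_top_iff_one.1 hpp.ne_top, by simp⟩
    | add x y _ _ hx hy =>
      obtain ⟨s, hs, h⟩ := hx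
      obtain ⟨s', hs', h'⟩ := hy
      refine ⟨s * s', hpp.mul_notMem hs hs', ?_⟩
      rw [add_smul, smul_add, mul_comm, mul_smul, h, mul_comm, mul_smul, h', smul_zero, smul_zero,
        add_zero]
    | smul c x _ hx =>
      obtain ⟨s, hs, h⟩ := hx
      exact ⟨s, hs, by rw [smul_assoc, smul_comm, h, smul_zero]⟩
  -- `H` gives an exponent for one element at a time; finitely many generators of k^(M+n₀)(Av) yield
  -- a common exponent m.
  obtain ⟨T', hT'⟩ := hfg (M + n₀)
  have hT'n : ∀ w ∈ T', ∃ n, ∀ a : A, ∃ s ∉ p, s • k^[n] (a • w) = 0 := fun w hw => by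
    have : w ∈ hk.powSpan (M + n₀) v := hT' ▸ Submodule.subset_span hw
    obtain ⟨a, rfl⟩ := hk.mem_powSpan.1 this
    rw [Function.iterate_add_apply]
    exact H p _ (hkill a)
  choose! n hn using hT'n
  obtain ⟨m, hm⟩ := (T'.finite_toSet.image n).bddAbove
  have hmm : ∀ w ∈ T', ∀ a : A, ∃ s ∉ p, s • k^[m] (a • w) = 0 := by
    intro w hw a
    obtain ⟨s, hs, h⟩ := hn w hw a
    obtain ⟨d, hd⟩ := Nat.exists_eq_add_of_le' (hm ⟨w, hw, rfl⟩)
    refine ⟨s, hs, ?_⟩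
    rw [hd]
    obtain ⟨e, he⟩ := Nat.exists_eq_add_of_le' (Nat.one_le_pow d q (by lia))
    have h2 := hkR d s (k^[n w] (a • w))
    rw [he, pow_succ, mul_smul, h, smul_zero, iterate_map_zero] at h2
    rw [Function.iterate_add_apply, ← h2]
  have hall : ∀ w ∈ Submodule.span A (T' : Set E), ∃ s ∉ p, s • k^[m] w = 0 := by
    intro w hw
    obtain ⟨c, -, rfl⟩ := Submodule.mem_span_finset.1 hw
    choose! s hs h using fun w hw => hmm w hw (c w)
    refine ⟨∏ w ∈ T', s w, fun hmem => ?_, ?_⟩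
    · obtain ⟨w, hw, hw'⟩ := (hpp.prod_mem_iff).1 hmem
      exact hs w hw hw'
    · rw [iterate_sum, Finset.smul_sum]
      refine Finset.sum_eq_zero fun w hw => ?_
      rw [← Finset.prod_erase_mul _ _ hw, mul_smul, h w hw, smul_zero]
  -- So far the denominator depends on the element. Finite generation once more yields one
  -- denominator outside p that kills all of k^(m+M+n₀)(Av); it lies in the stable annihilator,
  -- hence in p.
  obtain ⟨T₃, hT₃⟩ := hfg (m + (M + n₀))
  have hT₃s : ∀ w ∈ T₃, ∃ s ∉ p, s • w = 0 := fun w hw => by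
    have : w ∈ hk.powSpan (m + (M + n₀)) v := hT₃ ▸ Submodule.subset_span hw
    obtain ⟨a, rfl⟩ := hk.mem_powSpan.1 this
    rw [Function.iterate_add_apply]
    exact hall _ (hT' ▸ hk.mem_powSpan.2 ⟨a, rfl⟩)
  choose! s' hs' h' using hT₃s
  have hmem : ∏ w ∈ T₃, s' w ∈ J (m + (M + n₀)) := by
    intro a
    have : k^[m + (M + n₀)] (a • v) ∈ Submodule.span A (T₃ : Set E) :=
      hT₃ ▸ hk.mem_powSpan.2 ⟨a, rfl⟩
    obtain ⟨c, -, hc⟩ := Submodule.mem_span_finset.1 this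
    rw [← hc, Finset.smul_sum]
    refine Finset.sum_eq_zero fun w hw => ?_
    rw [← Finset.prod_erase_mul _ _ hw, mul_smul, smul_comm (s' w), h' w hw, smul_zero, smul_zero]
  rw [← hn₀ _ (by lia)] at hmem
  obtain ⟨w, hw, hw'⟩ := (hpp.prod_mem_iff).1 (hp.1.2 hmem)
  exact hs' w hw hw'

end Semilinear

end CartierSheaf

/-! ### Finite projective resolutions and κ on derived Hom at the level of complexes -/

namespace CartierSheaf

noncomputable section

section FGResolution

variable {A : Type u} [CommRing A]

instance [IsNoetherianRing A] : EnoughProjectives (FGModuleCat.{u} A) where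
  presentation M := by
    obtain ⟨n, g, hg⟩ := Module.Finite.exists_fin' A M
    let c : FGModuleCat.of A (ULift.{u} (Fin n) → A) ⟶ M :=
      FGModuleCat.ofHom (g ∘ₗ (LinearEquiv.funCongrLeft A A Equiv.ulift.symm).toLinearMap)
    have hproj : Projective (FGModuleCat.of A (ULift.{u} (Fin n) → A)) := by
      refine { factors := fun {E X} f e he => ?_ }
      have he' : Function.Surjective e.hom.hom := by
        have : Epi ((forget₂ (FGModuleCat A) (ModuleCat A)).map e) := inferInstance
        exact (ModuleCat.epi_iff_surjective _).1 this
      obtain ⟨h, hh⟩ := Module.projective_lifting_property e.hom.hom f.hom.hom he'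
      exact ⟨FGModuleCat.ofHom h, FGModuleCat.hom_ext hh⟩
    have hc : Epi c := by
      apply (forget₂ (FGModuleCat A) (ModuleCat A)).epi_of_epi_map
      rw [ModuleCat.epi_iff_surjective]
      exact hg.comp (LinearEquiv.surjective _)
    exact ⟨{ p := FGModuleCat.of A (ULift.{u} (Fin n) → A), f := c }⟩

/-- A projective object among finite modules is a retract of a finite free module. -/
lemma projective_of_projective_fgModuleCat [IsNoetherianRing A] (M : FGModuleCat.{u} A)
    [Projective M] : Projective ((forget₂ (FGModuleCat A) (ModuleCat A)).obj M) := by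
  obtain ⟨n, g, hg⟩ := Module.Finite.exists_fin' A M
  let c : FGModuleCat.of A (ULift.{u} (Fin n) → A) ⟶ M :=
    FGModuleCat.ofHom (g ∘ₗ (LinearEquiv.funCongrLeft A A Equiv.ulift.symm).toLinearMap)
  have : Epi c := by
    apply (forget₂ (FGModuleCat A) (ModuleCat A)).epi_of_epi_map
    rw [ModuleCat.epi_iff_surjective]
    exact hg.comp (LinearEquiv.surjective _)
  have hP : Projective (ModuleCat.of A (ULift.{u} (Fin n) → A)) :=
    ModuleCat.projective_of_free (Pi.basisFun A (ULift.{u} (Fin n)))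
  let s : M ⟶ FGModuleCat.of A (ULift.{u} (Fin n) → A) := Projective.factorThru (𝟙 M) c
  have hs : s ≫ c = 𝟙 M := Projective.factorThru_comp _ _
  let r : Retract ((forget₂ (FGModuleCat A) (ModuleCat A)).obj M)
      (ModuleCat.of A (ULift.{u} (Fin n) → A)) :=
    { i := (forget₂ (FGModuleCat A) (ModuleCat A)).map s
      r := (forget₂ (FGModuleCat A) (ModuleCat A)).map c
      retract := by rw [← Functor.map_comp, hs]; rfl }
  exact r.projective

/-- A resolution of a module by finitely generated projective modules, as a cochain complex. -/
structure FinRes (B : ModuleCat.{u} A) where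
  /-- the complex -/
  P : CochainComplex (ModuleCat.{u} A) ℤ
  /-- the augmentation -/
  ε : P ⟶ (CochainComplex.singleFunctor _ 0).obj B
  quasiIso : QuasiIso ε
  le : P.IsStrictlyLE 0
  projective : ∀ n, Projective (P.X n)
  finite : ∀ n, Module.Finite A (P.X n)
  surjective : Function.Surjective (ε.f 0)

attribute [instance] FinRes.quasiIso FinRes.le FinRes.projective FinRes.finite

/-- Over a Noetherian ring the finite modules form an abelian category with enough projectives. A
resolution taken there is carried to all modules by the exact inclusion. -/
lemma exists_finRes [IsNoetherianRing A] (B : ModuleCat.{u} A) [Module.Finite A B] :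
    Nonempty (FinRes B) := by
  let U := forget₂ (FGModuleCat A) (ModuleCat A)
  let R := ProjectiveResolution.of (FGModuleCat.of A B)
  have hc : ∀ n, Projective (R.cochainComplex.X n) := inferInstance
  refine ⟨⟨(U.mapHomologicalComplex _).obj R.cochainComplex,
    (U.mapHomologicalComplex _).map R.π' ≫ (U.mapCochainComplexSingleFunctor 0).hom.app _,
    inferInstance, ?_, fun n => ?_, fun n => ?_, ?_⟩⟩
  · rw [CochainComplex.isStrictlyLE_iff]
    intro i hi
    exact U.map_isZero (CochainComplex.isZero_of_isStrictlyLE R.cochainComplex 0 i hi)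
  · exact projective_of_projective_fgModuleCat _
  · exact inferInstanceAs (Module.Finite A (R.cochainComplex.X n))
  · have h1 : Epi (R.π'.f 0) := by
      rw [R.π'_f_zero]
      have e0 : Epi (R.π.f 0) := inferInstance
      have e1 : Epi ((HomologicalComplex.singleObjXSelf (ComplexShape.up ℤ) 0
        (FGModuleCat.of A B)).inv) := inferInstance
      have e2 : Epi (R.cochainComplexXIso 0 0 (by simp)).hom := inferInstance
      exact epi_comp' e2 (epi_comp' inferInstance e1)
    have h2 : Epi (((U.mapHomologicalComplex (ComplexShape.up ℤ)).map R.π' ≫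
        (U.mapCochainComplexSingleFunctor 0).hom.app _).f 0) := by
      rw [HomologicalComplex.comp_f]
      have : Epi (((U.mapHomologicalComplex (ComplexShape.up ℤ)).map R.π').f 0) :=
        inferInstanceAs (Epi (U.map (R.π'.f 0)))
      infer_instance
    exact (ModuleCat.epi_iff_surjective _).1 h2

lemma FinRes.isKProjective {B : ModuleCat.{u} A} (R : FinRes B) : R.P.IsKProjective :=
  CochainComplex.isKProjective_of_projective _ 0

end FGResolution

/-- Out of a K-projective complex, morphisms in the homotopy and derived categories coincide.
Together with `homotopy_of_Q_map_eq` this turns derived morphisms into maps of complexes up to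
homotopy. -/
lemma Q_map_surjective {C : Type*} [Category* C] [Abelian C] [HasDerivedCategory C]
    (P L : CochainComplex C ℤ) [P.IsKProjective] (e : DerivedCategory.Q.obj P ⟶
      DerivedCategory.Q.obj L) : ∃ g : P ⟶ L, DerivedCategory.Q.map g = e := by
  let i := DerivedCategory.quotientCompQhIso C
  obtain ⟨h, hh⟩ := (CochainComplex.IsKProjective.Qh_map_bijective P
    ((HomotopyCategory.quotient _ _).obj L)).surjective (i.hom.app P ≫ e ≫ i.inv.app L)
  obtain ⟨g, rfl⟩ := (HomotopyCategory.quotient _ _).map_surjective h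
  refine ⟨g, ?_⟩
  rw [← cancel_epi (i.hom.app P), ← cancel_mono (i.inv.app L), Category.assoc, Category.assoc, ← hh]
  rw [← DerivedCategory.quotientCompQhIso_hom_naturality_assoc]
  simp [i]

lemma homotopy_of_Q_map_eq {C : Type*} [Category* C] [Abelian C] [HasDerivedCategory C]
    {P L : CochainComplex C ℤ} [P.IsKProjective] {g h : P ⟶ L}
    (e : DerivedCategory.Q.map g = DerivedCategory.Q.map h) : Nonempty (Homotopy g h) := by
  let i := DerivedCategory.quotientCompQhIso C
  refine ⟨HomotopyCategory.homotopyOfEq _ _ ?_⟩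
  apply (CochainComplex.IsKProjective.Qh_map_bijective P _).injective
  rw [← cancel_mono (i.hom.app L), DerivedCategory.quotientCompQhIso_hom_naturality,
    DerivedCategory.quotientCompQhIso_hom_naturality, e]

lemma Q_map_eq_of_homotopy {C : Type*} [Category* C] [Abelian C] [HasDerivedCategory C]
    {P L : CochainComplex C ℤ} {g h : P ⟶ L}
    (e : Homotopy g h) : DerivedCategory.Q.map g = DerivedCategory.Q.map h := by
  let i := DerivedCategory.quotientCompQhIso C
  rw [← cancel_epi (i.hom.app P), ← DerivedCategory.quotientCompQhIso_hom_naturality,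
    ← DerivedCategory.quotientCompQhIso_hom_naturality, HomotopyCategory.eq_of_homotopy _ _ e]

section Pair

variable {A : Type u} [CommRing A] {φ : A →+* A}

/-- The functor `φ_*` on complexes. -/
abbrev cRes (φ : A →+* A) :
    CochainComplex (ModuleCat.{u} A) ℤ ⥤ CochainComplex (ModuleCat.{u} A) ℤ :=
  (ModuleCat.restrictScalars.{u} φ).mapHomologicalComplex (ComplexShape.up ℤ)

/-- The object of the derived category defined by a complex `L` with a map `φ_* L ⟶ L`. -/
def pairDKMod (L : CochainComplex (ModuleCat.{u} A) ℤ) (σ : (cRes φ).obj L ⟶ L) : DKMod φ where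
  a := DerivedCategory.Q.obj L
  str := (ModuleCat.restrictScalars φ).mapDerivedCategoryFactors.hom.app _ ≫
    DerivedCategory.Q.map σ

variable {I : Ideal A} (hI : I ≤ I.comap φ) (R : FinRes (ModuleCat.of A (A ⧸ I)))

/-- The morphism from the resolution to its Frobenius twist, in the derived category. -/
def thetaQ : DerivedCategory.Q.obj R.P ⟶ DerivedCategory.Q.obj ((cRes φ).obj R.P) :=
  DerivedCategory.Q.map R.ε ≫ (DerivedCategory.singleFunctorIsoCompQ (ModuleCat A) 0).inv.app (ModuleCat.of A (A ⧸ I)) ≫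
    (DerivedCategory.singleFunctor _ 0).map (quotFrob I hI) ≫
    ((ModuleCat.restrictScalars φ).mapDerivedCategorySingleFunctor 0).inv.app _ ≫
    (ModuleCat.restrictScalars φ).mapDerivedCategory.map
      ((DerivedCategory.singleFunctorIsoCompQ (ModuleCat A) 0).hom.app (ModuleCat.of A (A ⧸ I)) ≫ inv (DerivedCategory.Q.map R.ε)) ≫
    (ModuleCat.restrictScalars φ).mapDerivedCategoryFactors.hom.app _

/-- The class of a morphism of complexes from the resolution. -/
def psi {L : CochainComplex (ModuleCat.{u} A) ℤ} (σ : (cRes φ).obj L ⟶ L) {a : ℤ}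
    (g : R.P ⟶ L⟦a⟧) : RHomQuot I (pairDKMod L σ) a :=
  (DerivedCategory.singleFunctorIsoCompQ (ModuleCat A) 0).hom.app (ModuleCat.of A (A ⧸ I)) ≫ inv (DerivedCategory.Q.map R.ε) ≫
    (ShiftedHom.map (a := a) (Y := L) g DerivedCategory.Q :)

/-- The structure map on the shifted complex. -/
def shiftStr {L : CochainComplex (ModuleCat.{u} A) ℤ} (σ : (cRes φ).obj L ⟶ L) (a : ℤ) :
    (cRes φ).obj (L⟦a⟧) ⟶ L⟦a⟧ :=
  ((cRes φ).commShiftIso a).hom.app L ≫ σ⟦a⟧'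

/-- This makes κ on R^a Hom explicit. Since `thetaQ` is A/I → φ_*(A/I) transported along the
augmentation on both sides, the augmentations cancel; what remains is the compatibility of φ_* with
localization and shift. -/
lemma kappaRHom_psi {L : CochainComplex (ModuleCat.{u} A) ℤ} (σ : (cRes φ).obj L ⟶ L) {a : ℤ}
    (θ : R.P ⟶ (cRes φ).obj R.P) (hθ : DerivedCategory.Q.map θ = thetaQ hI R)
    (g : R.P ⟶ L⟦a⟧) :
    kappaRHom I hI (pairDKMod L σ) a (psi R σ g) =
      psi R σ (θ ≫ (cRes φ).map g ≫ shiftStr σ a) := by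
  have h1 : ∀ (g : ShiftedHom R.P L a), (g.map DerivedCategory.Q).map
      (ModuleCat.restrictScalars φ).mapDerivedCategory ≫
      ((ModuleCat.restrictScalars φ).mapDerivedCategoryFactors.hom.app L)⟦a⟧' =
      (ModuleCat.restrictScalars φ).mapDerivedCategoryFactors.hom.app R.P ≫
        ((g.map (cRes φ)).map DerivedCategory.Q :) := by
    intro g
    have := g.map_naturality (ModuleCat.restrictScalars φ).mapDerivedCategoryFactors.hom
    rw [ShiftedHom.comp_mk₀, ShiftedHom.mk₀_comp, ShiftedHom.comp_map, ShiftedHom.comp_map] at this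
    exact this
  have h2 : (psi R σ g).map (ModuleCat.restrictScalars φ).mapDerivedCategory =
      (ModuleCat.restrictScalars φ).mapDerivedCategory.map
        ((DerivedCategory.singleFunctorIsoCompQ (ModuleCat A) 0).hom.app (ModuleCat.of A (A ⧸ I)) ≫
          inv (DerivedCategory.Q.map R.ε)) ≫
      ((ShiftedHom.map (a := a) (Y := L) g DerivedCategory.Q).map
        (ModuleCat.restrictScalars φ).mapDerivedCategory :) := by
    have h (F' : DerivedCategory (ModuleCat.{u} A) ⥤ DerivedCategory (ModuleCat.{u} A))
        [F'.CommShift ℤ] {X Y Z : DerivedCategory (ModuleCat.{u} A)} (u : X ⟶ Y)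
        (e : ShiftedHom Y Z a) : ShiftedHom.map (u ≫ e : X ⟶ _) F' = F'.map u ≫ e.map F' := by
      simp [ShiftedHom.map]
    refine Eq.trans (congrArg (fun e => ShiftedHom.map e _) ?_) (h _ _ _)
    exact (Category.assoc _ _ _).symm
  have h3 : psi R σ (θ ≫ (cRes φ).map g ≫ shiftStr σ a) =
      (DerivedCategory.singleFunctorIsoCompQ (ModuleCat A) 0).hom.app (ModuleCat.of A (A ⧸ I)) ≫ inv (DerivedCategory.Q.map R.ε) ≫
        thetaQ hI R ≫ ((ShiftedHom.map (ShiftedHom.map (a := a) (Y := L) g (cRes φ))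
          DerivedCategory.Q) ≫ (DerivedCategory.Q.map σ)⟦a⟧' :) := by
    rw [← hθ]
    dsimp only [psi, ShiftedHom.map, shiftStr]
    simp only [Functor.map_comp, Category.assoc, Functor.commShiftIso_hom_naturality]
    rfl
  rw [h3, kappaRHom, h2]
  dsimp only [pairDKMod, thetaQ]
  rw [Functor.map_comp (shiftFunctor (DerivedCategory (ModuleCat A)) a)]
  simp only [Category.assoc, IsIso.inv_hom_id_assoc, Iso.hom_inv_id_app_assoc]
  have h4 := congrArg (fun z => z ≫ (DerivedCategory.Q.map σ)⟦a⟧') (h1 g)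
  simp only [Category.assoc] at h4
  exact congrArg (fun z => (DerivedCategory.singleFunctor (ModuleCat A) 0).map (quotFrob I hI) ≫
    ((ModuleCat.restrictScalars φ).mapDerivedCategorySingleFunctor 0).inv.app _ ≫
    (ModuleCat.restrictScalars φ).mapDerivedCategory.map
      ((DerivedCategory.singleFunctorIsoCompQ (ModuleCat A) 0).hom.app (ModuleCat.of A (A ⧸ I)) ≫
        inv (DerivedCategory.Q.map R.ε)) ≫ z) h4

end Pair

end

end CartierSheaf

/-! ### The Frobenius lift to the resolution and its effect on the augmentation -/

namespace CartierSheaf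

noncomputable section

variable {A : Type u} [CommRing A] {φ : A →+* A} {I : Ideal A}

/-- The augmentation in degree `0`. -/
def FinRes.aug {B : ModuleCat.{u} A} (R : FinRes B) : R.P.X 0 →ₗ[A] B :=
  (R.ε.f 0 ≫ (HomologicalComplex.singleObjXSelf (ComplexShape.up ℤ) 0 B).hom).hom

lemma FinRes.aug_surjective {B : ModuleCat.{u} A} (R : FinRes B) :
    Function.Surjective R.aug := by
  intro b
  obtain ⟨x, hx⟩ := R.surjective ((HomologicalComplex.singleObjXSelf (ComplexShape.up ℤ) 0 B).inv b)
  refine ⟨x, ?_⟩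
  change (HomologicalComplex.singleObjXSelf (ComplexShape.up ℤ) 0 B).hom (R.ε.f 0 x) = b
  rw [hx]
  exact congr($((HomologicalComplex.singleObjXSelf (ComplexShape.up ℤ) 0 B).inv_hom_id) b)

lemma FinRes.aug_d {B : ModuleCat.{u} A} (R : FinRes B) (i : ℤ) (x : R.P.X i) :
    R.aug (R.P.d i 0 x) = 0 := by
  have h : R.P.d i 0 ≫ R.ε.f 0 = 0 := by
    rw [← R.ε.comm]
    exact comp_zero
  change (HomologicalComplex.singleObjXSelf (ComplexShape.up ℤ) 0 B).hom
    ((R.P.d i 0 ≫ R.ε.f 0) x) = 0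
  rw [h]
  exact map_zero (HomologicalComplex.singleObjXSelf (ComplexShape.up ℤ) 0 B).hom.hom

/-- Homotopic maps out of a complex in degrees `≤ 0` differ by a boundary in degree `0`. -/
lemma exists_boundary_of_homotopy {P M : CochainComplex (ModuleCat.{u} A) ℤ} [P.IsStrictlyLE 0]
    {g h : P ⟶ M} (e : Homotopy g h) (x : P.X 0) : ∃ y, M.d (-1) 0 y = g.f 0 x - h.f 0 x := by
  have h1 := e.comm 0
  have hz : e.hom 1 0 = 0 :=
    (CochainComplex.isZero_of_isStrictlyLE P 0 1 (by simp)).eq_of_src _ _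
  rw [dNext_eq (i' := 1) _ (by simp), prevD_eq (j' := -1) _ (by simp), hz, comp_zero, zero_add] at h1
  refine ⟨e.hom 0 (-1) x, ?_⟩
  rw [h1]
  change _ = (M.d (-1) 0 (e.hom 0 (-1) x) + h.f 0 x) - _
  rw [add_sub_cancel_right]

/-- K-projectivity provides θ. The two maps from P to φ_* of A/I in degree 0 agree in the derived
category and so are homotopic; since the target vanishes in degree -1 and P in degree 1, the
homotopy contributes nothing in degree 0 and the maps are equal there. -/
lemma exists_theta (hI : I ≤ I.comap φ) (R : FinRes (ModuleCat.of A (A ⧸ I))) :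
    ∃ θ : R.P ⟶ (cRes φ).obj R.P, DerivedCategory.Q.map θ = thetaQ hI R ∧
      ∀ x : R.P.X 0, R.aug (θ.f 0 x) = Ideal.quotientMap I φ hI (R.aug x) := by
  have := R.isKProjective
  obtain ⟨θ, hθ⟩ := Q_map_surjective _ _ (thetaQ hI R)
  refine ⟨θ, hθ, fun x => ?_⟩
  let B := ModuleCat.of A (A ⧸ I)
  let G := ModuleCat.restrictScalars.{u} φ
  let c := (G.mapCochainComplexSingleFunctor 0).app B
  have key : DerivedCategory.Q.map (θ ≫ (cRes φ).map R.ε) =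
      DerivedCategory.Q.map (R.ε ≫ (CochainComplex.singleFunctor _ 0).map (quotFrob I hI) ≫
        c.inv) := by
    have h1 := G.mapDerivedCategoryFactors_hom_naturality R.ε
    have h2 := G.mapDerivedCategorySingleFunctor_inv_app_mapDerivedCategoryFactors_hom_app B
    rw [Functor.map_comp DerivedCategory.Q, hθ, thetaQ, Functor.map_comp DerivedCategory.Q,
      Functor.map_comp DerivedCategory.Q]
    simp only [Category.assoc]
    refine congrArg (fun z => DerivedCategory.Q.map R.ε ≫ z) ?_
    have h3 : G.mapDerivedCategory.map
        ((DerivedCategory.singleFunctorIsoCompQ (ModuleCat A) 0).hom.app B ≫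
          inv (DerivedCategory.Q.map R.ε)) ≫ G.mapDerivedCategoryFactors.hom.app R.P ≫
        DerivedCategory.Q.map ((cRes φ).map R.ε) = G.mapDerivedCategoryFactors.hom.app _ := by
      rw [← h1, ← Category.assoc, ← Functor.map_comp, Category.assoc, IsIso.inv_hom_id,
        Category.comp_id]
      exact (congrArg (fun z => z ≫ _) (CategoryTheory.Functor.map_id _ _)).trans
        (Category.id_comp _)
    refine (congrArg (fun z => (DerivedCategory.singleFunctorIsoCompQ (ModuleCat A) 0).inv.app B ≫
      (DerivedCategory.singleFunctor (ModuleCat A) 0).map (quotFrob I hI) ≫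
      (G.mapDerivedCategorySingleFunctor 0).inv.app B ≫ z) h3).trans ?_
    exact (Category.id_comp _).trans (congrArg (fun z => _ ≫ z) h2)
  obtain ⟨e⟩ := homotopy_of_Q_map_eq key
  obtain ⟨y, hy⟩ := exists_boundary_of_homotopy e x
  have hy0 : y = 0 := by
    have hz : IsZero (((cRes φ).obj ((CochainComplex.singleFunctor _ 0).obj B)).X (-1)) :=
      G.map_isZero (HomologicalComplex.isZero_single_obj_X (ComplexShape.up ℤ) 0 B (-1) (by simp))
    have := ModuleCat.subsingleton_of_isZero hz
    exact Subsingleton.elim _ _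
  rw [hy0, map_zero, eq_comm, sub_eq_zero] at hy
  have hy' := congrArg (HomologicalComplex.singleObjXSelf (ComplexShape.up ℤ) 0 B).hom hy
  refine hy'.trans ?_
  have hc : c.inv.f 0 = (HomologicalComplex.singleObjXSelf (ComplexShape.up ℤ) 0 _).hom ≫
      G.map (HomologicalComplex.singleObjXSelf (ComplexShape.up ℤ) 0 B).inv :=
    HomologicalComplex.singleMapHomologicalComplex_inv_app_self _ _ _ _
  have hq : ((CochainComplex.singleFunctor _ 0).map (quotFrob I hI)).f 0 =
      (HomologicalComplex.singleObjXSelf (ComplexShape.up ℤ) 0 _).hom ≫ quotFrob I hI ≫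
        (HomologicalComplex.singleObjXSelf (ComplexShape.up ℤ) 0 _).inv :=
    HomologicalComplex.single_map_f_self _ _ _
  have hE : (R.ε ≫ (CochainComplex.singleFunctor _ 0).map (quotFrob I hI) ≫ c.inv).f 0 ≫
      G.map (HomologicalComplex.singleObjXSelf (ComplexShape.up ℤ) 0 B).hom =
      R.ε.f 0 ≫ (HomologicalComplex.singleObjXSelf (ComplexShape.up ℤ) 0 _).hom ≫
        quotFrob I hI := by
    have gen {X Y B' GB S' T : ModuleCat.{u} A} (u : X ⟶ Y) (s : Y ≅ B') (q : B' ⟶ GB)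
        (s' : S' ≅ GB) (t : T ≅ GB) :
        (u ≫ (s.hom ≫ q ≫ s'.inv) ≫ (s'.hom ≫ t.inv)) ≫ t.hom = u ≫ s.hom ≫ q := by simp
    rw [HomologicalComplex.comp_f, HomologicalComplex.comp_f, hc, hq]
    exact gen _ _ _ _
      (G.mapIso (HomologicalComplex.singleObjXSelf (ComplexShape.up ℤ) 0 B))
  exact congr($hE x)

end

end CartierSheaf

/-! ### Complexes with κ: chains modulo boundaries, and the operator on maps from P -/

namespace CartierSheaf

noncomputable section

section Complex

variable {A : Type u} [CommRing A] {φ : A →+* A} (M : CochainComplex (ModuleCat.{u} A) ℤ)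

/-- The submodule of boundaries. -/
def bd (i : ℤ) : Submodule A (M.X i) := LinearMap.range (M.d (i - 1) i).hom

variable {M}

lemma mem_bd {i : ℤ} {z : M.X i} : z ∈ bd M i ↔ ∃ j, ∃ y : M.X j, M.d j i y = z := by
  constructor
  · rintro ⟨y, rfl⟩
    exact ⟨_, y, rfl⟩
  · rintro ⟨j, y, rfl⟩
    by_cases h : j = i - 1
    · subst h
      exact ⟨y, rfl⟩
    · rw [M.shape _ _ (by simpa using fun h' => h (by lia))]
      exact (bd M i).zero_mem

lemma d_mem_bd (j i : ℤ) (y : M.X j) : M.d j i y ∈ bd M i := mem_bd.2 ⟨j, y, rfl⟩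

lemma exactAt_iff_bd {i : ℤ} : M.ExactAt i ↔ ∀ z : M.X i, M.d i (i + 1) z = 0 → z ∈ bd M i := by
  rw [HomologicalComplex.exactAt_iff' M (i - 1) i (i + 1) (by simp) (by simp),
    ShortComplex.moduleCat_exact_iff]
  rfl

variable (τ : (cRes φ).obj M ⟶ M)

/-- The `κ`-map in degree `i`. -/
def kapAt (i : ℤ) : M.X i →+ M.X i := (τ.f i).hom.toAddMonoidHom

lemma isKappa_kapAt (i : ℤ) : IsKappa φ (kapAt τ i) := fun a v => (τ.f i).hom.map_smul a v

lemma d_kapAt (i j : ℤ) (x : M.X i) : M.d i j (kapAt τ i x) = kapAt τ j (M.d i j x) :=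
  congr($(τ.comm i j) x)

lemma d_kapAt_iterate (i j : ℤ) (n : ℕ) (x : M.X i) :
    M.d i j ((kapAt τ i)^[n] x) = (kapAt τ j)^[n] (M.d i j x) :=
  iterate_comm_apply (M.d i j).hom (d_kapAt τ i j) n x

lemma kapAt_mem_bd {i : ℤ} {z : M.X i} (hz : z ∈ bd M i) : kapAt τ i z ∈ bd M i := by
  obtain ⟨j, y, rfl⟩ := mem_bd.1 hz
  rw [← d_kapAt]
  exact d_mem_bd _ _ _

/-- The `κ`-map on chains modulo boundaries. -/
def kapQ (i : ℤ) : (M.X i ⧸ bd M i) →+ (M.X i ⧸ bd M i) :=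
  QuotientAddGroup.map (bd M i).toAddSubgroup (bd M i).toAddSubgroup (kapAt τ i)
    fun _ hz => kapAt_mem_bd τ hz

lemma mkQ_kapAt (i : ℤ) (z : M.X i) :
    (bd M i).mkQ (kapAt τ i z) = kapQ τ i ((bd M i).mkQ z) := rfl

lemma mkQ_kapAt_iterate (i : ℤ) (n : ℕ) (z : M.X i) :
    (bd M i).mkQ ((kapAt τ i)^[n] z) = (kapQ τ i)^[n] ((bd M i).mkQ z) :=
  iterate_comm_apply (bd M i).mkQ (mkQ_kapAt τ i) n z

lemma isKappa_kapQ (i : ℤ) : IsKappa φ (kapQ τ i) := by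
  intro a v
  obtain ⟨v, rfl⟩ := (bd M i).mkQ_surjective v
  rw [← map_smul, ← mkQ_kapAt, isKappa_kapAt, map_smul, mkQ_kapAt]

/-- If all values of a linear map from a finite module are nilpotent modulo boundaries, this holds
uniformly. -/
lemma exists_uniform {i : ℤ} {P : Type*} [AddCommGroup P] [Module A P] [Module.Finite A P]
    (g : P →ₗ[A] M.X i) (h : ∀ x, LN A (kapQ τ i) ((bd M i).mkQ (g x))) :
    ∃ n : ℕ, ∀ (c : A) x, (kapAt τ i)^[n] (c • g x) ∈ bd M i := by
  obtain ⟨S, hS⟩ := Module.Finite.fg_top (R := A) (M := P)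
  obtain ⟨n, hn⟩ := LN.sum_span (A := A) (k := kapQ τ i)
    (T := ((bd M i).mkQ ∘ₗ g) '' S) (S.finite_toSet.image _) (by
      rintro _ ⟨x, -, rfl⟩
      exact h x)
  refine ⟨n, fun c x => ?_⟩
  rw [← Submodule.Quotient.mk_eq_zero, ← Submodule.mkQ_apply, mkQ_kapAt_iterate, ← map_smul]
  refine hn _ ?_
  rw [← Submodule.map_span, hS]
  exact ⟨c • x, trivial, rfl⟩

variable {P : CochainComplex (ModuleCat.{u} A) ℤ} (θ : P ⟶ (cRes φ).obj P)

/-- The Frobenius-semilinear endomorphism in degree `i`. -/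
def frP (i : ℤ) : P.X i →+ P.X i := (θ.f i).hom.toAddMonoidHom

lemma frP_smul (i : ℤ) (a : A) (x : P.X i) : frP θ i (a • x) = φ a • frP θ i x :=
  (θ.f i).hom.map_smul a x

lemma d_frP (i j : ℤ) (x : P.X i) : P.d i j (frP θ i x) = frP θ j (P.d i j x) :=
  congr($(θ.comm i j) x)

/-- The operator `g ↦ τ ∘ φ_* g ∘ θ`. -/
def opT : (P ⟶ M) →+ (P ⟶ M) :=
  AddMonoidHom.mk' (fun g => θ ≫ (cRes φ).map g ≫ τ) (by simp)

lemma opT_f (g : P ⟶ M) (i : ℤ) (x : P.X i) :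
    (opT τ θ g).f i x = kapAt τ i (g.f i (frP θ i x)) := rfl

lemma opT_iterate_f (n : ℕ) (g : P ⟶ M) (i : ℤ) (x : P.X i) :
    ((opT τ θ)^[n] g).f i x = (kapAt τ i)^[n] (g.f i ((frP θ i)^[n] x)) := by
  induction n generalizing g with
  | zero => rfl
  | succ n ih =>
    rw [Function.iterate_succ_apply, ih, opT_f, Function.iterate_succ_apply,
      Function.iterate_succ_apply']

lemma isKappa_opT : IsKappa φ (opT τ θ) := by
  intro a g
  ext i x
  exact (τ.f i).hom.map_smul a (g.f i (frP θ i x))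

end Complex

end

end CartierSheaf

/-! ### Derived Hom as homotopy classes of maps from the resolution -/

namespace CartierSheaf

noncomputable section

variable {A : Type u} [CommRing A] {φ : A →+* A} {I : Ideal A}

section Psi

variable (R : FinRes (ModuleCat.of A (A ⧸ I))) {L : CochainComplex (ModuleCat.{u} A) ℤ}
  (σ : (cRes φ).obj L ⟶ L) {a : ℤ}

/-- The isomorphism in the derived category given by the augmentation. -/
def FinRes.isoQ : (DerivedCategory.singleFunctor _ 0).obj (ModuleCat.of A (A ⧸ I)) ≅
    DerivedCategory.Q.obj R.P :=
  (DerivedCategory.singleFunctorIsoCompQ (ModuleCat A) 0).app (ModuleCat.of A (A ⧸ I)) ≪≫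
    (asIso (DerivedCategory.Q.map R.ε)).symm

lemma psi_eq (g : R.P ⟶ L⟦a⟧) :
    psi R σ g = R.isoQ.hom ≫ DerivedCategory.Q.map g ≫
      ((DerivedCategory.Q.commShiftIso a).app L).hom :=
  (Category.assoc _ _ _).symm

lemma psi_add (g h : R.P ⟶ L⟦a⟧) : psi R σ (g + h) = psi R σ g + psi R σ h := by
  have gen {X Y Z W : DerivedCategory (ModuleCat.{u} A)} (u : X ⟶ Y) (v w : Y ⟶ Z) (t : Z ⟶ W) :
      u ≫ (v + w) ≫ t = u ≫ v ≫ t + u ≫ w ≫ t := by simp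
  rw [psi_eq, psi_eq, psi_eq, Functor.map_add]
  exact gen _ _ _ _

lemma psi_smul (r : A) (g : R.P ⟶ L⟦a⟧) : psi R σ (r • g) = r • psi R σ g := by
  have gen {X Y Z W : DerivedCategory (ModuleCat.{u} A)} (u : X ⟶ Y) (v : Y ⟶ Z) (t : Z ⟶ W) :
      u ≫ (r • v) ≫ t = r • (u ≫ v ≫ t) := by simp
  rw [psi_eq, psi_eq, Functor.map_smul]
  exact gen _ _ _

lemma psi_congr {g h : R.P ⟶ L⟦a⟧} (e : DerivedCategory.Q.map g = DerivedCategory.Q.map h) :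
    psi R σ g = psi R σ h := by
  rw [psi, psi, ShiftedHom.map, ShiftedHom.map, e]

/-- The class of a morphism of complexes from the resolution, as a linear map. -/
def psiLin : (R.P ⟶ L⟦a⟧) →ₗ[A] RHomQuot I (pairDKMod L σ) a where
  toFun := psi R σ
  map_add' := psi_add R σ
  map_smul' := psi_smul R σ

lemma psiLin_surjective : Function.Surjective (psiLin R σ (a := a)) := by
  intro e
  have := R.isKProjective
  obtain ⟨g, hg⟩ := Q_map_surjective R.P (L⟦a⟧) (R.isoQ.inv ≫ (show
    _ ⟶ (DerivedCategory.Q.obj L)⟦a⟧ from e) ≫ ((DerivedCategory.Q.commShiftIso a).app L).inv)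
  refine ⟨g, (psi_eq R σ g).trans ?_⟩
  rw [hg]
  have gen {X Y Z W : DerivedCategory (ModuleCat.{u} A)} (u : X ≅ Y) (v : X ⟶ W) (t : Z ≅ W) :
      u.hom ≫ (u.inv ≫ v ≫ t.inv) ≫ t.hom = v := by simp
  exact gen _ _ _

lemma homotopy_of_psi_eq_zero {g : R.P ⟶ L⟦a⟧} (h : psi R σ g = 0) :
    Nonempty (Homotopy g 0) := by
  have := R.isKProjective
  refine homotopy_of_Q_map_eq ?_
  rw [Functor.map_zero]
  have gen {X Y Z W : DerivedCategory (ModuleCat.{u} A)} (u : X ≅ Y) (v : Y ⟶ Z) (t : Z ≅ W)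
      (e : u.hom ≫ v ≫ t.hom = 0) : v = 0 := by
    rwa [← Category.assoc, ← cancel_mono t.inv, Category.assoc, Iso.hom_inv_id, Category.comp_id,
      zero_comp, ← cancel_epi u.inv, Iso.inv_hom_id_assoc, comp_zero] at e
  exact gen R.isoQ _ ((DerivedCategory.Q.commShiftIso a).app L) ((psi_eq R σ g).symm.trans h)

/-- The map to the truncation in degrees ≥ n is a quasi-isomorphism, and its composite with g
vanishes: in degrees ≥ n because g does, below because the truncation does. Thus only the finitely
many components in degrees from n to 0 influence the class. -/
lemma psi_eq_zero_of_exact {n : ℤ} (hL : ∀ i < n, (L⟦a⟧).ExactAt i) {g : R.P ⟶ L⟦a⟧}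
    (hg : ∀ i, n ≤ i → g.f i = 0) : psi R σ g = 0 := by
  let M := L⟦a⟧
  have hM : M.IsGE n := (CochainComplex.isGE_iff M n).2 hL
  have h1 : g ≫ M.πTruncGE n = 0 := by
    ext1 i
    by_cases hi : n ≤ i
    · rw [HomologicalComplex.comp_f, hg i hi, zero_comp]
      rfl
    · exact (CochainComplex.isZero_of_isStrictlyGE (M.truncGE n) n i (by lia)).eq_of_tgt _ _
  have h2 : DerivedCategory.Q.map g = DerivedCategory.Q.map 0 := by
    rw [← cancel_mono (DerivedCategory.Q.map (M.πTruncGE n)), ← Functor.map_comp, h1,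
      Functor.map_zero, Functor.map_zero, zero_comp]
  rw [psi_congr R σ h2]
  exact map_zero (psiLin R σ)

lemma kappaRHom_psi_iterate (hI : I ≤ I.comap φ) {θ : R.P ⟶ (cRes φ).obj R.P}
    (hθ : DerivedCategory.Q.map θ = thetaQ hI R) (n : ℕ) (g : R.P ⟶ L⟦a⟧) :
    (kappaRHom I hI (pairDKMod L σ) a)^[n] (psi R σ g) =
      psi R σ ((opT (shiftStr σ a) θ)^[n] g) := by
  induction n generalizing g with
  | zero => rfl
  | succ n ih =>
    rw [Function.iterate_succ_apply, kappaRHom_psi hI R σ θ hθ, Function.iterate_succ_apply]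
    exact ih _

/-- The `κ`-map on `R^a Hom (A/I, K)`, as an additive map. -/
def kappaRHomAdd (hI : I ≤ I.comap φ) (K : DKMod φ) (a : ℤ) :
    RHomQuot I K a →+ RHomQuot I K a :=
  AddMonoidHom.mk' (kappaRHom I hI K a) (kappaRHom_add I hI K a)

lemma isKappa_kappaRHomAdd (hI : I ≤ I.comap φ) (K : DKMod φ) (a : ℤ) :
    IsKappa φ (kappaRHomAdd hI K a) :=
  fun r e => kappaRHom_smul I hI K a r e

end Psi

end

end CartierSheaf

/-! ### From nilpotent cohomology to nilpotent derived Hom -/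

namespace CartierSheaf

noncomputable section

/-- The kernel condition makes g factor through the image of f, so the image of W under g is a
quotient of its image under f. -/
lemma fg_map_of_fg_map {A E E₁ E₂ : Type*} [CommRing A] [AddCommGroup E] [Module A E]
    [AddCommGroup E₁] [Module A E₁] [AddCommGroup E₂] [Module A E₂] (f : E →ₗ[A] E₁)
    (g : E →ₗ[A] E₂) (hfg : ∀ w, f w = 0 → g w = 0) {W : Submodule A E} (h : (W.map f).FG) :
    (W.map g).FG := by
  classical
  obtain ⟨T, hT⟩ := h
  have h1 : ∀ t ∈ T, ∃ w ∈ W, f w = t := fun t ht =>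
    (Submodule.mem_map).1 (hT ▸ Submodule.subset_span ht)
  choose! s hsW hs using h1
  refine ⟨T.image (g ∘ s), le_antisymm ?_ ?_⟩
  · rw [Submodule.span_le]
    intro z hz
    obtain ⟨t, ht, rfl⟩ := Finset.mem_image.1 (Finset.mem_coe.1 hz)
    exact ⟨_, hsW t ht, rfl⟩
  · rintro _ ⟨w, hw, rfl⟩
    have h2 : f w ∈ (Submodule.span A (s '' T)).map f := by
      rw [Submodule.map_span, Set.image_image, Set.image_congr hs, Set.image_id', hT]
      exact ⟨w, hw, rfl⟩
    obtain ⟨w', hw', e⟩ := h2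
    have h3 : g w = g w' := by
      rw [← sub_eq_zero, ← map_sub]
      exact hfg _ (by rw [map_sub, e, sub_self])
    rw [h3, Finset.coe_image, Set.image_comp, ← Submodule.map_span]
    exact ⟨w', hw', rfl⟩

lemma IsKappa.iterate_mem_iSup_powSpan {A E : Type*} [CommRing A] {φ : A →+* A} [AddCommGroup E]
    [Module A E] {k : E →+ E} (hk : IsKappa φ k) (n : ℕ) {T : Set E} {v : E}
    (hv : v ∈ Submodule.span A T) : k^[n] v ∈ ⨆ w ∈ T, hk.powSpan n w := by
  have key : ∀ a : A, k^[n] (a • v) ∈ ⨆ w ∈ T, hk.powSpan n w := by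
    induction hv using Submodule.span_induction with
    | mem w hw =>
      exact fun a => (le_iSup₂ (f := fun w (_ : w ∈ T) => hk.powSpan n w) w hw)
        (hk.mem_powSpan.2 ⟨a, rfl⟩)
    | zero => intro a; rw [smul_zero, iterate_map_zero]; exact Submodule.zero_mem _
    | add x y _ _ hx hy => intro a; rw [smul_add, iterate_add]; exact Submodule.add_mem _ (hx a) (hy a)
    | smul b x _ hx => intro a; rw [smul_smul]; exact hx _
  simpa using key 1

variable {A : Type u} [CommRing A] {φ : A →+* A} {I : Ideal A}

lemma exists_lift_bd {M : CochainComplex (ModuleCat.{u} A) ℤ} {P : ModuleCat.{u} A} [Projective P]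
    {i : ℤ} (g : P ⟶ M.X i) (h : ∀ x, g x ∈ bd M i) (j : ℤ) (hj : j + 1 = i) :
    ∃ l : P ⟶ M.X j, l ≫ M.d j i = g := by
  obtain rfl : j = i - 1 := by lia
  have : Module.Projective A P := (IsProjective.iff_projective P).2 inferInstance
  obtain ⟨l, hl⟩ := Module.projective_lifting_property (M.d (i - 1) i).hom.rangeRestrict
    (g.hom.codRestrict _ h) (M.d (i - 1) i).hom.surjective_rangeRestrict
  refine ⟨ModuleCat.ofHom l, ?_⟩
  ext x
  exact congrArg Subtype.val (LinearMap.congr_fun hl x)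

/-- A morphism of complexes whose component in the highest nonzero degree `i` is a boundary is
homotopic to one which vanishes in degree `i`. -/
lemma exists_homotopic {P M : CochainComplex (ModuleCat.{u} A) ℤ} [∀ i, Projective (P.X i)]
    (w : P ⟶ M) (i : ℤ) (hw : ∀ j, i < j → w.f j = 0) (h : ∀ x, w.f i x ∈ bd M i) :
    ∃ w' : P ⟶ M, Nonempty (Homotopy w w') ∧ ∀ j, i ≤ j → w'.f j = 0 := by
  choose l hl using exists_lift_bd (w.f i) h
  -- The only nonzero component of the homotopy is a lift of w_i through d, going from degree i to
  -- degree i - 1. Subtracting its boundary cancels w_i and leaves all higher degrees unchanged.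
  let H : ∀ p q, (ComplexShape.up ℤ).Rel q p → (P.X p ⟶ M.X q) := fun p q hqp =>
    if hp : i = p then eqToHom (by rw [hp]) ≫ l q (hqp.trans hp.symm) else 0
  refine ⟨w - Homotopy.nullHomotopicMap' H, ⟨?_⟩, fun j hj => ?_⟩
  · exact Homotopy.equivSubZero.symm ((Homotopy.ofEq (sub_sub_cancel _ _)).trans
      (Homotopy.nullHomotopy' H))
  · have hr : ∀ p : ℤ, (ComplexShape.up ℤ).Rel (p - 1) p := fun p => sub_add_cancel p 1
    rw [HomologicalComplex.sub_f_apply,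
      Homotopy.nullHomotopicMap'_f (hr j) (rfl : j + 1 = j + 1)]
    have h1 : H (j + 1) j rfl = 0 := dif_neg (by lia)
    rw [h1, comp_zero, zero_add]
    obtain rfl | hij := eq_or_lt_of_le hj
    · have h2 : H i (i - 1) (hr i) = l (i - 1) (sub_add_cancel i 1) := by simp [H]
      rw [h2, hl, sub_self]
    · have h2 : H j (j - 1) (hr j) = 0 := dif_neg hij.ne
      rw [h2, zero_comp, sub_zero, hw j hij]

variable (R : FinRes (ModuleCat.of A (A ⧸ I))) {L : CochainComplex (ModuleCat.{u} A) ℤ}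
  (σ : (cRes φ).obj L ⟶ L) {a : ℤ}

/-- Induction on the highest degree i in which g may be nonzero. The values of g_i are cycles
because g_(i+1) = 0. As P_i is finite, one power of the operator makes them all boundaries, and a
homotopy removes the component. Once only components in the exact range remain, the class is zero.
The map obtained depends on the multiplier c, and so may the next exponent; hence `EvNil` rather
than `LN`. -/
lemma evNil_psi (hI : I ≤ I.comap φ) {θ : R.P ⟶ (cRes φ).obj R.P}
    (hθ : DerivedCategory.Q.map θ = thetaQ hI R) {n₀ : ℤ} (hL : ∀ i < n₀, (L⟦a⟧).ExactAt i)
    (hN : ∀ i (z : (L⟦a⟧).X i), (L⟦a⟧).d i (i + 1) z = 0 →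
      LN A (kapQ (shiftStr σ a) i) ((bd (L⟦a⟧) i).mkQ z)) (g : R.P ⟶ L⟦a⟧) :
    EvNil A (kappaRHomAdd hI (pairDKMod L σ) a) (psi R σ g) := by
  have key : ∀ (k : ℕ) (g : R.P ⟶ L⟦a⟧), (∀ j, n₀ + k ≤ j → g.f j = 0) →
      EvNil A (kappaRHomAdd hI (pairDKMod L σ) a) (psi R σ g) := by
    intro k
    induction k with
    | zero =>
      intro g hg
      rw [psi_eq_zero_of_exact R σ hL (by simpa using hg)]
      exact .zero
    | succ k ih =>
      intro g hg
      obtain ⟨i, hi⟩ : ∃ i, i = n₀ + k := ⟨_, rfl⟩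
      have hcyc (x : R.P.X i) : (L⟦a⟧).d i (i + 1) (g.f i x) = 0 := by
        refine congr($(g.comm i (i + 1)) x).trans ?_
        rw [hg (i + 1) (by push_cast; lia), comp_zero]
        rfl
      obtain ⟨n, hn⟩ := exists_uniform (shiftStr σ a) (g.f i).hom fun x => hN i _ (hcyc x)
      refine .step _ n fun c => ?_
      let w := (opT (shiftStr σ a) θ)^[n] (c • g)
      have hw : (kappaRHomAdd hI (pairDKMod L σ) a)^[n] (c • psi R σ g) = psi R σ w := by
        rw [← psi_smul]
        exact kappaRHom_psi_iterate R σ hI hθ n _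
      have hw1 (j : ℤ) (hj : i < j) : w.f j = 0 := by
        ext x
        rw [opT_iterate_f]
        have : (c • g).f j = 0 := by
          rw [HomologicalComplex.smul_f_apply, hg j (by push_cast; lia), smul_zero]
        rw [this]
        exact iterate_map_zero (kapAt (shiftStr σ a) j) n
      obtain ⟨w', ⟨e⟩, hw'⟩ := exists_homotopic w i hw1 fun x => by
        rw [opT_iterate_f]
        exact hn c _
      rw [hw, psi_congr R σ (Q_map_eq_of_homotopy e)]
      exact ih w' (hi ▸ hw')
  -- P vanishes in degrees > 0, and n₀ + (1 - n₀).toNat is at least 1.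
  refine key (1 - n₀).toNat g fun j hj => ?_
  exact (CochainComplex.isZero_of_isStrictlyLE R.P 0 j (by lia)).eq_of_src _ _

/-- By exactness below n₀ a class is determined by the values of a representative on finite
generating sets of P_p for n₀ ≤ p ≤ 0. For the n-th iterates of multiples of g these values lie in
finite sums of modules κ^n(A g(s)), with s a generator. These are finitely generated and A is
Noetherian. -/
lemma powSpan_psi_fg [IsNoetherianRing A] (hI : I ≤ I.comap φ) {θ : R.P ⟶ (cRes φ).obj R.P}
    (hθ : DerivedCategory.Q.map θ = thetaQ hI R) {n₀ : ℤ} (hL : ∀ i < n₀, (L⟦a⟧).ExactAt i)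
    (hQ : ∀ i z n, ((isKappa_kapAt (shiftStr σ a) i).powSpan n z).FG) (g : R.P ⟶ L⟦a⟧) (n : ℕ) :
    ((isKappa_kappaRHomAdd hI (pairDKMod L σ) a).powSpan n (psi R σ g)).FG := by
  have h1 := (isKappa_opT (shiftStr σ a) θ).powMap_map
    (isKappa_kappaRHomAdd hI (pairDKMod L σ) a) (psiLin R σ)
    (fun v => (kappaRHom_psi_iterate R σ hI hθ 1 v).symm) n g
  change ((isKappa_kappaRHomAdd hI (pairDKMod L σ) a).powSpan n (psiLin R σ g)).FG
  rw [h1]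
  have hfin (p : ℤ) := Module.Finite.fg_top (R := A) (M := R.P.X p)
  choose S hS using hfin
  let ι := Σ p : Finset.Icc n₀ 0, S p.1
  let ρ : (R.P ⟶ L⟦a⟧) →ₗ[A] (∀ t : ι, (L⟦a⟧).X t.1) :=
    { toFun g t := g.f t.1 t.2.1
      map_add' _ _ := rfl
      map_smul' _ _ := rfl }
  refine fg_map_of_fg_map ρ _ (fun w hw => ?_) ?_
  · refine psi_eq_zero_of_exact R σ hL fun i hi => ?_
    by_cases h0 : i ≤ 0
    · refine ModuleCat.hom_ext (LinearMap.ext_on (hS i) fun s hs => ?_)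
      exact congrFun hw ⟨⟨i, Finset.mem_Icc.2 ⟨hi, h0⟩⟩, ⟨s, hs⟩⟩
    · exact (CochainComplex.isZero_of_isStrictlyLE R.P 0 i (by lia)).eq_of_src _ _
  · let N : ∀ t : ι, Submodule A ((L⟦a⟧).X t.1) := fun t =>
      ⨆ w ∈ (g.f t.1) '' (S t.1 : Set (R.P.X t.1)),
        (isKappa_kapAt (shiftStr σ a) t.1).powSpan n w
    have hN : (Submodule.pi Set.univ N).FG := by
      refine Submodule.fg_pi fun t => ?_
      have := ((S t.1).finite_toSet.image (g.f t.1)).to_subtype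
      dsimp only [N]
      rw [iSup_subtype']
      exact Submodule.fg_iSup _ fun w => hQ _ _ n
    refine Submodule.FG.of_le hN ?_
    rintro _ ⟨w, hw, rfl⟩ t -
    obtain ⟨c, rfl⟩ := (isKappa_opT (shiftStr σ a) θ).mem_powSpan.1 hw
    change ((opT (shiftStr σ a) θ)^[n] (c • g)).f _ _ ∈ _
    rw [opT_iterate_f]
    refine (isKappa_kapAt (shiftStr σ a) t.1).iterate_mem_iSup_powSpan n ?_
    refine Submodule.smul_mem _ c ?_
    change (g.f t.1).hom _ ∈ Submodule.span A ((g.f t.1).hom '' _)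
    rw [← Submodule.map_span, hS]
    exact ⟨_, trivial, rfl⟩

lemma locNilMap_of_shift [IsNoetherianRing A] (hI : I ≤ I.comap φ) {n₀ : ℤ}
    (hL : ∀ i < n₀, (L⟦a⟧).ExactAt i)
    (hN : ∀ i (z : (L⟦a⟧).X i), (L⟦a⟧).d i (i + 1) z = 0 →
      LN A (kapQ (shiftStr σ a) i) ((bd (L⟦a⟧) i).mkQ z))
    (hQ : ∀ i z n, ((isKappa_kapAt (shiftStr σ a) i).powSpan n z).FG) :
    LocNilMap A (kappaRHom I hI (pairDKMod L σ) a) := by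
  obtain ⟨R⟩ := exists_finRes (ModuleCat.of A (A ⧸ I))
  obtain ⟨θ, hθ, -⟩ := exists_theta hI R
  refine (locNilMap_iff (isKappa_kappaRHomAdd hI (pairDKMod L σ) a)).2 fun v => ?_
  refine EvNil.ln (isKappa_kappaRHomAdd hI (pairDKMod L σ) a) ⊤ (fun _ _ => trivial)
    (fun w _ n => ?_) ?_ (v := v) trivial
  · obtain ⟨g, rfl⟩ := psiLin_surjective R σ w
    exact powSpan_psi_fg R σ hI hθ hL hQ g n
  · obtain ⟨g, rfl⟩ := psiLin_surjective R σ v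
    exact evNil_psi R σ hI hθ hL hN g

end

end CartierSheaf

/-! ### From nilpotent derived Hom to nilpotent cohomology: extending maps degree by degree -/

namespace CartierSheaf

noncomputable section

variable {A : Type u} [CommRing A] {φ : A →+* A}

section Families

variable {M P : CochainComplex (ModuleCat.{u} A) ℤ} (τ : (cRes φ).obj M ⟶ M)
  (θ : P ⟶ (cRes φ).obj P)

lemma frP_iterate_smul (i : ℤ) (n : ℕ) (a : A) (x : P.X i) :
    (frP θ i)^[n] (a • x) = φ^[n] a • (frP θ i)^[n] x := by
  induction n generalizing a x with
  | zero => rfl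
  | succ n ih => rw [Function.iterate_succ_apply, frP_smul, ih]; rfl

lemma d_frP_iterate (i j : ℤ) (n : ℕ) (x : P.X i) :
    P.d i j ((frP θ i)^[n] x) = (frP θ j)^[n] (P.d i j x) :=
  iterate_comm_apply (P.d i j).hom (d_frP θ i j) n x

/-- The map `x ↦ κ^n (g (θ^n x))`. -/
def twist (n : ℕ) {p : ℤ} (g : P.X p →ₗ[A] M.X p) : P.X p →ₗ[A] M.X p where
  toFun x := (kapAt τ p)^[n] (g ((frP θ p)^[n] x))
  map_add' x y := by rw [iterate_add, map_add, iterate_add]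
  map_smul' a x := by
    rw [frP_iterate_smul, map_smul, (isKappa_kapAt τ p).iterate_smul]; rfl

lemma twist_apply (n : ℕ) {p : ℤ} (g : P.X p →ₗ[A] M.X p) (x : P.X p) :
    twist τ θ n g x = (kapAt τ p)^[n] (g ((frP θ p)^[n] x)) := rfl

/-- A family of linear maps which commutes with the differentials in degrees `≥ m`. -/
def CommGE (g : ∀ p, P.X p →ₗ[A] M.X p) (m : ℤ) : Prop :=
  ∀ p, m ≤ p → ∀ x, M.d p (p + 1) (g p x) = g (p + 1) (P.d p (p + 1) x)

variable {τ θ}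

lemma CommGE.twist {g : ∀ p, P.X p →ₗ[A] M.X p} {m : ℤ} (hg : CommGE g m) (n : ℕ) (c : A) :
    CommGE (fun p => twist τ θ n (c • g p)) m := by
  intro p hp x
  rw [twist_apply, twist_apply, d_kapAt_iterate, ← d_frP_iterate, LinearMap.smul_apply, map_smul,
    LinearMap.smul_apply, hg p hp]

lemma CommGE.d_apply_d {g : ∀ p, P.X p →ₗ[A] M.X p} {m : ℤ} (hg : CommGE g m) (j : ℤ)
    (x : P.X j) : M.d m (m + 1) (g m (P.d j m x)) = 0 := by
  rw [hg m le_rfl]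
  have : P.d m (m + 1) (P.d j m x) = 0 := congr($(P.d_comp_d j m (m + 1)) x)
  rw [this, map_zero]

/-- The obstruction to one more component is g_m ∘ d on P_(m-1). If it lands in boundaries,
projectivity lifts it through the differential of M. -/
lemma CommGE.exists_extend [∀ i, Projective (P.X i)] {g : ∀ p, P.X p →ₗ[A] M.X p} {m : ℤ}
    (hg : CommGE g m) (h : ∀ x : P.X (m - 1), g m (P.d (m - 1) m x) ∈ bd M m) :
    ∃ g' : ∀ p, P.X p →ₗ[A] M.X p, CommGE g' (m - 1) ∧ ∀ p, m ≤ p → g' p = g p := by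
  obtain ⟨l, hl⟩ := exists_lift_bd (P.d (m - 1) m ≫ ModuleCat.ofHom (g m)) h (m - 1)
    (sub_add_cancel m 1)
  have h1 : ∀ p, m ≤ p → Function.update g (m - 1) l.hom p = g p := fun p hp =>
    Function.update_of_ne (by lia) _ _
  refine ⟨Function.update g (m - 1) l.hom, fun p hp x => ?_, h1⟩
  obtain rfl | hp := eq_or_lt_of_le hp
  · rw [Function.update_self]
    obtain ⟨k, hk⟩ : ∃ k, k = m - 1 + 1 := ⟨_, rfl⟩
    rw [← hk]
    obtain rfl : k = m := by lia
    rw [h1 _ le_rfl]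
    exact congr($hl x)
  · rw [h1 p (by lia), h1 (p + 1) (by lia)]
    exact hg p (by lia) x

/-- The obstruction always takes cycles as values, so in the exact range it never matters. Extending
indefinitely changes each component only finitely often, and the stable values form a morphism of
complexes. -/
lemma CommGE.exists_hom [∀ i, Projective (P.X i)] {g : ∀ p, P.X p →ₗ[A] M.X p} {m : ℤ}
    (hg : CommGE g m) (hM : ∀ i ≤ m, M.ExactAt i) :
    ∃ G : P ⟶ M, ∀ p, m ≤ p → (G.f p).hom = g p := by
  have step : ∀ (k : ℕ) (g : ∀ p, P.X p →ₗ[A] M.X p), CommGE g (m - k) →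
      ∃ g' : ∀ p, P.X p →ₗ[A] M.X p, CommGE g' (m - (k + 1 : ℕ)) ∧
        ∀ p, m - k ≤ p → g' p = g p := by
    intro k g hg
    obtain ⟨g', h1, h2⟩ := hg.exists_extend fun x =>
      exactAt_iff_bd.1 (hM (m - k) (by lia)) _ (hg.d_apply_d _ x)
    refine ⟨g', ?_, h2⟩
    rwa [show m - ((k + 1 : ℕ) : ℤ) = m - k - 1 by push_cast; ring]
  choose! F hF1 hF2 using step
  let s : ℕ → ∀ p, P.X p →ₗ[A] M.X p := fun k => Nat.rec g (fun k g => F k g) k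
  have hs1 (k : ℕ) : CommGE (s k) (m - k) := by
    induction k with
    | zero => rw [Nat.cast_zero, sub_zero]; exact hg
    | succ k ih => exact hF1 k _ ih
  have hs2 (p : ℤ) (k : ℕ) (hk : m - k ≤ p) (l : ℕ) (hl : k ≤ l) : s l p = s k p := by
    induction l, hl using Nat.le_induction with
    | base => rfl
    | succ l hl ih => exact (hF2 l _ (hs1 l) p (by lia)).trans ih
  refine ⟨{ f := fun p => ModuleCat.ofHom (s (m - p).toNat p), comm' := ?_ }, fun p hp => ?_⟩
  · rintro p _ rfl
    ext x
    have h1 := hs1 (m - p).toNat p (by lia) x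
    rw [hs2 (p + 1) (m - (p + 1)).toNat (by lia) _ (by lia)] at h1
    exact h1
  · exact hs2 p 0 (by lia) _ (by lia)

end Families

variable {I : Ideal A} (R : FinRes (ModuleCat.of A (A ⧸ I)))

/-- The component in degree `0` induces `1 ↦ h` modulo boundaries. -/
def Extends {M : CochainComplex (ModuleCat.{u} A) ℤ} (g : R.P.X 0 →ₗ[A] M.X 0) (h : M.X 0) :
    Prop :=
  ∀ (x : R.P.X 0) (r : A), R.aug x = Ideal.Quotient.mk I r → g x - r • h ∈ bd M 0

variable {R}

lemma kapAt_iterate_mem_bd {M : CochainComplex (ModuleCat.{u} A) ℤ} (τ : (cRes φ).obj M ⟶ M)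
    {i : ℤ} (n : ℕ) {z : M.X i} (hz : z ∈ bd M i) : (kapAt τ i)^[n] z ∈ bd M i := by
  induction n with
  | zero => exact hz
  | succ n ih => rw [Function.iterate_succ_apply']; exact kapAt_mem_bd τ ih

lemma aug_frP_iterate {hI : I ≤ I.comap φ} {θ : R.P ⟶ (cRes φ).obj R.P}
    (hθ : ∀ x : R.P.X 0, R.aug (θ.f 0 x) = Ideal.quotientMap I φ hI (R.aug x)) (n : ℕ)
    (x : R.P.X 0) (r : A) (h : R.aug x = Ideal.Quotient.mk I r) :
    R.aug ((frP θ 0)^[n] x) = Ideal.Quotient.mk I (φ^[n] r) := by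
  induction n with
  | zero => exact h
  | succ n ih =>
    rw [Function.iterate_succ_apply', Function.iterate_succ_apply']
    refine (hθ _).trans ?_
    rw [ih, Ideal.quotientMap_mk]

lemma Extends.twist {hI : I ≤ I.comap φ} {θ : R.P ⟶ (cRes φ).obj R.P}
    (hθ : ∀ x : R.P.X 0, R.aug (θ.f 0 x) = Ideal.quotientMap I φ hI (R.aug x))
    {M : CochainComplex (ModuleCat.{u} A) ℤ} (τ : (cRes φ).obj M ⟶ M)
    {g : R.P.X 0 →ₗ[A] M.X 0} {h : M.X 0} (hg : Extends R g h) (n : ℕ) (c : A) :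
    Extends R (twist τ θ n (c • g)) ((kapAt τ 0)^[n] (c • h)) := by
  intro x r hx
  have h1 := kapAt_iterate_mem_bd τ n ((bd M 0).smul_mem c (hg _ _ (aug_frP_iterate hθ n x r hx)))
  rw [smul_sub, iterate_map_sub, smul_comm, (isKappa_kapAt τ 0).iterate_smul] at h1
  exact h1

variable {L : CochainComplex (ModuleCat.{u} A) ℤ} (σ : (cRes φ).obj L ⟶ L) {a : ℤ}

/-- Induction on the number k of degrees above n₁ in which commutation is still missing. The
obstruction g_m ∘ d has cycles as values. For m = 0 these are boundaries because the augmentation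
kills d; for m < 0 they are nilpotent modulo boundaries, uniformly since the resolution is finite.
Twisting by κ^n and θ^n makes the obstruction vanish and replaces h by κ^n(ch). When nothing is
missing, g extends to a morphism G whose class is nilpotent by `hE`; a null homotopy of an iterate
of cG, evaluated at an element of augmentation 1, exhibits κ^n(ch) as a boundary. -/
lemma evNil_of_extends (hI : I ≤ I.comap φ) {θ : R.P ⟶ (cRes φ).obj R.P}
    (hθ : DerivedCategory.Q.map θ = thetaQ hI R)
    (hθ' : ∀ x : R.P.X 0, R.aug (θ.f 0 x) = Ideal.quotientMap I φ hI (R.aug x))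
    {n₁ : ℤ} (hL : ∀ i ≤ n₁, (L⟦a⟧).ExactAt i)
    (hN : ∀ i < 0, ∀ (z : (L⟦a⟧).X i), (L⟦a⟧).d i (i + 1) z = 0 →
      LN A (kapQ (shiftStr σ a) i) ((bd (L⟦a⟧) i).mkQ z))
    (hE : LocNilMap A (kappaRHom I hI (pairDKMod L σ) a))
    (k : ℕ) (hk : n₁ + k ≤ 0) (g : ∀ p, R.P.X p →ₗ[A] (L⟦a⟧).X p) (h : (L⟦a⟧).X 0)
    (hg : CommGE g (n₁ + k)) (hg' : Extends R (g 0) h) :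
    EvNil A (kapQ (shiftStr σ a) 0) ((bd (L⟦a⟧) 0).mkQ h) := by
  induction k generalizing g h with
  | zero =>
    obtain ⟨G, hG⟩ := hg.exists_hom (by simpa using hL)
    obtain ⟨n, hn⟩ := (locNilMap_iff (isKappa_kappaRHomAdd hI (pairDKMod L σ) a)).1 hE
      (psi R σ G)
    refine LN.evNil ⟨n, fun c => ?_⟩
    have h1 : psi R σ ((opT (shiftStr σ a) θ)^[n] (c • G)) = 0 := by
      rw [← kappaRHom_psi_iterate R σ hI hθ, psi_smul]
      exact hn c
    obtain ⟨e⟩ := homotopy_of_psi_eq_zero R σ h1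
    obtain ⟨x, hx⟩ := R.aug_surjective (Ideal.Quotient.mk I 1)
    obtain ⟨y, hy⟩ := exists_boundary_of_homotopy e x
    have h2 := Extends.twist hθ' (shiftStr σ a) hg' n c x 1 hx
    rw [one_smul] at h2
    have h3 : twist (shiftStr σ a) θ n (c • g 0) x = (L⟦a⟧).d (-1) 0 y := by
      rw [hy, opT_iterate_f, ← hG 0 hk]
      exact (sub_zero _).symm
    rw [h3] at h2
    rw [← map_smul, ← mkQ_kapAt_iterate, Submodule.mkQ_apply, Submodule.Quotient.mk_eq_zero]
    have := (bd (L⟦a⟧) 0).sub_mem (d_mem_bd _ _ y) h2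
    rwa [sub_sub_cancel] at this
  | succ k ih =>
    obtain ⟨m, hm⟩ : ∃ m, m = n₁ + (k + 1 : ℕ) := ⟨_, rfl⟩
    rw [← hm] at hg hk
    obtain ⟨n, hn⟩ : ∃ n : ℕ, ∀ (c : A) (x : R.P.X (m - 1)), (kapAt (shiftStr σ a) m)^[n]
        (c • g m (R.P.d (m - 1) m x)) ∈ bd (L⟦a⟧) m := by
      obtain rfl | hm0 := eq_or_lt_of_le hk
      · refine ⟨0, fun c x => Submodule.smul_mem _ _ ?_⟩
        have := hg' (R.P.d (0 - 1) 0 x) 0 (by rw [R.aug_d, map_zero])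
        rwa [zero_smul, sub_zero] at this
      · exact exists_uniform (shiftStr σ a) (g m ∘ₗ (R.P.d (m - 1) m).hom) fun x =>
          hN m hm0 _ (hg.d_apply_d _ x)
    refine .step _ n fun c => ?_
    obtain ⟨g', h1, h2⟩ := (hg.twist (τ := shiftStr σ a) (θ := θ) n c).exists_extend fun x => by
      rw [twist_apply, ← d_frP_iterate]
      exact hn c _
    rw [← map_smul, ← mkQ_kapAt_iterate]
    refine ih (by lia) g' _ ?_ ?_
    · rwa [show n₁ + (k : ℤ) = m - 1 by lia]
    · rw [h2 0 hk]
      exact hg'.twist hθ' (shiftStr σ a) n c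

lemma ln_of_shift [IsNoetherianRing A] (hI : I ≤ I.comap φ) {n₀ : ℤ}
    (hL : ∀ i < n₀, (L⟦a⟧).ExactAt i)
    (hN : ∀ i < 0, ∀ (z : (L⟦a⟧).X i), (L⟦a⟧).d i (i + 1) z = 0 →
      LN A (kapQ (shiftStr σ a) i) ((bd (L⟦a⟧) i).mkQ z))
    (hE : LocNilMap A (kappaRHom I hI (pairDKMod L σ) a))
    (hQ : ∀ z : (L⟦a⟧).X 0, (L⟦a⟧).d 0 1 z = 0 → ∀ n,
      ((isKappa_kapQ (shiftStr σ a) 0).powSpan n ((bd (L⟦a⟧) 0).mkQ z)).FG)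
    {h : (L⟦a⟧).X 0} (hh : (L⟦a⟧).d 0 1 h = 0) (hIh : ∀ r ∈ I, r • h ∈ bd (L⟦a⟧) 0) :
    LN A (kapQ (shiftStr σ a) 0) ((bd (L⟦a⟧) 0).mkQ h) := by
  obtain ⟨R⟩ := exists_finRes (ModuleCat.of A (A ⧸ I))
  obtain ⟨θ, hθ, hθ'⟩ := exists_theta hI R
  have hproj : Module.Projective A (R.P.X 0) := (IsProjective.iff_projective (R.P.X 0)).2 (R.projective 0)
  obtain ⟨l, hl⟩ := Module.projective_lifting_property (Ideal.Quotient.mkₐ A I).toLinearMap R.aug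
    (Ideal.Quotient.mkₐ_surjective A I)
  -- The initial family is a lift of the augmentation to A followed by r ↦ rh in degree 0, and zero
  -- elsewhere. It commutes with d in degrees ≥ 0 since h is a cycle, and it induces 1 ↦ h modulo
  -- boundaries since the elements of I send h into boundaries.
  let g : ∀ p, R.P.X p →ₗ[A] (L⟦a⟧).X p :=
    Function.update 0 0 ((LinearMap.toSpanSingleton A _ h) ∘ₗ l)
  have hg0 : g 0 = (LinearMap.toSpanSingleton A _ h) ∘ₗ l := Function.update_self _ _ _
  have hg (p : ℤ) (hp : p ≠ 0) : g p = 0 := Function.update_of_ne hp _ _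
  -- All degrees ≤ n₁ must be exact, and n₁ ≤ 0 is needed for n₁ + (-n₁).toNat to be 0, the degree
  -- where the family starts.
  obtain ⟨n₁, hn₁, hn₁'⟩ : ∃ n₁ : ℤ, n₁ ≤ 0 ∧ n₁ < n₀ := ⟨min 0 (n₀ - 1), by lia, by lia⟩
  refine EvNil.ln (isKappa_kapQ (shiftStr σ a) 0)
    (Submodule.map (bd (L⟦a⟧) 0).mkQ (LinearMap.ker ((L⟦a⟧).d 0 1).hom)) ?_ ?_
    (evNil_of_extends σ hI hθ hθ' (n₁ := n₁) (fun i hi => hL i (by lia)) hN hE (-n₁).toNat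
      (by lia) g h ?_ ?_) ⟨h, hh, rfl⟩
  · rintro _ ⟨z, hz, rfl⟩
    refine ⟨kapAt (shiftStr σ a) 0 z, ?_, rfl⟩
    change (L⟦a⟧).d 0 1 _ = 0
    rw [d_kapAt]
    exact (congrArg _ hz).trans (map_zero _)
  · rintro _ ⟨z, hz, rfl⟩ n
    exact hQ z hz n
  · intro p hp x
    rw [hg (p + 1) (by lia), LinearMap.zero_apply]
    by_cases hp0 : p = 0
    · subst hp0
      rw [hg0]
      change (L⟦a⟧).d 0 1 (l x • h) = 0
      rw [map_smul, hh, smul_zero]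
    · rw [hg p hp0, LinearMap.zero_apply, map_zero]
  · intro x r hx
    rw [hg0]
    change l x • h - r • h ∈ _
    rw [← sub_smul]
    refine hIh _ ?_
    rw [← Ideal.Quotient.eq, ← hx]
    exact LinearMap.congr_fun hl x

end

end CartierSheaf

/-! ### Removing the shift -/

namespace CartierSheaf

noncomputable section

variable {A : Type u} [CommRing A] {φ : A →+* A} {I : Ideal A}

lemma ln_kapQ_iff {M : CochainComplex (ModuleCat.{u} A) ℤ} (τ : (cRes φ).obj M ⟶ M) {i : ℤ}
    {z : M.X i} : LN A (kapQ τ i) ((bd M i).mkQ z) ↔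
      ∃ n : ℕ, ∀ c : A, (kapAt τ i)^[n] (c • z) ∈ bd M i := by
  refine exists_congr fun n => forall_congr' fun c => ?_
  rw [← map_smul, ← mkQ_kapAt_iterate, Submodule.mkQ_apply, Submodule.Quotient.mk_eq_zero]

lemma powSpan_kapQ {M : CochainComplex (ModuleCat.{u} A) ℤ} (τ : (cRes φ).obj M ⟶ M) {i : ℤ}
    (z : M.X i) (n : ℕ) : (isKappa_kapQ τ i).powSpan n ((bd M i).mkQ z) =
      ((isKappa_kapAt τ i).powSpan n z).map (bd M i).mkQ :=
  (isKappa_kapAt τ i).powMap_map _ _ (mkQ_kapAt τ i) n z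

variable {L : CochainComplex (ModuleCat.{u} A) ℤ} (σ : (cRes φ).obj L ⟶ L)

lemma negOnePow_smul_smul {E : Type*} [AddCommGroup E] (a : ℤ) (x : E) :
    (a.negOnePow : ℤ) • (a.negOnePow : ℤ) • x = x := by
  rw [smul_smul, ← Units.val_mul, ← sq, Int.units_sq, Units.val_one, one_smul]

/-- The differential of the shifted complex differs from that of L only by the sign (-1)^a, which
affects neither boundaries nor cycles. -/
lemma mem_bd_shift {a i : ℤ} {z : (L⟦a⟧).X i} :
    z ∈ bd (L⟦a⟧) i ↔ (show L.X (i + a) from z) ∈ bd L (i + a) := by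
  have hd (j : ℤ) (y : L.X (j + a)) : (L⟦a⟧).d j i (show (L⟦a⟧).X j from y) =
    show (L⟦a⟧).X i from (a.negOnePow : ℤ) • L.d (j + a) (i + a) y := rfl
  constructor
  · rintro ⟨y, rfl⟩
    exact (bd L (i + a)).toAddSubgroup.zsmul_mem (d_mem_bd (i - 1 + a) (i + a) y) a.negOnePow
  · intro h
    obtain ⟨j, y, hy⟩ := mem_bd.1 h
    obtain ⟨j, rfl⟩ : ∃ j', j = j' + a := ⟨j - a, by lia⟩
    refine mem_bd.2 ⟨j, (a.negOnePow : ℤ) • y, ?_⟩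
    refine (hd j _).trans ?_
    refine Eq.trans ?_ hy
    refine Eq.trans ?_ (negOnePow_smul_smul a (L.d (j + a) (i + a) y))
    exact congrArg (fun t : L.X (i + a) => (a.negOnePow : ℤ) • t) (map_zsmul (L.d (j + a) (i + a)).hom _ y)

lemma shift_d_eq_zero_iff {a i j j' : ℤ} (hj : j + a = j') {z : (L⟦a⟧).X i} :
    (L⟦a⟧).d i j z = 0 ↔ L.d (i + a) j' (show L.X (i + a) from z) = 0 := by
  subst hj
  constructor
  · intro h
    have := congrArg (fun y : L.X (j + a) => (a.negOnePow : ℤ) • y) h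
    exact ((negOnePow_smul_smul a _).symm.trans this).trans (smul_zero (a.negOnePow : ℤ))
  · intro h
    exact (congrArg (fun y : L.X (j + a) => (a.negOnePow : ℤ) • y) h).trans
      (smul_zero (a.negOnePow : ℤ))

lemma ln_kapQ_shift_iff {a i : ℤ} {z : (L⟦a⟧).X i} :
    LN A (kapQ (shiftStr σ a) i) ((bd (L⟦a⟧) i).mkQ z) ↔
      LN A (kapQ σ (i + a)) ((bd L (i + a)).mkQ (show L.X (i + a) from z)) := by
  refine (ln_kapQ_iff (shiftStr σ a)).trans (Iff.trans ?_ (ln_kapQ_iff σ).symm)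
  exact exists_congr fun n => forall_congr' fun c => mem_bd_shift

lemma powSpan_kapQ_shift_fg {a i : ℤ} {z : (L⟦a⟧).X i} {n : ℕ}
    (h : ((isKappa_kapQ σ (i + a)).powSpan n ((bd L (i + a)).mkQ
      (show L.X (i + a) from z))).FG) :
    ((isKappa_kapQ (shiftStr σ a) i).powSpan n ((bd (L⟦a⟧) i).mkQ z)).FG := by
  rw [powSpan_kapQ] at h ⊢
  have h2 : bd (L⟦a⟧) i = bd L (i + a) := Submodule.ext fun _ => mem_bd_shift
  rw [h2]
  exact h

lemma exactAt_shift {a i : ℤ} (h : L.ExactAt (i + a)) : (L⟦a⟧).ExactAt i := by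
  rw [exactAt_iff_bd]
  intro z hz
  exact mem_bd_shift.2 (exactAt_iff_bd.1 h z ((shift_d_eq_zero_iff (by lia)).1 hz))

theorem locNilMap_kappaRHom [IsNoetherianRing A] (hI : I ≤ I.comap φ) {n₀ : ℤ}
    (hL : ∀ i < n₀, L.ExactAt i)
    (hN : ∀ i (z : L.X i), L.d i (i + 1) z = 0 → LN A (kapQ σ i) ((bd L i).mkQ z))
    (hQ : ∀ i z n, ((isKappa_kapAt σ i).powSpan n z).FG) (a : ℤ) :
    LocNilMap A (kappaRHom I hI (pairDKMod L σ) a) :=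
  locNilMap_of_shift σ hI (n₀ := n₀ - a) (fun i hi => exactAt_shift (hL _ (by lia)))
    (fun i z hz => (ln_kapQ_shift_iff σ).2
      (hN (i + a) z ((shift_d_eq_zero_iff (by lia)).1 hz)))
    (fun i z n => hQ (i + a) z n)

theorem ln_of_locNilMap_kappaRHom [IsNoetherianRing A] (hI : I ≤ I.comap φ) {n₀ : ℤ}
    (hL : ∀ i < n₀, L.ExactAt i) (i : ℤ)
    (hN : ∀ j < i, ∀ z : L.X j, L.d j (j + 1) z = 0 → LN A (kapQ σ j) ((bd L j).mkQ z))
    (hE : LocNilMap A (kappaRHom I hI (pairDKMod L σ) i))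
    (hQ : ∀ z : L.X i, L.d i (i + 1) z = 0 → ∀ n,
      ((isKappa_kapQ σ i).powSpan n ((bd L i).mkQ z)).FG)
    {h : L.X i} (hh : L.d i (i + 1) h = 0) (hIh : ∀ r ∈ I, r • h ∈ bd L i) :
    LN A (kapQ σ i) ((bd L i).mkQ h) := by
  obtain ⟨a, rfl⟩ : ∃ a, i = 0 + a := ⟨i, (zero_add i).symm⟩
  rw [zero_add] at hE
  exact (ln_kapQ_shift_iff σ (i := 0)).1 (ln_of_shift σ hI (n₀ := n₀ - a)
    (fun i hi => exactAt_shift (hL _ (by lia)))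
    (fun j hj z hz => (ln_kapQ_shift_iff σ).2
      (hN (j + a) (by lia) z ((shift_d_eq_zero_iff (by lia)).1 hz))) hE
    (fun z hz n => powSpan_kapQ_shift_fg σ (hQ z ((shift_d_eq_zero_iff (by lia)).1 hz) n))
    ((shift_d_eq_zero_iff (j' := 0 + a + 1) (by lia)).2 hh)
    (fun r hr => mem_bd_shift.2 (hIh r hr)))

end

end CartierSheaf

/-! ### Modules placed in degree 0 -/

namespace CartierSheaf

noncomputable section

variable {A : Type u} [CommRing A] {φ : A →+* A} {I : Ideal A}

/-- The `κ`-map of a pair, as an additive map. -/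
def kapM (M : KMod φ) : M.a →+ M.a := M.str.hom.toAddMonoidHom

lemma isKappa_kapM (M : KMod φ) : IsKappa φ (kapM M) := fun a v => M.str.hom.map_smul a v

/-- The structure map of a pair on the associated complex concentrated in degree `0`. -/
def singleStr (M : KMod φ) : (cRes φ).obj ((CochainComplex.singleFunctor _ 0).obj M.a) ⟶
    (CochainComplex.singleFunctor _ 0).obj M.a :=
  ((ModuleCat.restrictScalars φ).mapCochainComplexSingleFunctor 0).hom.app M.a ≫
    (CochainComplex.singleFunctor _ 0).map M.str

lemma singleDKMod_eq (M : KMod φ) : singleDKMod M = pairDKMod _ (singleStr M) := by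
  have h := (ModuleCat.restrictScalars φ).mapDerivedCategoryFactors_inv_app_mapDerivedCategorySingleFunctor_hom_app M.a
  have h2 : (singleDKMod M).str = (pairDKMod _ (singleStr M)).str := by
    dsimp only [singleDKMod, pairDKMod, singleStr]
    rw [Functor.map_comp DerivedCategory.Q]
    have gen {X Y Z W : DerivedCategory (ModuleCat.{u} A)} (u : X ≅ Y) (v : Y ⟶ Z) (w : X ⟶ Z)
      (t : Z ⟶ W) (e : u.inv ≫ w = v) : w ≫ t = u.hom ≫ v ≫ t := by
        rw [← e]; simp
    exact gen ((ModuleCat.restrictScalars φ).mapDerivedCategoryFactors.app _) _ _ _ h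
  exact congrArg (Endofunctor.Algebra.mk (F := (ModuleCat.restrictScalars φ).mapDerivedCategory) _) h2

/-- The identification of the term in degree `0`. -/
def singleEquiv (M : ModuleCat.{u} A) : ((CochainComplex.singleFunctor _ 0).obj M).X 0 ≃ₗ[A] M :=
  (HomologicalComplex.singleObjXSelf (ComplexShape.up ℤ) 0 M).toLinearEquiv

lemma singleEquiv_kapAt (M : KMod φ) (z) :
    singleEquiv M.a (kapAt (singleStr M) 0 z) = kapM M (singleEquiv M.a z) := by
  let G := ModuleCat.restrictScalars.{u} φ
  have hc : ((G.mapCochainComplexSingleFunctor 0).hom.app M.a).f 0 =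
      G.map (HomologicalComplex.singleObjXSelf (ComplexShape.up ℤ) 0 M.a).hom ≫
        (HomologicalComplex.singleObjXSelf (ComplexShape.up ℤ) 0 _).inv :=
    HomologicalComplex.singleMapHomologicalComplex_hom_app_self _ _ _ _
  have hq : ((CochainComplex.singleFunctor _ 0).map M.str).f 0 =
      (HomologicalComplex.singleObjXSelf (ComplexShape.up ℤ) 0 _).hom ≫ M.str ≫
        (HomologicalComplex.singleObjXSelf (ComplexShape.up ℤ) 0 _).inv :=
    HomologicalComplex.single_map_f_self _ _ _
  have hE : (singleStr M).f 0 ≫ (HomologicalComplex.singleObjXSelf (ComplexShape.up ℤ) 0 M.a).hom =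
      G.map (HomologicalComplex.singleObjXSelf (ComplexShape.up ℤ) 0 M.a).hom ≫ M.str := by
    have gen {X Y Z W V : ModuleCat.{u} A} (u : X ⟶ Y) (s : Z ≅ Y) (m : Y ⟶ W) (t : V ≅ W) :
        ((u ≫ s.inv) ≫ (s.hom ≫ m ≫ t.inv)) ≫ t.hom = u ≫ m := by simp
    rw [singleStr, HomologicalComplex.comp_f, hc, hq]
    exact gen _ _ _ _
  exact congr($hE z)

lemma bd_single (M : ModuleCat.{u} A) (i : ℤ) :
    bd ((CochainComplex.singleFunctor _ 0).obj M) i = ⊥ := by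
  rw [eq_bot_iff]
  rintro _ ⟨y, rfl⟩
  exact rfl

lemma subsingleton_single (M : ModuleCat.{u} A) {i : ℤ} (hi : i ≠ 0) :
    Subsingleton (((CochainComplex.singleFunctor _ 0).obj M).X i) :=
  ModuleCat.subsingleton_of_isZero
    (HomologicalComplex.isZero_single_obj_X (ComplexShape.up ℤ) 0 M i hi)

lemma exactAt_single (M : ModuleCat.{u} A) (i : ℤ) (hi : i < 0) :
    ((CochainComplex.singleFunctor _ 0).obj M).ExactAt i := by
  rw [exactAt_iff_bd]
  intro z _
  have := subsingleton_single M hi.ne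
  rw [Subsingleton.elim z 0]
  exact Submodule.zero_mem _

lemma ln_single_iff (M : KMod φ) (z) :
    LN A (kapQ (singleStr M) 0) ((bd ((CochainComplex.singleFunctor _ 0).obj M.a) 0).mkQ z) ↔
      LN A (kapM M) (singleEquiv M.a z) := by
  rw [ln_kapQ_iff]
  refine exists_congr fun n => forall_congr' fun c => ?_
  rw [bd_single, Submodule.mem_bot, ← map_smul,
    ← iterate_comm_apply (singleEquiv M.a) (singleEquiv_kapAt M), LinearEquiv.map_eq_zero_iff]

lemma powSpan_single_fg (M : KMod φ) (hQ : ∀ v n, ((isKappa_kapM M).powSpan n v).FG) (z) (n : ℕ) :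
    ((isKappa_kapAt (singleStr M) 0).powSpan n z).FG := by
  have h := (isKappa_kapM M).powMap_map (isKappa_kapAt (singleStr M) 0)
    (singleEquiv M.a).symm.toLinearMap (fun v => by
      rw [LinearEquiv.coe_coe, LinearEquiv.symm_apply_eq, singleEquiv_kapAt,
        LinearEquiv.apply_symm_apply]) n (singleEquiv M.a z)
  rw [LinearEquiv.coe_coe, LinearEquiv.symm_apply_apply] at h
  rw [h]
  exact (hQ _ _).map _

theorem locNilMap_kappaRHom_single [IsNoetherianRing A] (hI : I ≤ I.comap φ) (M : KMod φ)
    (hN : ∀ v, LN A (kapM M) v) (hQ : ∀ v n, ((isKappa_kapM M).powSpan n v).FG) (a : ℤ) :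
    LocNilMap A (kappaRHom I hI (singleDKMod M) a) := by
  rw [singleDKMod_eq]
  refine locNilMap_kappaRHom (singleStr M) hI (exactAt_single M.a) (fun i z _ => ?_)
    (fun i z n => ?_) a
  · by_cases hi : i = 0
    · subst hi
      exact (ln_single_iff M z).2 (hN _)
    · have := subsingleton_single M.a hi
      rw [Subsingleton.elim z 0, map_zero]
      exact ⟨0, fun c => smul_zero _⟩
  · by_cases hi : i = 0
    · subst hi
      exact powSpan_single_fg M hQ z n
    · have := subsingleton_single M.a hi
      rw [Subsingleton.elim ((isKappa_kapAt (singleStr M) i).powSpan n z) ⊥]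
      exact Submodule.fg_bot

/-- Degree 0 of derived Hom suffices: the nilpotence required of lower cohomology is vacuous for a
module in degree 0. -/
theorem ln_of_locNilMap_kappaRHom_single [IsNoetherianRing A] (hI : I ≤ I.comap φ) (M : KMod φ)
    (hQ : ∀ v n, ((isKappa_kapM M).powSpan n v).FG)
    (hE : LocNilMap A (kappaRHom I hI (singleDKMod M) 0)) {h : M.a} (hh : ∀ r ∈ I, r • h = 0) :
    LN A (kapM M) h := by
  rw [singleDKMod_eq] at hE
  obtain ⟨z, rfl⟩ := (singleEquiv M.a).surjective h
  rw [← ln_single_iff]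
  refine ln_of_locNilMap_kappaRHom (singleStr M) hI (exactAt_single M.a) 0 (fun j hj z _ => ?_)
    hE (fun z _ n => ?_) rfl fun r hr => ?_
  · have := subsingleton_single M.a hj.ne
    rw [Subsingleton.elim z 0, map_zero]
    exact ⟨0, fun c => smul_zero _⟩
  · rw [powSpan_kapQ]
    exact (powSpan_single_fg M hQ z n).map _
  · rw [bd_single, Submodule.mem_bot]
    refine (singleEquiv M.a).map_eq_zero_iff.1 ?_
    rw [map_smul, hh r hr]

end

end CartierSheaf

/-! ### Quasi-coherence as a localization property of sections -/

namespace CartierSheaf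
noncomputable section
open Scheme.Modules

variable {Y Z : Scheme.{u}}

/-- Restriction of sections of a sheaf of modules. -/
def res (M : Y.Modules) {W' W : Y.Opens} (h : W' ≤ W) : Γ(M, W) →+ Γ(M, W') :=
  (M.presheaf.map (homOfLE h).op).hom

/-- Restriction of functions. -/
def rres {W' W : Y.Opens} (h : W' ≤ W) : Γ(Y, W) →+* Γ(Y, W') :=
  (Y.presheaf.map (homOfLE h).op).hom

lemma res_smul (M : Y.Modules) {W' W : Y.Opens} (h : W' ≤ W) (a : Γ(Y, W)) (m : Γ(M, W)) :
    res M h (a • m) = rres h a • res M h m := M.map_smul (homOfLE h) a m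

lemma res_res (M : Y.Modules) {W₁ W₂ W₃ : Y.Opens} (h : W₃ ≤ W₂) (h' : W₂ ≤ W₁) (m : Γ(M, W₁)) :
    res M h (res M h' m) = res M (h.trans h') m := by
  unfold res
  rw [← AddMonoidHom.comp_apply, ← AddCommGrpCat.hom_comp, ← Functor.map_comp]
  rfl

lemma res_self (M : Y.Modules) {W : Y.Opens} (h : W ≤ W) (m : Γ(M, W)) : res M h m = m :=
  congr($(M.presheaf.map_id (op W)) m)

lemma rres_rres {W₁ W₂ W₃ : Y.Opens} (h : W₃ ≤ W₂) (h' : W₂ ≤ W₁) (m : Γ(Y, W₁)) :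
    rres h (rres h' m) = rres (h.trans h') m := by
  unfold rres
  rw [← RingHom.comp_apply, ← CommRingCat.hom_comp, ← Functor.map_comp]
  rfl

lemma rres_self {W : Y.Opens} (h : W ≤ W) (m : Γ(Y, W)) : rres h m = m :=
  congr($(Y.presheaf.map_id (op W)) m)

lemma app_res {M N : Y.Modules} (g : M ⟶ N) {W' W : Y.Opens} (h : W' ≤ W) (m : Γ(M, W)) :
    g.app W' (res M h m) = res N h (g.app W m) :=
  congr($(g.mapPresheaf.naturality (homOfLE h).op) m)

/-- The sections of `M` on `W` localize correctly at basic open subsets. -/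
def QCAt (M : Y.Modules) (W : Y.Opens) : Prop :=
  ∀ (a : Γ(Y, W)) (D : Y.Opens) (_ : D = Y.basicOpen a) (h : D ≤ W),
    (∀ m : Γ(M, W), res M h m = 0 → ∃ k : ℕ, a ^ k • m = 0) ∧
    ∀ m : Γ(M, D), ∃ (k : ℕ) (m' : Γ(M, W)), res M h m' = rres h a ^ k • m

lemma qcAt_restrict_iff (f : Z ⟶ Y) [IsOpenImmersion f] (M : Y.Modules) (U : Z.Opens)
    (W : Y.Opens) (hW : W = f ''ᵁ U) : QCAt (M.restrict f) U ↔ QCAt M W := by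
  subst hW
  have hb (a : Γ(Z, U)) : f ''ᵁ Z.basicOpen a = Y.basicOpen ((f.appIso U).inv a) :=
    Scheme.image_basicOpen f a
  have hn (a : Γ(Z, U)) {D : Z.Opens} (h : D ≤ U) : (f.appIso D).inv (rres h a) =
      rres (f.image_mono h) ((f.appIso U).inv a) :=
    congr($(f.appIso_inv_naturality (homOfLE h).op) a)
  constructor
  · intro H b D hD h
    obtain ⟨a, rfl⟩ : ∃ a, (f.appIso U).inv a = b := ⟨(f.appIso U).hom b, by simp⟩
    rw [← hb] at hD
    subst hD
    obtain ⟨h1, h2⟩ := H a _ rfl (Z.basicOpen_le a)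
    refine ⟨fun m hm => ?_, fun m => ?_⟩
    · obtain ⟨k, hk⟩ := h1 m hm
      refine ⟨k, Eq.trans ?_ hk⟩
      rw [← map_pow]
      rfl
    · obtain ⟨k, m', hk⟩ := h2 m
      refine ⟨k, m', Eq.trans hk ?_⟩
      rw [← map_pow, ← map_pow, ← map_pow, ← hn]
      rfl
  · intro H a D hD h
    subst hD
    obtain ⟨h1, h2⟩ := H ((f.appIso U).inv a) _ (hb a) (f.image_mono h)
    refine ⟨fun m hm => ?_, fun m => ?_⟩
    · obtain ⟨k, hk⟩ := h1 m hm
      refine ⟨k, Eq.trans ?_ hk⟩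
      rw [← map_pow]
      rfl
    · obtain ⟨k, m', hk⟩ := h2 m
      refine ⟨k, m', Eq.trans hk ?_⟩
      rw [← map_pow, ← map_pow, ← map_pow, ← hn]
      rfl

lemma isLocalizing_iff_qcAt {R : CommRingCat.{u}} (M : (Spec R).Modules) :
    IsLocalizing (modulesSpecToSheaf.obj M) ↔ QCAt M ⊤ := by
  have key (r : R) (k : ℕ) (D : (Spec R).Opens) (h : D ≤ ⊤) (m : Γ(M, D)) :
      rres h ((Scheme.ΓSpecIso R).inv r) ^ k • m = r ^ k • m := by
    rw [← map_pow, ← map_pow]; rfl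
  have key' (r : R) (k : ℕ) (m : Γ(M, ⊤)) : (Scheme.ΓSpecIso R).inv r ^ k • m = r ^ k • m := by
    refine Eq.trans ?_ (key r k ⊤ le_rfl m)
    rw [rres_self]
  have hD' (r : R) : PrimeSpectrum.basicOpen r =
      (Spec R).basicOpen ((Scheme.ΓSpecIso R).inv r) := (basicOpen_eq_of_affine r).symm
  constructor
  · intro H a D hD h
    obtain ⟨r, rfl⟩ : ∃ r, (Scheme.ΓSpecIso R).inv r = a := ⟨(Scheme.ΓSpecIso R).hom a, by simp⟩
    rw [← hD'] at hD
    subst hD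
    have := H r
    refine ⟨fun m hm => ?_, fun m => ?_⟩
    · obtain ⟨⟨_, n, rfl⟩, hn⟩ := (IsLocalizedModule.eq_zero_iff (.powers r) _).mp
        (show ((modulesSpecToSheaf.obj M).obj.map (PrimeSpectrum.basicOpen r).leTop.op).hom m = 0
          from hm)
      exact ⟨n, (key' r n m).trans hn⟩
    · obtain ⟨⟨y, _, n, rfl⟩, hy⟩ := this.surj m
      exact ⟨n, y, hy.symm.trans (key r n _ h m).symm⟩
  · intro H r
    obtain ⟨h1, h2⟩ := H _ _ (hD' r) le_top
    refine IsLocalizedModule.Away.mk_of_addCommGroup ?_ ?_ ?_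
    · exact Scheme.Modules.isUnit_algebraMap_end_of_le_basicOpen r le_rfl
    · intro x
      obtain ⟨n, t, ht⟩ := h2 x
      exact ⟨n, t, (ht.trans (key r n (PrimeSpectrum.basicOpen r) le_top x)).symm⟩
    · intro x hx
      obtain ⟨n, hn⟩ := h1 x hx
      exact ⟨n, (key' r n x).symm.trans hn⟩

/-- A quasi-coherent module localizes on affine open subsets. -/
theorem qcAt_of_isQuasicoherent (M : Y.Modules) [M.IsQuasicoherent] {W : Y.Opens}
    (hW : IsAffineOpen W) : QCAt M W := by
  rw [← qcAt_restrict_iff hW.fromSpec M ⊤ W (by simp), ← isLocalizing_iff_qcAt,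
    ← isIso_fromTildeΓ_iff_isLocalizing]
  infer_instance

lemma nonempty_presentation_of_iso {C : Type u} [Category.{u} C] {J : GrothendieckTopology C}
    {R : Sheaf J RingCat.{u}} [HasSheafify J AddCommGrpCat.{u}]
    [J.WEqualsLocallyBijective AddCommGrpCat.{u}] {M N : SheafOfModules.{u} R} (e : M ≅ N)
    (h : Nonempty M.Presentation) : Nonempty N.Presentation :=
  h.map fun P => SheafOfModules.Presentation.ofIsIso.{u, u, u} e.hom P

lemma nonempty_presentation_map {C C' : Type u} [Category.{u} C] {J : GrothendieckTopology C}
    {R : Sheaf J RingCat.{u}} [HasSheafify J AddCommGrpCat.{u}]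
    [J.WEqualsLocallyBijective AddCommGrpCat.{u}] [Category.{u} C'] {J' : GrothendieckTopology C'}
    {R' : Sheaf J' RingCat.{u}} [HasSheafify J' AddCommGrpCat.{u}]
    [J'.WEqualsLocallyBijective AddCommGrpCat.{u}] (e : SheafOfModules.{u} R ≌ SheafOfModules.{u} R')
    (η : SheafOfModules.unit R' ≅ e.functor.obj (SheafOfModules.unit R))
    {M : SheafOfModules.{u} R} (h : Nonempty M.Presentation) :
    Nonempty (e.functor.obj M).Presentation :=
  h.map fun P => P.map e.functor η

/-- Transported to the spectrum, the localization property identifies M with the sheaf of a module,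
which has a presentation. This is moved back to W and through the equivalence between modules on the
scheme W and modules on the slice over W. -/
lemma nonempty_presentation_of_qcAt (M : Y.Modules) {W : Y.Opens} (hW : IsAffineOpen W)
    (h : QCAt M W) : Nonempty (M.over W).Presentation := by
  rw [← qcAt_restrict_iff hW.fromSpec M ⊤ W (by simp), ← isLocalizing_iff_qcAt,
    ← isIso_fromTildeΓ_iff_isLocalizing] at h
  have P : Nonempty (M.restrict hW.fromSpec).Presentation :=
    nonempty_presentation_of_iso
      (@asIso (Scheme.Modules _) _ _ _ (M.restrict hW.fromSpec).fromTildeΓ h)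
      ⟨presentationTilde.{u} _ .univ (by simp) _ (Submodule.span_eq _)⟩
  have hw : hW.isoSpec.hom ≫ hW.fromSpec = W.ι := hW.isoSpec_hom_fromSpec
  let i : restrictFunctor hW.fromSpec ⋙ restrictFunctor hW.isoSpec.hom ≅ restrictFunctor W.ι :=
    (restrictFunctorComp hW.isoSpec.hom hW.fromSpec).symm ≪≫ restrictFunctorCongr hw
  have P' : Nonempty (M.restrict W.ι).Presentation :=
    nonempty_presentation_of_iso (i.app M) (P.map (presentationRestrict hW.isoSpec.hom))
  let e := overEquiv W
  let u' : SheafOfModules.unit _ ≅ e.functor.obj (SheafOfModules.unit _) :=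
    (Scheme.Modules.restrictUnitIso W.ι).symm ≪≫
      (overFunctorEquiv W).symm.app (SheafOfModules.unit _)
  let u'' : SheafOfModules.unit _ ≅ e.inverse.obj (SheafOfModules.unit _) :=
    e.unitIso.app (SheafOfModules.unit _) ≪≫ e.inverse.mapIso u'.symm
  exact nonempty_presentation_of_iso
    (e.inverse.mapIso ((overFunctorEquiv W).symm.app M) ≪≫ e.unitIso.symm.app _)
    (nonempty_presentation_map e.symm u'' P')

/-- A module that localizes on an affine open cover is quasi-coherent. -/
theorem isQuasicoherent_of_qcAt (M : Y.Modules)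
    (h : ∀ y : Y, ∃ W : Y.Opens, y ∈ W ∧ IsAffineOpen W ∧ QCAt M W) : M.IsQuasicoherent := by
  choose W hy hW hM using h
  refine SheafOfModules.QuasicoherentData.isQuasicoherent (M := M)
    { I := Y
      X := W
      coversTop := ?_
      presentation := fun i => (nonempty_presentation_of_qcAt M (hW i) (hM i)).some }
  rw [Opens.coversTop_iff]
  exact eq_top_iff.2 fun y _ => Opens.mem_iSup.2 ⟨y, hy y⟩

end
end CartierSheaf

/-! ### Images, kernels and cokernels on affine sections -/

namespace CartierSheaf
noncomputable section
open Scheme.Modules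

variable {Y : Scheme.{u}} {M N P : Y.Modules}

lemma eq_zero_of_locally {W : Y.Opens} (m : Γ(M, W))
    (H : ∀ z ∈ W, ∃ (W' : Y.Opens) (h : W' ≤ W), z ∈ W' ∧ res M h m = 0) : m = 0 := by
  choose! W' h hz hm using H
  refine TopCat.Sheaf.eq_of_locally_eq' (C := Ab.{u}) ⟨_, M.isSheaf⟩ (fun z : W => W' z) W
    (fun z => homOfLE (h z z.2)) ?_ m 0 fun z => ?_
  · exact fun z hz' => Opens.mem_iSup.2 ⟨⟨z, hz'⟩, hz z hz'⟩
  · exact (hm z z.2).trans (map_zero (res M (h z z.2))).symm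

lemma basicOpen_rres {W' W : Y.Opens} (h : W' ≤ W) (a : Γ(Y, W)) :
    Y.basicOpen (rres h a) = W' ⊓ Y.basicOpen a := Y.basicOpen_res a _

/-- The claim is that b lies in the radical of the ideal (S : s), an intersection of primes. A prime
containing (S : s) but not b would be a point of the basic open set of b; there some a outside the
prime has a power in (S : s), which is absurd. -/
lemma pow_mem_of_locally {W : Y.Opens} (hW : IsAffineOpen W) (S : Submodule Γ(Y, W) Γ(N, W))
    (s : Γ(N, W)) (b : Γ(Y, W))
    (H : ∀ z ∈ Y.basicOpen b, ∃ a : Γ(Y, W), z ∈ Y.basicOpen a ∧ ∃ k : ℕ, a ^ k • s ∈ S) :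
    ∃ l : ℕ, b ^ l • s ∈ S := by
  suffices b ∈ (S.colon {s}).radical by
    obtain ⟨l, hl⟩ := this
    exact ⟨l, Submodule.mem_colon_singleton.1 hl⟩
  rw [Ideal.radical_eq_sInf, Submodule.mem_sInf]
  rintro p ⟨hp, hpp⟩
  by_contra hb
  let x : Spec Γ(Y, W) := ⟨p, hpp⟩
  have hx (c : Γ(Y, W)) : hW.fromSpec x ∈ Y.basicOpen c ↔ c ∉ p := by
    change x ∈ hW.fromSpec ⁻¹ᵁ Y.basicOpen c ↔ _
    rw [hW.fromSpec_preimage_basicOpen]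
    rfl
  obtain ⟨a, ha, k, hk⟩ := H _ ((hx b).2 hb)
  exact (hx a).1 ha (hpp.mem_of_pow_mem k (hp (Submodule.mem_colon_singleton.2 hk)))

lemma mem_of_locally {W : Y.Opens} (hW : IsAffineOpen W) (S : Submodule Γ(Y, W) Γ(N, W))
    (s : Γ(N, W)) (H : ∀ z ∈ W, ∃ a : Γ(Y, W), z ∈ Y.basicOpen a ∧ ∃ k : ℕ, a ^ k • s ∈ S) : s ∈ S := by
  obtain ⟨l, hl⟩ := pow_mem_of_locally hW S s 1 fun z hz => H z (Y.basicOpen_le _ hz)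
  rwa [one_pow, one_smul] at hl

/-- Every point has a basic affine neighbourhood. -/
lemma exists_basicOpen {W W' : Y.Opens} (hW : IsAffineOpen W) (h : W' ≤ W) {z : Y} (hz : z ∈ W') :
    ∃ a : Γ(Y, W), Y.basicOpen a ≤ W' ∧ z ∈ Y.basicOpen a :=
  hW.exists_basicOpen_le (V := W') ⟨z, hz⟩ (h hz)

/-- The range of a morphism on sections. -/
def rangeAt (g : M ⟶ N) (W : Y.Opens) : Submodule Γ(Y, W) Γ(N, W) where
  carrier := Set.range (g.app W)
  add_mem' := by
    rintro _ _ ⟨a, rfl⟩ ⟨b, rfl⟩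
    exact ⟨a + b, map_add _ _ _⟩
  zero_mem' := ⟨0, map_zero _⟩
  smul_mem' := by
    rintro c _ ⟨a, rfl⟩
    exact ⟨c • a, Scheme.Modules.Hom.app_smul _ _ _⟩

lemma exists_pow_smul_mem_rangeAt {W D : Y.Opens} (hM : QCAt M W) (hN : QCAt N W) (g : M ⟶ N)
    (a : Γ(Y, W)) (hD : D = Y.basicOpen a) (h : D ≤ W) (s : Γ(N, W))
    (hs : res N h s ∈ rangeAt g D) : ∃ k : ℕ, a ^ k • s ∈ rangeAt g W := by
  obtain ⟨t, ht⟩ := hs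
  obtain ⟨k, t', ht'⟩ := (hM a D hD h).2 t
  obtain ⟨l, hl⟩ := (hN a D hD h).1 (g.app W t' - a ^ k • s) (by
    rw [map_sub, ← app_res, ht', Scheme.Modules.Hom.app_smul, ht, res_smul, map_pow, sub_self])
  refine ⟨l + k, a ^ l • t', ?_⟩
  rw [Scheme.Modules.Hom.app_smul, ← sub_eq_zero, pow_add, mul_smul, ← smul_sub, hl]

/-- Every point has a neighbourhood on which the section lies in the image. -/
def LocIm (g : M ⟶ N) {U : Y.Opens} (n : Γ(N, U)) : Prop :=
  ∀ z ∈ U, ∃ (U' : Y.Opens) (h : U' ≤ U), z ∈ U' ∧ res N h n ∈ rangeAt g U'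

lemma res_mem_rangeAt {g : M ⟶ N} {U U' : Y.Opens} (h : U' ≤ U) {n : Γ(N, U)}
    (hn : n ∈ rangeAt g U) : res N h n ∈ rangeAt g U' := by
  obtain ⟨m, rfl⟩ := hn
  exact ⟨res M h m, app_res g h m⟩

lemma LocIm.mem_rangeAt {W : Y.Opens} (hW : IsAffineOpen W) (hM : QCAt M W) (hN : QCAt N W)
    {g : M ⟶ N} {s : Γ(N, W)} (hs : LocIm g s) : s ∈ rangeAt g W := by
  refine mem_of_locally hW _ s fun z hz => ?_
  obtain ⟨U', h, hzU, hU⟩ := hs z hz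
  obtain ⟨a, haU, hza⟩ := exists_basicOpen hW h hzU
  refine ⟨a, hza, exists_pow_smul_mem_rangeAt hM hN g a rfl (haU.trans h) s ?_⟩
  rw [← res_res N haU h]
  exact res_mem_rangeAt haU hU

lemma locIm_of_epi (g : M ⟶ N) [Epi g] {U : Y.Opens} (n : Γ(N, U)) : LocIm g n := by
  have := (epi_iff_locally_surjective g).1 inferInstance
  rw [TopCat.Presheaf.isLocallySurjective_iff] at this
  intro z hz
  obtain ⟨V, hV, ⟨s, hs⟩, hx⟩ := this U n z hz
  exact ⟨V, hV, hx, s, hs⟩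

/-- Sections over an open subset, as a functor. -/
def sectionsFunctor (U : Y.Opens) : Y.Modules ⥤ Ab.{u} :=
  Scheme.Modules.toPresheaf Y ⋙ (show TopCat.Presheaf Ab.{u} Y ⥤ Ab.{u} from
    (evaluation (Opens Y)ᵒᵖ Ab.{u}).obj (op U))

instance (U : Y.Opens) : PreservesLimits (sectionsFunctor U) := by
  have : PreservesLimits (show TopCat.Presheaf Ab.{u} Y ⥤ Ab.{u} from
    (evaluation (Opens Y)ᵒᵖ Ab.{u}).obj (op U)) :=
    inferInstanceAs (PreservesLimits ((evaluation (Opens Y)ᵒᵖ Ab.{u}).obj (op U)))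
  exact comp_preservesLimits _ _

instance (U : Y.Opens) : (sectionsFunctor U).PreservesZeroMorphisms := ⟨fun _ _ => rfl⟩

lemma app_injective_of_mono (g : M ⟶ N) [Mono g] (U : Y.Opens) : Function.Injective (g.app U) := by
  have : Mono ((sectionsFunctor U).map g) := inferInstance
  exact (AddCommGrpCat.mono_iff_injective _).1 this

lemma mem_rangeAt_of_exact (S : ShortComplex Y.Modules) (hS : S.Exact) (hm : Mono S.f)
    {U : Y.Opens} {n : Γ(S.X₂, U)} (hn : S.g.app U n = 0) : n ∈ rangeAt S.f U := by
  have := hS.map_of_mono_of_preservesKernel (sectionsFunctor U) hm inferInstance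
  rw [ShortComplex.ab_exact_iff] at this
  exact this n hn

lemma locIm_of_exact (S : ShortComplex Y.Modules) (hS : S.Exact)
    {U : Y.Opens} {n : Γ(S.X₂, U)} (hn : S.g.app U n = 0) : LocIm S.f n := by
  have := S.exact_iff_epi_kernel_lift.1 hS
  obtain ⟨k, hk⟩ := mem_rangeAt_of_exact (ShortComplex.mk (kernel.ι S.g) S.g (kernel.condition _))
    (ShortComplex.exact_of_f_is_kernel _ (kernelIsKernel _)) inferInstance hn
  intro z hz
  obtain ⟨U', h, hz', m, hm⟩ := locIm_of_epi (kernel.lift S.g S.f S.zero) k z hz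
  refine ⟨U', h, hz', m, ?_⟩
  have e : S.f = kernel.lift S.g S.f S.zero ≫ kernel.ι S.g := (kernel.lift_ι _ _ _).symm
  have e' : S.f.app U' m = (kernel.ι S.g).app U' ((kernel.lift S.g S.f S.zero).app U' m) :=
    congr(Scheme.Modules.Hom.app $e U' m)
  rw [e', hm, app_res]
  exact congrArg _ hk

/-- The kernel of a morphism of localizing modules is localizing. -/
lemma qcAt_of_kernel {ι : M ⟶ N} {g : N ⟶ P} {W : Y.Opens}
    (hi : ∀ U, Function.Injective (ι.app U)) (hz : ∀ U n, g.app U (ι.app U n) = 0)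
    (hk : ∀ U n, g.app U n = 0 → n ∈ rangeAt ι U) (hN : QCAt N W) (hP : QCAt P W) : QCAt M W := by
  intro a D hD h
  refine ⟨fun m hm => ?_, fun m => ?_⟩
  · obtain ⟨k, hk'⟩ := (hN a D hD h).1 (ι.app W m) (by rw [← app_res, hm, map_zero])
    exact ⟨k, hi W (by rw [Scheme.Modules.Hom.app_smul, hk', map_zero])⟩
  · obtain ⟨k, m', hk'⟩ := (hN a D hD h).2 (ι.app D m)
    obtain ⟨l, hl⟩ := (hP a D hD h).1 (g.app W m') (by
      rw [← app_res, hk', Scheme.Modules.Hom.app_smul, hz, smul_zero])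
    obtain ⟨m'', hm''⟩ := hk W (a ^ l • m') (by rw [Scheme.Modules.Hom.app_smul, hl])
    refine ⟨l + k, m'', hi D ?_⟩
    rw [app_res, hm'', res_smul, hk', map_pow, Scheme.Modules.Hom.app_smul, pow_add, mul_smul]

section Cokernel
variable {d : M ⟶ N} {p : N ⟶ P}

/-- Near a point, s lifts to a section t of N over some basic open set of b. Over that of ab the
lift lies in the image of d, since s vanishes there, so a power of a moves t into the image over the
basic open set of b and kills s there. Quasi-compactness makes the exponent uniform; no vanishing of
cohomology is needed. -/
lemma exists_pow_smul_eq_zero_of_cokernel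
    (hM : ∀ W, IsAffineOpen W → QCAt M W) (hN : ∀ W, IsAffineOpen W → QCAt N W)
    (hz : ∀ U m, p.app U (d.app U m) = 0) (hk : ∀ U n, p.app U n = 0 → LocIm d n)
    (hp : ∀ U n, LocIm p (U := U) n) {W D : Y.Opens} (hW : IsAffineOpen W) (a : Γ(Y, W))
    (hD : D = Y.basicOpen a) (h : D ≤ W) (s : Γ(P, W)) (hs : res P h s = 0) :
    ∃ k : ℕ, a ^ k • s = 0 := by
  let Q (T : Set Y) : Prop := ∃ k : ℕ, ∀ z ∈ T ∩ W, ∃ (U' : Y.Opens) (h : U' ≤ W), z ∈ U' ∧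
    res P h (a ^ k • s) = 0
  suffices Q (W : Set Y) by
    obtain ⟨k, hk⟩ := this
    exact ⟨k, eq_zero_of_locally _ fun z hz => hk z ⟨hz, hz⟩⟩
  refine hW.isCompact.induction_on (p := Q) ⟨0, fun z hz => hz.1.elim⟩
    (fun A B hAB ⟨k, hk⟩ => ⟨k, fun z hz => hk z ⟨hAB hz.1, hz.2⟩⟩) ?_ ?_
  · rintro A B ⟨k, hk⟩ ⟨l, hl⟩
    refine ⟨k + l, fun z hz => ?_⟩
    rcases hz.1 with hA | hB
    · obtain ⟨U', h', hz', e⟩ := hk z ⟨hA, hz.2⟩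
      exact ⟨U', h', hz', by rw [add_comm, pow_add, mul_smul, res_smul, e, smul_zero]⟩
    · obtain ⟨U', h', hz', e⟩ := hl z ⟨hB, hz.2⟩
      exact ⟨U', h', hz', by rw [pow_add, mul_smul, res_smul, e, smul_zero]⟩
  · intro z hz'
    obtain ⟨U', h', hzU, t, ht⟩ := hp W s z hz'
    obtain ⟨b, hbU, hzb⟩ := exists_basicOpen hW h' hzU
    have hB : IsAffineOpen (Y.basicOpen b) := hW.basicOpen b
    have hBW := Y.basicOpen_le b
    have haB : IsAffineOpen (Y.basicOpen (rres hBW a)) := hB.basicOpen _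
    have hl1 : Y.basicOpen (rres hBW a) ≤ D := by
      rw [basicOpen_rres, hD]
      exact inf_le_right
    have hl2 : Y.basicOpen (rres hBW a) ≤ Y.basicOpen b := Y.basicOpen_le _
    have hd : res N hl2 (res N hbU t) ∈ rangeAt d (Y.basicOpen (rres hBW a)) := by
      refine LocIm.mem_rangeAt haB (hM _ haB) (hN _ haB) (hk _ _ ?_)
      rw [app_res, app_res, ht, res_res, res_res, ← res_res P hl1 h, hs, map_zero]
    obtain ⟨k, m, hm⟩ := exists_pow_smul_mem_rangeAt (hM _ hB) (hN _ hB) d _ rfl hl2 _ hd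
    refine ⟨_, mem_nhdsWithin_of_mem_nhds ((Y.basicOpen b).2.mem_nhds hzb), k, fun w hw =>
      ⟨_, hBW, hw.1, ?_⟩⟩
    rw [res_smul, map_pow, ← res_res P hbU h', ← ht, ← app_res, ← Scheme.Modules.Hom.app_smul,
      ← hm, hz]

/-- Sections of a cokernel of quasi-coherent modules lift on affine open subsets. -/
lemma mem_rangeAt_of_cokernel
    (hM : ∀ W, IsAffineOpen W → QCAt M W) (hN : ∀ W, IsAffineOpen W → QCAt N W)
    (hz : ∀ U m, p.app U (d.app U m) = 0) (hk : ∀ U n, p.app U n = 0 → LocIm d n)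
    (hp : ∀ U n, LocIm p (U := U) n) {W : Y.Opens} (hW : IsAffineOpen W) (s : Γ(P, W)) :
    s ∈ rangeAt p W := by
  refine mem_of_locally hW _ s fun z hz' => ?_
  obtain ⟨U', h, hzU, t, ht⟩ := hp W s z hz'
  obtain ⟨a, haU, hza⟩ := exists_basicOpen hW h hzU
  -- The local lift extends to W after multiplication by a power of a. The error is a section of P
  -- vanishing on the basic open set of a, hence killed by a power of a.
  obtain ⟨k, t', ht'⟩ := (hN W hW a _ rfl (haU.trans h)).2 (res N haU t)
  obtain ⟨l, hl⟩ := exists_pow_smul_eq_zero_of_cokernel hM hN hz hk hp hW a rfl (haU.trans h)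
    (p.app W t' - a ^ k • s) (by
      rw [map_sub, ← app_res, ht', Scheme.Modules.Hom.app_smul, app_res, ht, res_smul, res_res,
        map_pow, sub_self])
  refine ⟨a, hza, l + k, a ^ l • t', ?_⟩
  rw [Scheme.Modules.Hom.app_smul, ← sub_eq_zero, pow_add, mul_smul, ← smul_sub, hl]

/-- The cokernel of a morphism of localizing modules is localizing. -/
lemma qcAt_of_cokernel
    (hM : ∀ W, IsAffineOpen W → QCAt M W) (hN : ∀ W, IsAffineOpen W → QCAt N W)
    (hz : ∀ U m, p.app U (d.app U m) = 0) (hk : ∀ U n, p.app U n = 0 → LocIm d n)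
    (hp : ∀ U n, LocIm p (U := U) n) {W : Y.Opens} (hW : IsAffineOpen W) : QCAt P W := by
  intro a D hD h
  refine ⟨exists_pow_smul_eq_zero_of_cokernel hM hN hz hk hp hW a hD h, fun s => ?_⟩
  obtain ⟨t, rfl⟩ := mem_rangeAt_of_cokernel hM hN hz hk hp (hD ▸ hW.basicOpen a) s
  obtain ⟨k, t', ht⟩ := (hN W hW a D hD h).2 t
  exact ⟨k, p.app W t', by rw [← app_res, ht, Scheme.Modules.Hom.app_smul]⟩

end Cokernel

end
end CartierSheaf

/-! ### Cycles and cohomology of complexes of sheaves with κ -/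

namespace CartierSheaf
noncomputable section
open Scheme.Modules

section
variable {C : Type u'} [Category.{v'} C] [Abelian C] {G : C ⥤ C} [G.Additive] [G.PreservesHomology]

lemma comp_inv_eq_of_comp_hom_eq {A K A' B H B' : C} {p : A ⟶ B} {q : K ⟶ H} {r : A' ⟶ B'}
    {c₁ : A ≅ K} {h₁ : B ≅ H} {c₂ : K ≅ A'} {h₂ : H ≅ B'} (e₁ : p ≫ h₁.hom = c₁.hom ≫ q)
    (e₂ : q ≫ h₂.hom = c₂.hom ≫ r) : r ≫ (h₁ ≪≫ h₂).inv = (c₁ ≪≫ c₂).inv ≫ p := by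
  rw [Iso.comp_inv_eq, Category.assoc, Iso.eq_inv_comp, Iso.trans_hom, Iso.trans_hom,
    Category.assoc, ← e₂, ← reassoc_of% e₁]

lemma mapCyclesIso_inv_iCycles (S : ShortComplex C) :
    (S.mapCyclesIso G).inv ≫ (S.map G).iCycles = G.map S.iCycles :=
  (Iso.inv_comp_eq _).2 (S.mapCyclesIso_hom_iCycles G).symm

/-- The structure map on cohomology is defined through the comparison of an exact functor with
homology. Its compatibility with the projection from cycles is what makes that projection commute
with κ. -/
lemma map_homologyπ_comp_inv (S : ShortComplex C) :
    G.map S.homologyπ ≫ (S.mapHomologyIso G).inv = (S.mapCyclesIso G).inv ≫ (S.map G).homologyπ := by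
  have e1 := S.homologyData.left.mapHomologyIso_eq G
  have e2 := S.homologyData.left.mapCyclesIso_eq G
  have e3 := (S.homologyData.left.map G).homologyπ_comp_homologyIso_hom
  have e4 : G.map S.homologyData.left.π ≫ (G.mapIso S.homologyData.left.homologyIso.symm).hom =
      (G.mapIso S.homologyData.left.cyclesIso.symm).hom ≫ G.map S.homologyπ :=
    ((G.map_comp _ _).symm.trans (congrArg G.map
      S.homologyData.left.π_comp_homologyIso_inv)).trans (G.map_comp _ _)
  refine (congrArg (fun z => _ ≫ Iso.inv z) e1).trans
    (Eq.trans ?_ (congrArg (fun z => Iso.inv z ≫ _) e2).symm)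
  exact comp_inv_eq_of_comp_hom_eq e3 e4

/-- The cycles of a complex of algebras, with the induced structure map. -/
def cycAlg (K : CochainComplex (Endofunctor.Algebra G) ℤ) (i : ℤ) : Endofunctor.Algebra G where
  a := (underlying K).cycles i
  str := (((underlying K).sc i).mapCyclesIso G).inv ≫
    HomologicalComplex.cyclesMap (strHom K) i

/-- The inclusion of the cycles. -/
def cycI (K : CochainComplex (Endofunctor.Algebra G) ℤ) (i : ℤ) : cycAlg K i ⟶ K.X i where
  f := (underlying K).iCycles i
  h := by
    have h1 := HomologicalComplex.cyclesMap_i (strHom K) i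
    have h2 := mapCyclesIso_inv_iCycles (G := G) ((underlying K).sc i)
    refine Eq.trans ?_ (Category.assoc _ _ _).symm
    refine Eq.trans ?_ (congrArg (_ ≫ ·) h1.symm)
    refine Eq.trans ?_ (Category.assoc _ _ _)
    exact congrArg (· ≫ _) h2.symm

/-- The projection from cycles to cohomology. -/
def cycP (K : CochainComplex (Endofunctor.Algebra G) ℤ) (i : ℤ) :
    cycAlg K i ⟶ cohomologyAlg K i where
  f := (underlying K).homologyπ i
  h := by
    have h1 := HomologicalComplex.homologyπ_naturality (strHom K) i
    have h2 := map_homologyπ_comp_inv (G := G) ((underlying K).sc i)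
    refine Eq.trans ?_ (Category.assoc _ _ _).symm
    refine Eq.trans ?_ (congrArg (_ ≫ ·) h1)
    refine (Category.assoc _ _ _).symm.trans ?_
    refine Eq.trans ?_ (Category.assoc _ _ _)
    exact congrArg (· ≫ _) h2

end

section
variable {Y : Scheme.{u}} (L : CochainComplex Y.Modules ℤ) (i : ℤ)

lemma iCycles_injective (U : Y.Opens) : Function.Injective ((L.iCycles i).app U) :=
  app_injective_of_mono _ _

lemma d_iCycles (j : ℤ) (U : Y.Opens) (n : Γ(L.cycles i, U)) :
    (L.d i j).app U ((L.iCycles i).app U n) = 0 :=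
  congr(Scheme.Modules.Hom.app $(L.iCycles_d i j) U n)

lemma mem_rangeAt_iCycles {U : Y.Opens} {n : Γ(L.X i, U)} (hn : (L.d i (i + 1)).app U n = 0) :
    n ∈ rangeAt (L.iCycles i) U :=
  mem_rangeAt_of_exact (ShortComplex.mk (L.iCycles i) (L.d i (i + 1)) (L.iCycles_d _ _))
    (ShortComplex.exact_of_f_is_kernel _ (L.cyclesIsKernel i (i + 1) (by simp)))
    (inferInstanceAs (Mono (L.iCycles i))) hn

lemma iCycles_toCycles (j : ℤ) (U : Y.Opens) (n : Γ(L.X j, U)) :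
    (L.iCycles i).app U ((L.toCycles j i).app U n) = (L.d j i).app U n :=
  congr(Scheme.Modules.Hom.app $(L.toCycles_i j i) U n)

lemma homologyπ_toCycles (j : ℤ) (U : Y.Opens) (n : Γ(L.X j, U)) :
    (L.homologyπ i).app U ((L.toCycles j i).app U n) = 0 :=
  congr(Scheme.Modules.Hom.app $(L.toCycles_comp_homologyπ j i) U n)

lemma locIm_toCycles {U : Y.Opens} {n : Γ(L.cycles i, U)} (hn : (L.homologyπ i).app U n = 0) :
    LocIm (L.toCycles (i - 1) i) n :=
  locIm_of_exact (ShortComplex.mk (L.toCycles (i - 1) i) (L.homologyπ i)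
    (L.toCycles_comp_homologyπ _ _))
    (ShortComplex.exact_of_g_is_cokernel _ (L.homologyIsCokernel (i - 1) i (by simp))) hn

lemma locIm_homologyπ {U : Y.Opens} (n : Γ(L.homology i, U)) : LocIm (L.homologyπ i) n :=
  locIm_of_epi _ n

variable {L}

lemma qcAt_cycles (hL : ∀ i, (L.X i).IsQuasicoherent)
    {W : Y.Opens} (hW : IsAffineOpen W) : QCAt (L.cycles i) W :=
  have := hL i
  have := hL (i + 1)
  qcAt_of_kernel (ι := L.iCycles i) (g := L.d i (i + 1)) (iCycles_injective L i)
    (d_iCycles L i (i + 1)) (fun _ _ h => mem_rangeAt_iCycles L i h)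
    (qcAt_of_isQuasicoherent _ hW) (qcAt_of_isQuasicoherent _ hW)

lemma qcAt_homology (hL : ∀ i, (L.X i).IsQuasicoherent)
    {W : Y.Opens} (hW : IsAffineOpen W) : QCAt (L.homology i) W :=
  have := hL (i - 1)
  qcAt_of_cokernel (d := L.toCycles (i - 1) i) (p := L.homologyπ i)
    (fun _ h => qcAt_of_isQuasicoherent _ h) (fun _ h => qcAt_cycles i hL h)
    (homologyπ_toCycles L i (i - 1)) (fun _ _ h => locIm_toCycles L i h)
    (fun _ n => locIm_homologyπ L i n) hW

lemma mem_rangeAt_homologyπ (hL : ∀ i, (L.X i).IsQuasicoherent)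
    {W : Y.Opens} (hW : IsAffineOpen W) (n : Γ(L.homology i, W)) :
    n ∈ rangeAt (L.homologyπ i) W :=
  have := hL (i - 1)
  mem_rangeAt_of_cokernel (d := L.toCycles (i - 1) i) (p := L.homologyπ i)
    (fun _ h => qcAt_of_isQuasicoherent _ h) (fun _ h => qcAt_cycles i hL h)
    (homologyπ_toCycles L i (i - 1)) (fun _ _ h => locIm_toCycles L i h)
    (fun _ n => locIm_homologyπ L i n) hW n

lemma mem_rangeAt_toCycles (hL : ∀ i, (L.X i).IsQuasicoherent)
    {W : Y.Opens} (hW : IsAffineOpen W) {n : Γ(L.cycles i, W)}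
    (hn : (L.homologyπ i).app W n = 0) : n ∈ rangeAt (L.toCycles (i - 1) i) W :=
  have := hL (i - 1)
  (locIm_toCycles L i hn).mem_rangeAt hW (qcAt_of_isQuasicoherent _ hW) (qcAt_cycles i hL hW)

end

end
end CartierSheaf

/-! ### The geometry of X × C over X: Noetherian rings, finiteness of σ × id, germs -/

namespace CartierSheaf
noncomputable section
open Scheme.Modules

set_option linter.unusedSectionVars false

lemma isNoetherianRing_of_isPushout {A B C P : CommRingCat.{u}} {f : A ⟶ B} {g : A ⟶ C}
    {inl : B ⟶ P} {inr : C ⟶ P} (h : IsPushout f g inl inr) [IsNoetherianRing B]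
    (hg : @Algebra.EssFiniteType A C _ _ g.hom.toAlgebra) : IsNoetherianRing P := by
  let := f.hom.toAlgebra
  let := g.hom.toAlgebra
  have := Algebra.EssFiniteType.isNoetherianRing B (TensorProduct A B C)
  let e := (CommRingCat.isPushout_tensorProduct A B C).isoIsPushout _ _ h
  exact isNoetherianRing_of_ringEquiv _ e.commRingCatIsoToRingEquiv

lemma finite_appLE_of_isFinite {Y Z : Scheme.{u}} (g : Y ⟶ Z) [IsFinite g] {W : Z.Opens}
    (hW : IsAffineOpen W) {W' : Y.Opens} (e : W' = g ⁻¹ᵁ W) :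
    (g.appLE W W' e.le).hom.Finite := by
  subst e
  rw [Scheme.Hom.appLE_eq_app]
  exact IsFinite.finite_app g W hW

/-- On an affine open subset, functions near a point are fractions. -/
lemma exists_pow_mul_rres_eq {Y : Scheme.{u}} {W D : Y.Opens} (hW : IsAffineOpen W) (a : Γ(Y, W))
    (hD : D = Y.basicOpen a) (h : D ≤ W) (b : Γ(Y, D)) :
    ∃ (k : ℕ) (c : Γ(Y, W)), rres h a ^ k * b = rres h c := by
  subst hD
  have := hW.isLocalization_basicOpen a
  obtain ⟨k, c, hc⟩ := IsLocalization.Away.surj a b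
  exact ⟨k, c, (mul_comm _ _).trans hc⟩

variable {F : Type u} [Field F] [Finite F] {X : Scheme.{u}} (f : X ⟶ Spec (CommRingCat.of F))
variable (Λ : Type u) [CommRing Λ] [Algebra F Λ]

instance : IsAffineHom (prX f Λ) :=
  MorphismProperty.of_isPullback (P := @IsAffineHom.{u})
    (IsPullback.of_hasPullback f (Spec.map (CommRingCat.ofHom (algebraMap F Λ)))).flip inferInstance

lemma preimage_le {U U' : X.Opens} (h : U' ≤ U) : prX f Λ ⁻¹ᵁ U' ≤ prX f Λ ⁻¹ᵁ U :=
  ((Opens.map (prX f Λ).base).map (homOfLE h)).le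

lemma isAffineOpen_preimage {U : X.Opens} (hU : IsAffineOpen U) :
    IsAffineOpen (prX f Λ ⁻¹ᵁ U) := hU.preimage _

lemma isNoetherianRing_sections [Algebra.EssFiniteType F Λ] [IsLocallyNoetherian X] {U : X.Opens}
    (hU : IsAffineOpen U) : IsNoetherianRing Γ(prodC f Λ, prX f Λ ⁻¹ᵁ U) := by
  have : IsAffine U := hU
  have hN : IsNoetherianRing Γ(X, U) := IsLocallyNoetherian.component_noetherian ⟨U, hU⟩
  have hN' : IsNoetherianRing Γ(U, ⊤) :=
    isNoetherianRing_of_ringEquiv _ U.topIso.symm.commRingCatIsoToRingEquiv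
  have h := isPushout_appTop_of_isPullback
    ((isPullback_morphismRestrict (prX f Λ) U).flip.paste_horiz (IsPullback.of_hasPullback f
      (Spec.map (CommRingCat.ofHom (algebraMap F Λ)))).flip).flip
  have h' := h.of_iso (Scheme.ΓSpecIso _) (Iso.refl _) (Scheme.ΓSpecIso _) (Iso.refl _)
    (f' := (Scheme.ΓSpecIso _).inv ≫ (U.ι ≫ f).appTop) (g' := CommRingCat.ofHom (algebraMap F Λ))
    (inl' := (prX f Λ ∣_ U).appTop) (inr' := (Scheme.ΓSpecIso _).inv ≫ ((prX f Λ ⁻¹ᵁ U).ι ≫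
      pullback.snd f (Spec.map (CommRingCat.ofHom (algebraMap F Λ)))).appTop) (by simp)
    (Scheme.ΓSpecIso_naturality _) ((Category.comp_id _).trans (Category.id_comp _).symm) (by simp)
  have := isNoetherianRing_of_isPushout h' (by
    have e : (algebraMap F Λ).toAlgebra = ‹Algebra F Λ› := Algebra.algebra_ext _ _ fun _ => rfl
    change @Algebra.EssFiniteType F Λ _ _ (algebraMap F Λ).toAlgebra
    rw [e]
    infer_instance)
  exact isNoetherianRing_of_ringEquiv _ (prX f Λ ⁻¹ᵁ U).topIso.commRingCatIsoToRingEquiv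

/-- As σ is a morphism over F, pasting this square with the product square gives the product square
again; cancelling shows that σ × id is a base change of σ, so finiteness of σ passes to it. -/
lemma isPullback_sigma : IsPullback (sigma f Λ) (prX f Λ) (prX f Λ) (frob f) := by
  refine IsPullback.of_right (h₁₂ := pullback.snd _ _) (h₂₂ := f)
    (v₁₃ := Spec.map (CommRingCat.ofHom (algebraMap F Λ))) ?_ (sigma_prX f Λ)
    (IsPullback.of_hasPullback f (Spec.map (CommRingCat.ofHom (algebraMap F Λ)))).flip
  rw [sigma_snd, frob_comp]
  exact (IsPullback.of_hasPullback _ _).flip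

lemma isFinite_sigma (h : IsFinite (frob f)) : IsFinite (sigma f Λ) :=
  MorphismProperty.of_isPullback (isPullback_sigma f Λ).flip h

/-- The endomorphism `σ × id` on sections over the preimage of `U`. -/
abbrev sigmaOn (U : X.Opens) :
    Γ(prodC f Λ, prX f Λ ⁻¹ᵁ U) →+* Γ(prodC f Λ, prX f Λ ⁻¹ᵁ U) :=
  ((sigma f Λ).appLE (prX f Λ ⁻¹ᵁ U) (prX f Λ ⁻¹ᵁ U) (sigma_preimage f Λ U).ge).hom

lemma finite_sigmaOn (h : IsFinite (frob f)) {U : X.Opens} (hU : IsAffineOpen U) :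
    (sigmaOn f Λ U).Finite :=
  have := isFinite_sigma f Λ h
  finite_appLE_of_isFinite (sigma f Λ) (isAffineOpen_preimage f Λ hU) (sigma_preimage f Λ U).symm

/-- Pullback of functions along `X × C ⟶ X`. -/
abbrev prS (U : X.Opens) : Γ(X, U) →+* Γ(prodC f Λ, prX f Λ ⁻¹ᵁ U) := ((prX f Λ).app U).hom

lemma sigmaOn_prS (U : X.Opens) (r : Γ(X, U)) :
    sigmaOn f Λ U (prS f Λ U r) = prS f Λ U r ^ Nat.card F := by
  have h2 : (prX f Λ).app U ≫ (sigma f Λ).appLE _ (prX f Λ ⁻¹ᵁ U) (sigma_preimage f Λ U).ge =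
      (frob f).app U ≫ (prX f Λ).app U := by
    have e1 : prX f Λ ⁻¹ᵁ U ≤ (sigma f Λ ≫ prX f Λ) ⁻¹ᵁ U := (sigma_preimage f Λ U).ge
    have e2 : prX f Λ ⁻¹ᵁ U ≤ (prX f Λ ≫ frob f) ⁻¹ᵁ U := le_rfl
    have e3 : (sigma f Λ ≫ prX f Λ).appLE U _ e1 = (prX f Λ ≫ frob f).appLE U _ e2 := by
      simp only [sigma_prX]
    rw [Scheme.Hom.comp_appLE, Scheme.Hom.comp_appLE] at e3
    rw [e3, Scheme.Hom.app_eq_appLE (prX f Λ)]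
    rfl
  refine congr($h2 r).trans ?_
  change (prX f Λ).app U ((frob f).app U r) = _
  rw [frob_app, map_pow]

lemma prS_rres {U U' : X.Opens} (h : U' ≤ U) (r : Γ(X, U)) :
    prS f Λ U' (rres h r) = rres (preimage_le f Λ h) (prS f Λ U r) :=
  congr($((prX f Λ).c.naturality (homOfLE h).op) r)

lemma basicOpen_prS {U : X.Opens} (r : Γ(X, U)) :
    prX f Λ ⁻¹ᵁ X.basicOpen r = (prodC f Λ).basicOpen (prS f Λ U r) :=
  Scheme.preimage_basicOpen (prX f Λ) r

/-- The germ at `x` of a function over the preimage of a neighbourhood of `x`. -/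
abbrev gm (x : X) (U : X.Opens) (hx : x ∈ U) :
    Γ(prodC f Λ, prX f Λ ⁻¹ᵁ U) →+* ringAt f Λ x := ((ringX f Λ).germ U x hx).hom

lemma gm_rres (x : X) {U U' : X.Opens} (h : U' ≤ U) (hx : x ∈ U')
    (a : Γ(prodC f Λ, prX f Λ ⁻¹ᵁ U)) :
    gm f Λ x U' hx (rres (preimage_le f Λ h) a) =
      gm f Λ x U (h hx) a :=
  TopCat.Presheaf.germ_res_apply (ringX f Λ) (homOfLE h) x hx a

lemma toRingAt_germ (x : X) (U : X.Opens) (hx : x ∈ U) (r : Γ(X, U)) :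
    toRingAt f Λ x (X.presheaf.germ U x hx r) = gm f Λ x U hx (prS f Λ U r) :=
  TopCat.Presheaf.stalkFunctor_map_germ_apply U x hx (toRingX f Λ) r

lemma isUnit_gm_prS {x : X} {U : X.Opens} (hx : x ∈ U) {r : Γ(X, U)} (hr : x ∈ X.basicOpen r) :
    IsUnit (gm f Λ x U hx (prS f Λ U r)) := by
  rw [← toRingAt_germ]
  exact ((X.mem_basicOpen r x hx).1 hr).map _

lemma mem_basicOpen_pow {Y : Scheme.{u}} {x : Y} {U : Y.Opens} {r : Γ(Y, U)} (hr : x ∈ Y.basicOpen r)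
    (k : ℕ) : x ∈ Y.basicOpen (r ^ k) := by
  have hx := Y.basicOpen_le _ hr
  rw [Y.mem_basicOpen _ _ hx] at hr ⊢
  rw [map_pow]
  exact hr.pow k

/-- The denominators come from X alone, because the neighbourhoods involved are preimages from X.
This matters: on such functions the endomorphism is the q-power map. -/
lemma exists_gm {x : X} {U : X.Opens} (hU : IsAffineOpen U) (hx : x ∈ U) (y : ringAt f Λ x) :
    ∃ (s : Γ(X, U)) (a : Γ(prodC f Λ, prX f Λ ⁻¹ᵁ U)), x ∈ X.basicOpen s ∧
      gm f Λ x U hx (prS f Λ U s) * y = gm f Λ x U hx a := by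
  obtain ⟨V, hV, b, rfl⟩ : ∃ V hV b, gm f Λ x V hV b = y :=
    TopCat.Presheaf.exists_germ_eq (ringX f Λ) y
  obtain ⟨r, hrV, hxr⟩ := exists_basicOpen hU (W' := U ⊓ V) inf_le_left ⟨hx, hV⟩
  have hrU := X.basicOpen_le r
  obtain ⟨k, c, hc⟩ := exists_pow_mul_rres_eq (isAffineOpen_preimage f Λ hU) (prS f Λ U r)
    (basicOpen_prS f Λ r) (preimage_le f Λ hrU)
    (rres (preimage_le f Λ (hrV.trans inf_le_right)) b)
  refine ⟨r ^ k, c, mem_basicOpen_pow hxr k, ?_⟩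
  have := congrArg (gm f Λ x _ hxr) hc
  rw [map_mul, map_pow, gm_rres f Λ x hrU, gm_rres f Λ x (hrV.trans inf_le_right),
    gm_rres f Λ x hrU, ← map_pow, ← map_pow] at this
  exact this

lemma exists_germ_mul {Y : Scheme.{u}} {x : Y} {U : Y.Opens} (hU : IsAffineOpen U) (hx : x ∈ U)
    (y : Y.presheaf.stalk x) : ∃ s a : Γ(Y, U), x ∈ Y.basicOpen s ∧
      Y.presheaf.germ U x hx s * y = Y.presheaf.germ U x hx a := by
  obtain ⟨V, hV, b, rfl⟩ := TopCat.Presheaf.exists_germ_eq Y.presheaf y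
  obtain ⟨r, hrV, hxr⟩ := exists_basicOpen hU (W' := U ⊓ V) inf_le_left ⟨hx, hV⟩
  have hrU := Y.basicOpen_le r
  obtain ⟨k, c, hc⟩ := exists_pow_mul_rres_eq hU r rfl hrU (rres (hrV.trans inf_le_right) b)
  refine ⟨r ^ k, c, mem_basicOpen_pow hxr k, ?_⟩
  have hg {V' V : Y.Opens} (h : V' ≤ V) (hx : x ∈ V') (a : Γ(Y, V)) :
      Y.presheaf.germ V' x hx (rres h a) = Y.presheaf.germ V x (h hx) a :=
    TopCat.Presheaf.germ_res_apply Y.presheaf (homOfLE h) x hx a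
  have := congrArg (Y.presheaf.germ _ x hxr) hc
  rw [map_mul, map_pow, hg, hg, hg, ← map_pow] at this
  exact this

/-- As in any localization, every ideal of A_x is extended from the Noetherian ring of functions
over an affine neighbourhood. -/
lemma isNoetherianRing_ringAt [Algebra.EssFiniteType F Λ] [IsLocallyNoetherian X] (x : X) :
    IsNoetherianRing (ringAt f Λ x) := by
  obtain ⟨_, ⟨U, hU, rfl⟩, hx, -⟩ :=
    X.isBasis_affineOpens.exists_subset_of_mem_open (Set.mem_univ x) isOpen_univ
  have hN := isNoetherianRing_sections f Λ hU
  refine isNoetherianRing_iff_ideal_fg _ |>.2 fun J => ?_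
  suffices J = (J.comap (gm f Λ x U hx)).map (gm f Λ x U hx) by
    rw [this]
    exact Ideal.FG.map ((isNoetherianRing_iff_ideal_fg _).1 hN _) _
  refine le_antisymm (fun y hy => ?_) Ideal.map_comap_le
  obtain ⟨s, a, hs, e⟩ := exists_gm f Λ hU hx y
  obtain ⟨u, hu⟩ := isUnit_gm_prS f Λ hx hs
  have : y = ↑u⁻¹ * gm f Λ x U hx a := by rw [← e, ← hu, Units.inv_mul_cancel_left]
  rw [this]
  refine Ideal.mul_mem_left _ _ (Ideal.mem_map_of_mem _ ?_)
  rw [Ideal.mem_comap, ← e]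
  exact J.mul_mem_left _ hy

lemma exists_mem_iff_basicOpen {Y : Scheme.{u}} {U : Y.Opens} (hU : IsAffineOpen U)
    (p : Ideal Γ(Y, U)) [hp : p.IsPrime] : ∃ x ∈ U, ∀ r, x ∈ Y.basicOpen r ↔ r ∉ p := by
  refine ⟨hU.fromSpec ⟨p, hp⟩, ?_, fun r => ?_⟩
  · have : hU.fromSpec ⟨p, hp⟩ ∈ Set.range hU.fromSpec := ⟨_, rfl⟩
    rwa [hU.range_fromSpec] at this
  · change (⟨p, hp⟩ : Spec Γ(Y, U)) ∈ hU.fromSpec ⁻¹ᵁ Y.basicOpen r ↔ _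
    rw [hU.fromSpec_preimage_basicOpen]
    rfl

end
end CartierSheaf

/-! ### Iterates of κ on sections, and the finiteness condition -/

namespace CartierSheaf
noncomputable section
open Scheme.Modules

set_option linter.unusedSectionVars false

section
variable {A E : Type*} [CommRing A] [AddCommGroup E] [Module A E]

/-- The elements generating a submodule killed by the `n`-th iterate of `k`. -/
def nilSub (A : Type*) [CommRing A] [Module A E] (k : E →+ E) (n : ℕ) : Submodule A E where
  carrier := {v | ∀ a : A, k^[n] (a • v) = 0}
  add_mem' := by
    intro v w hv hw a
    rw [smul_add, iterate_add, hv, hw, add_zero]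
  zero_mem' := by
    intro a
    rw [smul_zero]
    exact iterate_map_zero k n
  smul_mem' := by
    intro c v hv a
    rw [smul_smul]
    exact hv _

lemma nilSub_mono {k : E →+ E} {m n : ℕ} (h : m ≤ n) : nilSub A k m ≤ nilSub A k n :=
  fun _ hv a => iterate_eq_zero_of_le k h (hv a)

/-- The submodule of locally nilpotent elements. -/
def lnSub (A : Type*) [CommRing A] [Module A E] (k : E →+ E) : Submodule A E where
  carrier := {v | LN A k v}
  add_mem' := by
    rintro v w ⟨m, hm⟩ ⟨n, hn⟩
    exact ⟨m + n, (nilSub A k (m + n)).add_mem (nilSub_mono (Nat.le_add_right _ _) hm)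
      (nilSub_mono (Nat.le_add_left _ _) hn)⟩
  zero_mem' := ⟨0, (nilSub A k 0).zero_mem⟩
  smul_mem' := by
    rintro c v ⟨n, hn⟩
    exact ⟨n, (nilSub A k n).smul_mem c hn⟩

/-- The elements lying in a finitely generated submodule stable under `k`. -/
def finSub (A : Type*) [CommRing A] [Module A E] (k : E →+ E) : Submodule A E where
  carrier := {v | ∃ S : Submodule A E, S.FG ∧ (∀ w ∈ S, k w ∈ S) ∧ v ∈ S}
  add_mem' := by
    rintro v w ⟨S, hS, hkS, hv⟩ ⟨T, hT, hkT, hw⟩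
    refine ⟨S ⊔ T, hS.sup hT, fun x hx => ?_, add_mem (Submodule.mem_sup_left hv)
      (Submodule.mem_sup_right hw)⟩
    obtain ⟨y, hy, z, hz, rfl⟩ := Submodule.mem_sup.1 hx
    rw [map_add]
    exact add_mem (Submodule.mem_sup_left (hkS y hy)) (Submodule.mem_sup_right (hkT z hz))
  zero_mem' := ⟨⊥, Submodule.fg_bot, fun w hw => by
    rw [(Submodule.mem_bot A).1 hw, map_zero]
    exact zero_mem _, zero_mem _⟩
  smul_mem' := by
    rintro c v ⟨S, hS, hkS, hv⟩
    exact ⟨S, hS, hkS, S.smul_mem c hv⟩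

end

variable {F : Type u} [Field F] [Finite F] {X : Scheme.{u}} {f : X ⟶ Spec (CommRingCat.of F)}
variable {Λ : Type u} [CommRing Λ] [Algebra F Λ]

lemma isKappa_kappaOn (V : KappaMod f Λ) (U : X.Opens) :
    IsKappa (sigmaOn f Λ U) (kappaOn f Λ V U) := fun a v => kappaOn_smul f Λ V U a v

lemma iterate_kappaOn_res (V : KappaMod f Λ) {U' U : X.Opens} (h : U' ≤ U) (n : ℕ)
    (v : Γ(V.a, prX f Λ ⁻¹ᵁ U)) :
    (kappaOn f Λ V U')^[n] (res V.a (preimage_le f Λ h) v) =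
      res V.a (preimage_le f Λ h) ((kappaOn f Λ V U)^[n] v) :=
  (Function.Semiconj.iterate_right (f := res V.a (preimage_le f Λ h))
    (fun w => (kappaOn_res f Λ V (homOfLE h) w).symm) n v).symm

lemma iterate_kappaOn_app {V V' : KappaMod f Λ} (g : V ⟶ V') (U : X.Opens) (n : ℕ)
    (v : Γ(V.a, prX f Λ ⁻¹ᵁ U)) :
    (kappaOn f Λ V' U)^[n] (g.f.app _ v) = g.f.app _ ((kappaOn f Λ V U)^[n] v) :=
  (Function.Semiconj.iterate_right (f := g.f.app (prX f Λ ⁻¹ᵁ U))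
    (fun w => (kappaOn_naturality f Λ g U w).symm) n v).symm

/-- The source of κ^n is an iterated pushforward, whose sections over the preimage of U are those of
V only up to equalities of open sets. Comparing ranges is enough for vanishing and avoids naming
this identification. -/
lemma range_kpow (V : KappaMod f Λ) (U : X.Opens) (n : ℕ) :
    Set.range ((kpow V n).app (prX f Λ ⁻¹ᵁ U)) = Set.range (kappaOn f Λ V U)^[n] := by
  induction n with
  | zero => exact (Set.range_id).trans Set.range_id.symm
  | succ n ih =>
    rw [Function.iterate_succ', Set.range_comp, ← ih, ← Set.range_comp]
    have e (p : Γ(powObj (Scheme.Modules.pushforward (sigma f Λ)) V.a n, prX f Λ ⁻¹ᵁ U)) :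
        (kpow V (n + 1)).app (prX f Λ ⁻¹ᵁ U) (res _ (sigma_preimage f Λ U).le p) =
          kappaOn f Λ V U ((kpow V n).app _ p) :=
      congrArg (V.str.app (prX f Λ ⁻¹ᵁ U)) (app_res (kpow V n) (sigma_preimage f Λ U).le p)
    ext w
    constructor
    · rintro ⟨p, rfl⟩
      refine ⟨res (powObj (Scheme.Modules.pushforward (sigma f Λ)) V.a n)
        (sigma_preimage f Λ U).ge p, (e _).symm.trans ?_⟩
      exact congrArg ((kpow V (n + 1)).app (prX f Λ ⁻¹ᵁ U))
        ((res_res (powObj (Scheme.Modules.pushforward (sigma f Λ)) V.a n) _ _ _).trans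
          (res_self _ _ _))
    · rintro ⟨p, rfl⟩
      exact ⟨_, e p⟩

lemma iterate_kappaOn_eq_zero {V : KappaMod f Λ} {n : ℕ} (h : kpow V n = 0) (U : X.Opens)
    (v : Γ(V.a, prX f Λ ⁻¹ᵁ U)) : (kappaOn f Λ V U)^[n] v = 0 := by
  have : (kappaOn f Λ V U)^[n] v ∈ Set.range ((kpow V n).app (prX f Λ ⁻¹ᵁ U)) := by
    rw [range_kpow]
    exact ⟨v, rfl⟩
  obtain ⟨p, hp⟩ := this
  rw [← hp, h]
  rfl

lemma qcAt_pushforward {Y Z : Scheme.{u}} (g : Y ⟶ Z) (M : Y.Modules) (W : Z.Opens)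
    (h : QCAt M (g ⁻¹ᵁ W)) : QCAt ((Scheme.Modules.pushforward g).obj M) W := by
  intro a D hD hDW
  subst hD
  obtain ⟨h1, h2⟩ := h (g.app W a) _ (Scheme.preimage_basicOpen g a)
    ((Opens.map g.base).map (homOfLE hDW)).le
  have e : rres ((Opens.map g.base).map (homOfLE hDW)).le (g.app W a) =
      g.app _ (rres hDW a) := congr($(g.c.naturality (homOfLE hDW).op) a).symm
  refine ⟨fun m hm => ?_, fun m => ?_⟩
  · obtain ⟨k, hk⟩ := h1 m hm
    refine ⟨k, Eq.trans ?_ hk⟩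
    rw [← map_pow]
    rfl
  · obtain ⟨k, m', hk⟩ := h2 m
    refine ⟨k, m', hk.trans ?_⟩
    rw [e, ← map_pow]
    rfl

lemma qcAt_powObj {M : (prodC f Λ).Modules} {U : X.Opens} (h : QCAt M (prX f Λ ⁻¹ᵁ U)) (n : ℕ) :
    QCAt (powObj (Scheme.Modules.pushforward (sigma f Λ)) M n) (prX f Λ ⁻¹ᵁ U) := by
  induction n with
  | zero => exact h
  | succ n ih =>
    refine qcAt_pushforward _ _ _ ?_
    rw [sigma_preimage]
    exact ih

lemma smul_eq_zero_of_basicOpen {Y : Scheme.{u}} (M : Y.Modules) {W D : Y.Opens} (a : Γ(Y, W))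
    (hD : D = Y.basicOpen a) (h : D ≤ W) (k : ℕ) (m : Γ(M, D)) (hm : rres h a ^ k • m = 0) :
    m = 0 := by
  subst hD
  have : IsUnit (rres h a) := RingedSpace.isUnit_res_basicOpen _ a
  exact ((this.pow k).smul_eq_zero).1 hm

/-- Every point has a basic neighbourhood in the preimage of an affine open subset. -/
lemma exists_basicOpen_preimage {W : (prodC f Λ).Opens} {z : prodC f Λ} (hz : z ∈ W) :
    ∃ U : X.Opens, IsAffineOpen U ∧ ∃ a : Γ(prodC f Λ, prX f Λ ⁻¹ᵁ U),
      z ∈ (prodC f Λ).basicOpen a ∧ (prodC f Λ).basicOpen a ≤ W := by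
  obtain ⟨_, ⟨U, hU, rfl⟩, hx, -⟩ :=
    X.isBasis_affineOpens.exists_subset_of_mem_open (Set.mem_univ (prX f Λ z)) isOpen_univ
  obtain ⟨a, ha, hza⟩ := exists_basicOpen (isAffineOpen_preimage f Λ hU)
    (W' := prX f Λ ⁻¹ᵁ U ⊓ W) inf_le_left ⟨hx, hz⟩
  exact ⟨U, hU, a, hza, ha.trans inf_le_right⟩

/-- If the iterates vanish on preimages of affine opens, then so does the iterate of the
structure map. -/
lemma kpow_eq_zero {V : KappaMod f Λ} (hV : ∀ U, IsAffineOpen U → QCAt V.a (prX f Λ ⁻¹ᵁ U)) {n : ℕ}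
    (h : ∀ U, IsAffineOpen U → ∀ v, (kappaOn f Λ V U)^[n] v = 0) : kpow V n = 0 := by
  have h0 (U : X.Opens) (hU : IsAffineOpen U) (p) : (kpow V n).app (prX f Λ ⁻¹ᵁ U) p = 0 := by
    have : (kpow V n).app (prX f Λ ⁻¹ᵁ U) p ∈ Set.range (kappaOn f Λ V U)^[n] := by
      rw [← range_kpow]
      exact ⟨p, rfl⟩
    obtain ⟨v, hv⟩ := this
    rw [← hv, h U hU]
  refine Scheme.Modules.hom_ext _ _ fun W => ?_
  ext p
  refine eq_zero_of_locally _ fun z hz => ?_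
  obtain ⟨U, hU, a, hza, haW⟩ := exists_basicOpen_preimage hz
  refine ⟨_, haW, hza, ?_⟩
  obtain ⟨k, p', hp⟩ := (qcAt_powObj (hV U hU) n a _ rfl ((prodC f Λ).basicOpen_le a)).2
    (res _ haW p)
  refine smul_eq_zero_of_basicOpen V.a a rfl ((prodC f Λ).basicOpen_le a) k _ ?_
  rw [← app_res, ← Scheme.Modules.Hom.app_smul, ← hp, app_res, h0 U hU, map_zero]

/-- The submodules `κ^n (A v)` of sections over preimages of affine opens are finitely
generated. -/
def QK (V : KappaMod f Λ) : Prop :=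
  ∀ U : X.Opens, IsAffineOpen U → ∀ (v : Γ(V.a, prX f Λ ⁻¹ᵁ U)) (n : ℕ),
    ((isKappa_kappaOn V U).powSpan n v).FG

lemma QK.of_isFinite (h : IsFinite (frob f)) (V : KappaMod f Λ) : QK V := fun U hU v n =>
  (isKappa_kappaOn V U).powSpan_fg_of_finite (finite_sigmaOn f Λ h hU) n v

/-- A morphism on sections, as a linear map. -/
def appLin {Y : Scheme.{u}} {M N : Y.Modules} (g : M ⟶ N) (W : Y.Opens) :
    Γ(M, W) →ₗ[Γ(Y, W)] Γ(N, W) where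
  toFun := g.app W
  map_add' := map_add _
  map_smul' _ _ := Scheme.Modules.Hom.app_smul _ _ _

/-- Near each point the section comes from a κ-subsheaf with property P. Quasi-coherence clears
denominators, so a multiple by a power of a function nonvanishing at the point comes from that
subsheaf over the whole preimage of U and lies in S. Such multiples decide membership. -/
lemma mem_of_isUnionOf {P : KappaMod f Λ → Prop} {V : KappaMod f Λ} (hV : IsUnionOf f Λ P V)
    {U : X.Opens} (hU : IsAffineOpen U) (hq : QCAt V.a (prX f Λ ⁻¹ᵁ U))
    (S : Submodule Γ(prodC f Λ, prX f Λ ⁻¹ᵁ U) Γ(V.a, prX f Λ ⁻¹ᵁ U))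
    (hS : ∀ (N : KappaMod f Λ) (i : N ⟶ V), IsKappaSheaf f Λ N → P N → rangeAt i.f _ ≤ S)
    (v : Γ(V.a, prX f Λ ⁻¹ᵁ U)) : v ∈ S := by
  have hW := isAffineOpen_preimage f Λ hU
  refine mem_of_locally hW S v fun z hz => ?_
  obtain ⟨W, h, N, i, hzW, hN, hP, -, ht⟩ := hV _ v z hz
  obtain ⟨a, ha, hza⟩ := exists_basicOpen hW h hzW
  have : N.a.IsQuasicoherent := hN
  obtain ⟨k, hk⟩ := exists_pow_smul_mem_rangeAt (qcAt_of_isQuasicoherent _ hW) hq i.f a rfl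
    (ha.trans h) v (by
      rw [← res_res V.a ha h]
      exact res_mem_rangeAt ha ht)
  exact ⟨a, hza, k, hS N i hN hP hk⟩

/-- Sections of a locally nilpotent module over preimages of affine opens are locally
nilpotent. -/
lemma IsLocNil.ln {V : KappaMod f Λ} (hV : IsLocNil f Λ V) {U : X.Opens} (hU : IsAffineOpen U)
    (hq : QCAt V.a (prX f Λ ⁻¹ᵁ U)) (v : Γ(V.a, prX f Λ ⁻¹ᵁ U)) :
    LN Γ(prodC f Λ, prX f Λ ⁻¹ᵁ U) (kappaOn f Λ V U) v := by
  refine mem_of_isUnionOf hV hU hq (lnSub _ (kappaOn f Λ V U)) ?_ v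
  rintro N i - ⟨n, hn⟩ _ ⟨w, rfl⟩
  refine ⟨n, fun a => ?_⟩
  rw [← Scheme.Modules.Hom.app_smul, iterate_kappaOn_app, iterate_kappaOn_eq_zero hn, map_zero]

/-- Each section lies in a finitely generated κ-stable submodule, since these submodules are closed
under sums and include the images of coherent κ-subsheaves. Over a Noetherian ring every k^n(Av)
inside one is finitely generated. -/
lemma QK.of_isIndCoh [Algebra.EssFiniteType F Λ] [IsLocallyNoetherian X] {V : KappaMod f Λ}
    (hfg : ∀ N : KappaMod f Λ, IsCoh f Λ N → ∀ U, IsAffineOpen U →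
      Module.Finite Γ(prodC f Λ, prX f Λ ⁻¹ᵁ U) Γ(N.a, prX f Λ ⁻¹ᵁ U))
    (hV : IsIndCoh f Λ V)
    (hq : ∀ U, IsAffineOpen U → QCAt V.a (prX f Λ ⁻¹ᵁ U)) : QK V := by
  intro U hU v n
  have := isNoetherianRing_sections f Λ hU
  obtain ⟨S, hS, hkS, hvS⟩ := mem_of_isUnionOf hV hU (hq U hU) (finSub _ (kappaOn f Λ V U))
    (fun N i _ hN => by
      rintro _ ⟨w, rfl⟩
      have := hfg N hN U hU
      refine ⟨LinearMap.range (appLin i.f (prX f Λ ⁻¹ᵁ U)), ?_, ?_, w, rfl⟩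
      · exact Module.Finite.iff_fg.1 inferInstance
      · rintro _ ⟨y, rfl⟩
        exact ⟨kappaOn f Λ N U y, (kappaOn_naturality f Λ i U y).symm⟩) v
  exact (isKappa_kappaOn V U).powSpan_fg_of_mem hS hkS hvS n

end
end CartierSheaf

/-! ### Finite type implies finitely generated affine sections -/

namespace CartierSheaf
noncomputable section
open Scheme.Modules

set_option linter.unusedSectionVars false

lemma module_finite_of_surjective {R S P Q : Type*} [CommRing R] [CommRing S] [AddCommGroup P]
    [AddCommGroup Q] [Module R P] [Module S Q] [Module.Finite R P] (ρ : R → S) (g : P →+ Q)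
    (hg : Function.Surjective g) (h : ∀ r m, g (r • m) = ρ r • g m) : Module.Finite S Q := by
  obtain ⟨T, hT⟩ := Module.Finite.fg_top (R := R) (M := P)
  classical
  refine ⟨⟨T.image g, eq_top_iff.2 ?_⟩⟩
  rintro q -
  obtain ⟨m, rfl⟩ := hg q
  have hm : m ∈ Submodule.span R (T : Set P) := hT ▸ Submodule.mem_top
  induction hm using Submodule.span_induction with
  | mem x hx => exact Submodule.subset_span (by simpa using ⟨x, hx, rfl⟩)
  | zero => rw [map_zero]; exact zero_mem _
  | add x y _ _ hx hy => rw [map_add]; exact add_mem hx hy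
  | smul a x _ hx => rw [h]; exact Submodule.smul_mem _ _ hx

lemma epi_hom_comp {C : Type*} [Category* C] {P Q S : C} (e : P ≅ Q) (p : Q ⟶ S) (hp : Epi p) :
    Epi (e.hom ≫ p) :=
  inferInstance

/-- A finite free sheaf on a spectrum is the sheaf of a finite free module, and an epimorphism of
quasi-coherent modules is surjective on affine sections. -/
lemma finite_top_of_epi {R : CommRingCat.{u}} (M : (Spec R).Modules) (hM : QCAt M ⊤) (I : Type u)
    [Finite I] (p : (SheafOfModules.free.{u} I : (Spec R).Modules) ⟶ M) (hp : Epi p) :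
    Module.Finite Γ(Spec R, ⊤) Γ(M, ⊤) := by
  let T : (Spec R).Modules := tilde (ModuleCat.of R (I →₀ R))
  let e : T ≅ (SheafOfModules.free.{u} I : (Spec R).Modules) := tildeFinsupp I
  let p' : T ⟶ M := e.hom ≫ p
  have hp' : Epi p' := epi_hom_comp e p hp
  have hT : QCAt T ⊤ := qcAt_of_isQuasicoherent T (isAffineOpen_top _)
  have hs : Function.Surjective (p'.app ⊤) := fun m =>
    (locIm_of_epi p' m).mem_rangeAt (isAffineOpen_top _) hT hM
  have : Module.Finite R (I →₀ R) := inferInstance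
  refine module_finite_of_surjective (R := R) (P := (I →₀ R)) (Scheme.ΓSpecIso R).inv
    ((p'.app ⊤).hom.comp (tilde.toOpen (ModuleCat.of R (I →₀ R)) ⊤).hom.toAddMonoidHom) ?_ ?_
  · refine hs.comp ?_
    exact ((tilde.isoTop (ModuleCat.of R (I →₀ R))).toLinearEquiv).surjective
  · intro r m
    refine Eq.trans (congrArg (p'.app ⊤) ?_) (Scheme.Modules.Hom.app_smul _ _ _)
    refine ((tilde.toOpen (ModuleCat.of R (I →₀ R)) ⊤).hom.map_smul r m).trans ?_
    rfl

variable {Y Z : Scheme.{u}}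

lemma finite_of_restrict (f : Z ⟶ Y) [IsOpenImmersion f] (M : Y.Modules) (U : Z.Opens)
    (W : Y.Opens) (hW : W = f ''ᵁ U) [Module.Finite Γ(Z, U) Γ(M.restrict f, U)] :
    Module.Finite Γ(Y, W) Γ(M, W) := by
  subst hW
  exact module_finite_of_surjective (R := Γ(Z, U)) (P := Γ(M.restrict f, U))
    (Q := Γ(M, f ''ᵁ U)) (f.appIso U).inv (AddMonoidHom.id _) Function.surjective_id fun r m => rfl

lemma exists_finite_epi {C C' : Type u} [Category.{u} C] {J : GrothendieckTopology C}
    {R : Sheaf J RingCat.{u}} [HasSheafify J AddCommGrpCat.{u}]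
    [J.WEqualsLocallyBijective AddCommGrpCat.{u}] [Category.{u} C'] {J' : GrothendieckTopology C'}
    {R' : Sheaf J' RingCat.{u}} [HasSheafify J' AddCommGrpCat.{u}]
    [J'.WEqualsLocallyBijective AddCommGrpCat.{u}]
    (F : SheafOfModules.{u} R ⥤ SheafOfModules.{u} R') (hF : PreservesColimitsOfSize.{u, u} F)
    (η : SheafOfModules.unit R' ≅ F.obj (SheafOfModules.unit R))
    {M : SheafOfModules.{u} R} {N : SheafOfModules.{u} R'} (e : F.obj M ≅ N)
    (G : M.GeneratingSections) [G.IsFiniteType] :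
    ∃ (I : Type u) (_ : Finite I) (p : SheafOfModules.free.{u} I ⟶ N), Epi p :=
  ⟨G.I, inferInstance, _, ((G.map F η).ofEpi e.hom).epi⟩

lemma finite_sections_of_generators (M : Y.Modules) [M.IsQuasicoherent] (V : Y.Opens)
    (G : (SheafOfModules.over M V).GeneratingSections) [G.IsFiniteType] {D : Y.Opens} (hD : D ≤ V)
    (hDa : IsAffineOpen D) : Module.Finite Γ(Y, D) Γ(M, D) := by
  let w := hDa.isoSpec.inv ≫ Y.homOfLE hD
  have : PreservesColimitsOfSize.{u, u} (restrictFunctor w) := inferInstance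
  have hw : w ≫ V.ι = hDa.fromSpec := by
    rw [Category.assoc, Y.homOfLE_ι, IsAffineOpen.isoSpec_inv_ι]
  let F := (overEquiv V).functor ⋙ restrictFunctor w
  have hF : PreservesColimitsOfSize.{u, u} F :=
    comp_preservesColimits (overEquiv V).functor (restrictFunctor w)
  let iso : SheafOfModules.overFunctor Y.ringCatSheaf V ⋙ F ≅ restrictFunctor hDa.fromSpec :=
    (Functor.associator _ _ _).symm ≪≫
        Functor.isoWhiskerRight (Scheme.Modules.overFunctorEquiv V) _ ≪≫
        (restrictFunctorComp _ _).symm ≪≫ (restrictFunctorCongr hw)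
  obtain ⟨I, hI, p, hp⟩ := exists_finite_epi F hF (Scheme.Modules.restrictUnitIso w).symm
    (iso.app M) G
  have hq : QCAt (M.restrict hDa.fromSpec) ⊤ :=
    (qcAt_restrict_iff hDa.fromSpec M ⊤ D (by simp)).2 (qcAt_of_isQuasicoherent M hDa)
  have := @finite_top_of_epi _ (M.restrict hDa.fromSpec) hq I hI p hp
  exact finite_of_restrict hDa.fromSpec M ⊤ D (by simp)

lemma exists_finite_of_isFiniteType (M : Y.Modules) [M.IsQuasicoherent] [h : M.IsFiniteType]
    (z : Y) : ∃ V : Y.Opens, z ∈ V ∧ ∀ D : Y.Opens, D ≤ V → IsAffineOpen D →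
      Module.Finite Γ(Y, D) Γ(M, D) := by
  obtain ⟨⟨I, V, cov, G⟩, hG⟩ := h.exists_localGeneratorsData
  rw [Opens.coversTop_iff] at cov
  obtain ⟨i, hi⟩ := Opens.mem_iSup.1 (cov ▸ Opens.mem_top z)
  have hGi : (G i).IsFiniteType := hG.isFiniteType i
  exact ⟨V i, hi, fun D hD hDa => finite_sections_of_generators M (V i) (G i) hD hDa⟩

/-- Sections of a quasi-coherent module of finite type over an affine open subset form a finite
module. -/
theorem finite_sections (M : Y.Modules) [M.IsQuasicoherent] [M.IsFiniteType] {W : Y.Opens}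
    (hW : IsAffineOpen W) : Module.Finite Γ(Y, W) Γ(M, W) := by
  have hq := qcAt_of_isQuasicoherent M hW
  have H (z : Y) (hz : z ∈ W) : ∃ (a : Γ(Y, W)) (T : Finset Γ(M, W)), z ∈ Y.basicOpen a ∧
      ∀ s, ∃ k : ℕ, a ^ k • s ∈ Submodule.span Γ(Y, W) (T : Set Γ(M, W)) := by
    obtain ⟨V, hzV, hV⟩ := exists_finite_of_isFiniteType M z
    obtain ⟨a, ha, hza⟩ := exists_basicOpen hW (inf_le_left : W ⊓ V ≤ W) ⟨hz, hzV⟩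
    obtain ⟨T, hT⟩ := (hV (Y.basicOpen a) (ha.trans inf_le_right) (hW.basicOpen a)).fg_top
    have h : Y.basicOpen a ≤ W := Y.basicOpen_le a
    -- The section g t over W restricts to a^(k t) t. The extensions of a finite generating set over
    -- the basic open set generate every section over W up to a power of a.
    choose k g hg using (hq a _ rfl h).2
    classical
    refine ⟨a, T.image g, hza, fun s => ?_⟩
    have key (t : Γ(M, Y.basicOpen a)) : ∃ l : ℕ, ∃ s' ∈ Submodule.span Γ(Y, W)
        ((T.image g : Finset _) : Set Γ(M, W)), res M h s' = rres h a ^ l • t := by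
      have ht : t ∈ Submodule.span Γ(Y, Y.basicOpen a) (T : Set Γ(M, Y.basicOpen a)) :=
        hT ▸ Submodule.mem_top
      induction ht using Submodule.span_induction with
      | mem x hx => exact ⟨k x, g x, Submodule.subset_span (by simpa using ⟨x, hx, rfl⟩), hg x⟩
      | zero => exact ⟨0, 0, zero_mem _, by simp⟩
      | add x y _ _ hx hy =>
        obtain ⟨l, x', hx', ex⟩ := hx
        obtain ⟨l', y', hy', ey⟩ := hy
        refine ⟨l + l', a ^ l' • x' + a ^ l • y',
          add_mem (Submodule.smul_mem _ _ hx') (Submodule.smul_mem _ _ hy'), ?_⟩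
        rw [map_add, res_smul, res_smul, ex, ey, map_pow, map_pow, smul_smul, smul_smul, smul_add,
          pow_add, mul_comm (rres h a ^ l')]
      | smul c x _ hx =>
        obtain ⟨l, x', hx', ex⟩ := hx
        obtain ⟨j, c', hc'⟩ := exists_pow_mul_rres_eq hW a rfl h c
        refine ⟨j + l, c' • x', Submodule.smul_mem _ _ hx', ?_⟩
        rw [res_smul, ex, ← hc', smul_smul, smul_smul]
        congr 1
        ring
    obtain ⟨l, s', hs', e⟩ := key (res M h s)
    obtain ⟨j, hj⟩ := (hq a _ rfl h).1 (s' - a ^ l • s) (by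
      rw [map_sub, e, res_smul, map_pow, sub_self])
    refine ⟨j + l, ?_⟩
    rw [pow_add, mul_smul]
    rw [smul_sub, sub_eq_zero] at hj
    rw [← hj]
    exact Submodule.smul_mem _ _ hs'
  choose! a T hza hT using H
  obtain ⟨t, ht⟩ := hW.isCompact.elim_finite_subcover (fun z : W => (Y.basicOpen (a z) : Set Y))
    (fun z => (Y.basicOpen (a z)).2) fun z hz => Set.mem_iUnion.2 ⟨⟨z, hz⟩, hza z hz⟩
  classical
  refine ⟨⟨t.biUnion fun z => T z, eq_top_iff.2 fun s _ => mem_of_locally hW _ s fun z hz => ?_⟩⟩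
  obtain ⟨w, hw⟩ := Set.mem_iUnion.1 (ht hz)
  obtain ⟨hwt, hzw⟩ := Set.mem_iUnion.1 hw
  obtain ⟨k, hk⟩ := hT w w.2 s
  refine ⟨a w, hzw, k, Submodule.span_mono ?_ hk⟩
  intro y hy
  exact Finset.mem_biUnion.2 ⟨w, hwt, hy⟩

end
end CartierSheaf

/-! ### Subsheaves, and restriction and extension of κ^n-nilpotent sections -/

namespace CartierSheaf
noncomputable section
open Scheme.Modules

set_option linter.unusedSectionVars false

section Sub
variable {Y : Scheme.{u}} (H : Y.Modules) (S : ∀ W : Y.Opens, Submodule Γ(Y, W) Γ(H, W))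

/-- A family of submodules stable under restriction, as a presheaf. -/
def subPre (hres : ∀ (W' W : Y.Opens) (h : W' ≤ W) (s), s ∈ S W → res H h s ∈ S W') :
    PresheafOfModules.Submodule H.val where
  obj W := S W.unop
  map {_ _} g := fun s hs => hres _ _ (leOfHom g.unop) s hs

lemma isSheaf_subPre (hres : ∀ (W' W : Y.Opens) (h : W' ≤ W) (s), s ∈ S W → res H h s ∈ S W')
    (hloc : ∀ (W : Y.Opens) (s : Γ(H, W)), (∀ z ∈ W, ∃ (W' : Y.Opens) (h : W' ≤ W), z ∈ W' ∧
      res H h s ∈ S W') → s ∈ S W) :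
    TopCat.Presheaf.IsSheaf (subPre H S hres).toPresheafOfModules.presheaf := by
  rw [TopCat.Presheaf.isSheaf_iff_isSheaf_comp (forget Ab.{u})]
  have hH := H.isSheaf
  rw [TopCat.Presheaf.isSheaf_iff_isSheaf_comp (forget Ab.{u})] at hH
  let G : Subfunctor (H.presheaf ⋙ forget Ab.{u}) :=
    { obj := fun W => {s | s ∈ S W.unop}
      map := fun {_ _} g s hs => hres _ _ (leOfHom g.unop) s hs }
  have := (Subfunctor.isSheaf_iff (J := Opens.grothendieckTopology Y) G
    ((isSheaf_iff_isSheaf_of_type _ _).1 hH)).2 fun W s hs => by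
      refine hloc W.unop s fun z hz => ?_
      obtain ⟨W', g, hg, hzW⟩ := hs z hz
      exact ⟨W', leOfHom g, hzW, hg⟩
  exact (isSheaf_iff_isSheaf_of_type _ _).2 this

variable (hres : ∀ (W' W : Y.Opens) (h : W' ≤ W) (s), s ∈ S W → res H h s ∈ S W')
  (hloc : ∀ (W : Y.Opens) (s : Γ(H, W)), (∀ z ∈ W, ∃ (W' : Y.Opens) (h : W' ≤ W), z ∈ W' ∧
    res H h s ∈ S W') → s ∈ S W)

/-- A family of submodules stable under restriction and with a local membership condition,
as a module. -/
def sub : Y.Modules := ⟨(subPre H S hres).toPresheafOfModules, isSheaf_subPre H S hres hloc⟩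

/-- The inclusion of a submodule. -/
def subι : sub H S hres hloc ⟶ H := ⟨(subPre H S hres).ι⟩

lemma subι_injective (W : Y.Opens) : Function.Injective ((subι H S hres hloc).app W) :=
  Subtype.val_injective

lemma subι_mem {W : Y.Opens} (m) : (subι H S hres hloc).app W m ∈ S W := m.2

lemma exists_subι {W : Y.Opens} {s : Γ(H, W)} (hs : s ∈ S W) :
    ∃ m, (subι H S hres hloc).app W m = s := ⟨⟨s, hs⟩, rfl⟩

instance : Mono (subι H S hres hloc) := by
  refine ⟨fun a b h => Scheme.Modules.hom_ext _ _ fun W => ?_⟩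
  ext m
  exact subι_injective H S hres hloc W congr(Scheme.Modules.Hom.app $h W m)

variable {H S}

/-- The factorization of a morphism through a submodule. -/
def subLift {P : Y.Modules} (g : P ⟶ H) (hg : ∀ W m, g.app W m ∈ S W) : P ⟶ sub H S hres hloc :=
  ⟨PresheafOfModules.homMk
    { app := fun W => AddCommGrpCat.ofHom
        (((g.app W.unop).hom).codRestrict (S W.unop).toAddSubgroup (hg W.unop))
      naturality := fun W W' i => by
        ext m
        exact Subtype.ext congr($(g.mapPresheaf.naturality i) m) }
    (fun W r m => Subtype.ext (Scheme.Modules.Hom.app_smul g r m))⟩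

lemma subLift_ι {P : Y.Modules} (g : P ⟶ H) (hg : ∀ W m, g.app W m ∈ S W) :
    subLift hres hloc g hg ≫ subι H S hres hloc = g := by
  refine Scheme.Modules.hom_ext _ _ fun W => ?_
  ext m
  rfl

end Sub

variable {F : Type u} [Field F] [Finite F] {X : Scheme.{u}} {f : X ⟶ Spec (CommRingCat.of F)}
variable {Λ : Type u} [CommRing Λ] [Algebra F Λ]

lemma kappaOn_mem_nilSub (V : KappaMod f Λ) (U : X.Opens) (n : ℕ) {v : Γ(V.a, prX f Λ ⁻¹ᵁ U)}
    (hv : v ∈ nilSub Γ(prodC f Λ, prX f Λ ⁻¹ᵁ U) (kappaOn f Λ V U) n) :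
    kappaOn f Λ V U v ∈ nilSub Γ(prodC f Λ, prX f Λ ⁻¹ᵁ U) (kappaOn f Λ V U) n := by
  intro a
  rw [← isKappa_kappaOn V U a v, ← Function.iterate_succ_apply, Function.iterate_succ_apply', hv,
    map_zero]

lemma sigmaOn_iterate_prS (U : X.Opens) (n : ℕ) (r : Γ(X, U)) :
    (sigmaOn f Λ U)^[n] (prS f Λ U r) = prS f Λ U r ^ Nat.card F ^ n := by
  induction n with
  | zero => simp
  | succ n ih => rw [Function.iterate_succ_apply', ih, map_pow, sigmaOn_prS, ← pow_mul, pow_succ']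

/-- A multiplier b over U' need not extend to U, but locally r^m b does. Since r^m k^n(bv) =
k^n(r^(m q^n) bv) and the exponent m q^n is at least m, the right-hand side is the restriction of
some k^n(c'v) with c' over U, which is zero. -/
lemma res_mem_nilSub {V : KappaMod f Λ} {U U' : X.Opens}
    (hU : IsAffineOpen U) (h : U' ≤ U) (n : ℕ) {v : Γ(V.a, prX f Λ ⁻¹ᵁ U)}
    (hv : v ∈ nilSub Γ(prodC f Λ, prX f Λ ⁻¹ᵁ U) (kappaOn f Λ V U) n) :
    res V.a (preimage_le f Λ h) v ∈ nilSub Γ(prodC f Λ, prX f Λ ⁻¹ᵁ U') (kappaOn f Λ V U') n := by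
  intro b
  refine eq_zero_of_locally _ fun z hz => ?_
  obtain ⟨r, hr, hzr⟩ := exists_basicOpen hU h (z := prX f Λ z) hz
  refine ⟨prX f Λ ⁻¹ᵁ X.basicOpen r, preimage_le f Λ hr, hzr, ?_⟩
  obtain ⟨m, c, hc⟩ := exists_pow_mul_rres_eq (isAffineOpen_preimage f Λ hU) (prS f Λ U r)
    (basicOpen_prS f Λ r) (preimage_le f Λ (hr.trans h)) (rres (preimage_le f Λ hr) b)
  refine smul_eq_zero_of_basicOpen V.a (prS f Λ U r) (basicOpen_prS f Λ r)
    (preimage_le f Λ (hr.trans h)) m _ ?_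
  have hq : 0 < Nat.card F ^ n := pow_pos Nat.card_pos n
  rw [← iterate_kappaOn_res V hr, res_smul, res_res V.a (preimage_le f Λ hr) (preimage_le f Λ h),
    ← prS_rres f Λ (hr.trans h), ← map_pow,
    ← (isKappa_kappaOn V _).iterate_smul, sigmaOn_iterate_prS, smul_smul,
    ← Nat.sub_add_cancel hq, pow_succ, map_pow, mul_assoc, prS_rres f Λ (hr.trans h), hc, mul_smul,
    ← map_pow, ← map_pow, ← res_smul, ← res_smul, iterate_kappaOn_res V (hr.trans h), smul_smul,
    hv, map_zero]

/-- Lift r^j t to a section v over U. All elements of k^n(Av) vanish on the basic open set of r;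
finite generation yields one power r^K that kills them, and r^K k^n(bv) = k^n(r^(K q^n) bv) puts
r^(K q^n) v into the desired submodule. The finiteness condition is indispensable to this argument.
-/
lemma exists_smul_mem_nilSub {V : KappaMod f Λ} (hV : QK V) {U : X.Opens} (hU : IsAffineOpen U)
    (hq : QCAt V.a (prX f Λ ⁻¹ᵁ U)) (r : Γ(X, U)) (n : ℕ)
    {t : Γ(V.a, prX f Λ ⁻¹ᵁ X.basicOpen r)}
    (ht : t ∈ nilSub Γ(prodC f Λ, prX f Λ ⁻¹ᵁ X.basicOpen r) (kappaOn f Λ V _) n) :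
    ∃ (l : ℕ), ∃ v ∈ nilSub Γ(prodC f Λ, prX f Λ ⁻¹ᵁ U) (kappaOn f Λ V U) n,
      res V.a (preimage_le f Λ (X.basicOpen_le r)) v =
        rres (preimage_le f Λ (X.basicOpen_le r)) (prS f Λ U r) ^ l • t := by
  obtain ⟨j, v, hv⟩ := (hq _ _ (basicOpen_prS f Λ r) (preimage_le f Λ (X.basicOpen_le r))).2 t
  have h0 (w) (hw : w ∈ (isKappa_kappaOn V U).powSpan n v) : ∃ k : ℕ, prS f Λ U r ^ k • w = 0 := by
    obtain ⟨b, rfl⟩ := (isKappa_kappaOn V U).mem_powSpan.1 hw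
    refine (hq _ _ (basicOpen_prS f Λ r) (preimage_le f Λ (X.basicOpen_le r))).1 _ ?_
    rw [← iterate_kappaOn_res V (X.basicOpen_le r), res_smul, hv, smul_smul, ht]
  obtain ⟨T, hT⟩ := hV U hU v n
  choose! k hk using h0
  let K := T.sup k
  have hK (w) (hw : w ∈ (isKappa_kappaOn V U).powSpan n v) : prS f Λ U r ^ K • w = 0 := by
    suffices (isKappa_kappaOn V U).powSpan n v ≤
      LinearMap.ker (LinearMap.lsmul Γ(prodC f Λ, prX f Λ ⁻¹ᵁ U) _ (prS f Λ U r ^ K)) from this hw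
    rw [← hT, Submodule.span_le]
    intro x hx
    have : x ∈ (isKappa_kappaOn V U).powSpan n v := hT ▸ Submodule.subset_span hx
    change prS f Λ U r ^ K • x = 0
    have hle : k x ≤ K := Finset.le_sup hx
    rw [← Nat.sub_add_cancel hle, pow_add, mul_smul, hk x this, smul_zero]
  refine ⟨K * Nat.card F ^ n + j, prS f Λ U r ^ (K * Nat.card F ^ n) • v, fun b => ?_, ?_⟩
  · rw [smul_smul, mul_comm, ← smul_smul, pow_mul, ← map_pow, ← sigmaOn_iterate_prS,
      (isKappa_kappaOn V U).iterate_smul, map_pow]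
    exact hK _ ((isKappa_kappaOn V U).mem_powSpan.2 ⟨b, rfl⟩)
  · rw [res_smul, hv, map_pow, smul_smul, pow_add]

end
end CartierSheaf

/-! ### The largest subsheaf killed by κ^n and the criterion for local nilpotence -/

namespace CartierSheaf
noncomputable section
open Scheme.Modules

set_option linter.unusedSectionVars false

lemma QCAt.exists_pow_smul_eq {Y : Scheme.{u}} {M : Y.Modules} {W D : Y.Opens} (hM : QCAt M W)
    (a : Γ(Y, W)) (hD : D = Y.basicOpen a) (h : D ≤ W) {t t' : Γ(M, W)}
    (e : res M h t = res M h t') : ∃ k : ℕ, a ^ k • t = a ^ k • t' := by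
  obtain ⟨k, hk⟩ := (hM a D hD h).1 (t - t') (by rw [map_sub, e, sub_self])
  exact ⟨k, by rwa [smul_sub, sub_eq_zero] at hk⟩

variable {F : Type u} [Field F] [Finite F] {X : Scheme.{u}} {f : X ⟶ Spec (CommRingCat.of F)}
variable {Λ : Type u} [CommRing Λ] [Algebra F Λ]

/-- The sections on basic open subsets of preimages of affine opens become, up to denominators,
elements killed by the `n`-th iterate. -/
def nilAt (V : KappaMod f Λ) (hV : ∀ U, IsAffineOpen U → QCAt V.a (prX f Λ ⁻¹ᵁ U)) (n : ℕ)
    (W : (prodC f Λ).Opens) : Submodule Γ(prodC f Λ, W) Γ(V.a, W) where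
  -- A general open set of X × C is not stable under σ × id, so iterating κ on its sections has no
  -- meaning. Membership is tested instead on sections t over preimages of affine opens of X. The
  -- factor r makes the condition visibly closed under sums and scalars.
  carrier := {s | ∀ (U : X.Opens) (_ : IsAffineOpen U) (a r : Γ(prodC f Λ, prX f Λ ⁻¹ᵁ U))
    (D : (prodC f Λ).Opens) (_ : D = (prodC f Λ).basicOpen a) (h' : D ≤ prX f Λ ⁻¹ᵁ U)
    (h : D ≤ W) (t : Γ(V.a, prX f Λ ⁻¹ᵁ U)), res V.a h' t = rres h' r • res V.a h s →
    ∃ l : ℕ, a ^ l • t ∈ nilSub Γ(prodC f Λ, prX f Λ ⁻¹ᵁ U) (kappaOn f Λ V U) n}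
  zero_mem' := by
    intro U hU a r D hD h' h t ht
    obtain ⟨k, hk⟩ := (hV U hU a D hD h').1 t (by rw [ht, map_zero, smul_zero])
    exact ⟨k, hk ▸ zero_mem _⟩
  add_mem' := by
    intro s₁ s₂ h₁ h₂ U hU a r D hD h' h t ht
    obtain ⟨k₁, t₁, e₁⟩ := (hV U hU a D hD h').2 (rres h' r • res V.a h s₁)
    obtain ⟨l₁, hl₁⟩ := h₁ U hU a (a ^ k₁ * r) D hD h' h t₁ (by rw [e₁, map_mul, map_pow, mul_smul])
    obtain ⟨l₂, hl₂⟩ := h₂ U hU a (a ^ k₁ * r) D hD h' h (a ^ k₁ • t - t₁) (by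
      rw [map_sub, res_smul, ht, e₁, map_add, smul_add, map_mul, map_pow, smul_add, mul_smul,
        add_sub_cancel_left])
    refine ⟨l₁ + l₂ + k₁, ?_⟩
    have e : a ^ (l₁ + l₂ + k₁) • t = a ^ l₂ • a ^ l₁ • t₁ + a ^ l₁ • a ^ l₂ • (a ^ k₁ • t - t₁) := by
      rw [smul_smul, smul_smul, smul_sub, mul_comm (a ^ l₂), add_sub_cancel, smul_smul]
      rw [pow_add, pow_add]
    rw [e]
    exact add_mem (Submodule.smul_mem _ _ hl₁) (Submodule.smul_mem _ _ hl₂)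
  smul_mem' := by
    intro c s hs U hU a r D hD h' h t ht
    obtain ⟨j, c', hc⟩ := exists_pow_mul_rres_eq (isAffineOpen_preimage f Λ hU) a hD h' (rres h c)
    obtain ⟨l, hl⟩ := hs U hU a (r * c') D hD h' h (a ^ j • t) (by
      rw [res_smul, ht, map_mul, ← hc, res_smul, smul_smul, smul_smul, map_pow]
      congr 1
      ring)
    exact ⟨l + j, by rwa [pow_add, mul_smul]⟩

variable {V : KappaMod f Λ} (hV : ∀ U, IsAffineOpen U → QCAt V.a (prX f Λ ⁻¹ᵁ U)) (n : ℕ)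

lemma res_mem_nilAt (W' W : (prodC f Λ).Opens) (h : W' ≤ W) (s) (hs : s ∈ nilAt V hV n W) :
    res V.a h s ∈ nilAt V hV n W' := by
  intro U hU a r D hD h' hD' t ht
  exact hs U hU a r D hD h' (hD'.trans h) t (by rw [ht, res_res])

lemma mem_nilAt_of_locally (W : (prodC f Λ).Opens) (s : Γ(V.a, W))
    (H : ∀ z ∈ W, ∃ (W' : (prodC f Λ).Opens) (h : W' ≤ W), z ∈ W' ∧
      res V.a h s ∈ nilAt V hV n W') : s ∈ nilAt V hV n W := by
  intro U hU a r D hD h' h t ht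
  refine pow_mem_of_locally (isAffineOpen_preimage f Λ hU) _ t a fun z hz => ?_
  obtain ⟨W', hW', hzW, hs⟩ := H z (h (hD ▸ hz))
  obtain ⟨c, hc, hzc⟩ := exists_basicOpen (isAffineOpen_preimage f Λ hU)
    (W' := D ⊓ W') (inf_le_left.trans h') ⟨hD ▸ hz, hzW⟩
  refine ⟨c, hzc, hs U hU c r _ rfl ((prodC f Λ).basicOpen_le c) (hc.trans inf_le_right) t ?_⟩
  rw [← res_res V.a (hc.trans inf_le_left) h', ht, res_smul, rres_rres, res_res, res_res]

/-- For the harder inclusion a section on U is tested against another affine U'. Small basic open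
sets of U' lie in U; there the section is still killed by κ^n, and `exists_smul_mem_nilSub` extends
it to U' up to a denominator. `pow_mem_of_locally` assembles the local results. -/
lemma mem_nilAt_iff (hQ : QK V) {U : X.Opens} (hU : IsAffineOpen U) (s) :
    s ∈ nilAt V hV n (prX f Λ ⁻¹ᵁ U) ↔
      s ∈ nilSub Γ(prodC f Λ, prX f Λ ⁻¹ᵁ U) (kappaOn f Λ V U) n := by
  constructor
  · intro hs
    obtain ⟨l, hl⟩ := hs U hU 1 1 (prX f Λ ⁻¹ᵁ U) (by simp) le_rfl le_rfl s (by simp)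
    rwa [one_pow, one_smul] at hl
  · intro hs U' hU' a r D hD h' h t ht
    refine pow_mem_of_locally (isAffineOpen_preimage f Λ hU') _ t a fun z hz => ?_
    obtain ⟨g, hg, hzg⟩ := exists_basicOpen hU' (W' := U' ⊓ U) inf_le_left
      (z := prX f Λ z) ⟨h' (hD ▸ hz), h (hD ▸ hz)⟩
    have hgU : X.basicOpen g ≤ U := hg.trans inf_le_right
    obtain ⟨l, v, hv, hvs⟩ := exists_smul_mem_nilSub hQ hU' (hV U' hU') g n
      (res_mem_nilSub hU hgU n hs)
    let c := a * prS f Λ U' g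
    have hc : (prodC f Λ).basicOpen c = D ⊓ prX f Λ ⁻¹ᵁ X.basicOpen g := by
      rw [Scheme.basicOpen_mul, hD, basicOpen_prS]
    obtain ⟨m, hm⟩ := (hV U' hU').exists_pow_smul_eq c rfl ((prodC f Λ).basicOpen_le c)
      (t := prS f Λ U' g ^ l • t) (t' := r • v) (by
        have h1 : (prodC f Λ).basicOpen c ≤ D := hc.le.trans inf_le_left
        have h2 : (prodC f Λ).basicOpen c ≤ prX f Λ ⁻¹ᵁ X.basicOpen g := hc.le.trans inf_le_right
        rw [res_smul, res_smul, ← res_res V.a h1 h', ht,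
          ← res_res V.a h2 (preimage_le f Λ (X.basicOpen_le g)), hvs, res_smul, res_smul,
          rres_rres, map_pow, map_pow, rres_rres, res_res, res_res, smul_smul, smul_smul, mul_comm])
    refine ⟨c, ?_, m + l, ?_⟩
    · rw [hc]
      exact ⟨hD ▸ hz, hzg⟩
    · have e : c ^ (m + l) • t = a ^ l • c ^ m • r • v := by
        rw [← hm, smul_smul, smul_smul]
        congr 1
        rw [pow_add, mul_pow a _ l]
        ring
      rw [e]
      exact Submodule.smul_mem _ _ (Submodule.smul_mem _ _ (Submodule.smul_mem _ _ hv))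

/-- The preimage under σ × id of the basic open set of a is that of φ(a), and κ turns a denominator
φ(a)^l into a^l. -/
lemma str_mem_nilAt (W : (prodC f Λ).Opens) (s : Γ(V.a, sigma f Λ ⁻¹ᵁ W))
    (hs : s ∈ nilAt V hV n (sigma f Λ ⁻¹ᵁ W)) : V.str.app W s ∈ nilAt V hV n W := by
  intro U hU a r D hD h' h t ht
  have hσ : sigma f Λ ⁻¹ᵁ D ≤ prX f Λ ⁻¹ᵁ U :=
    ((Opens.map (sigma f Λ).base).map (homOfLE h')).le.trans (sigma_preimage f Λ U).le
  have hσW : sigma f Λ ⁻¹ᵁ D ≤ sigma f Λ ⁻¹ᵁ W := ((Opens.map (sigma f Λ).base).map (homOfLE h)).le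
  have hb : sigma f Λ ⁻¹ᵁ D = (prodC f Λ).basicOpen (sigmaOn f Λ U a) := by
    rw [hD, Scheme.preimage_basicOpen]
    refine Eq.trans ?_ ((prodC f Λ).basicOpen_res _ (homOfLE (sigma_preimage f Λ U).ge).op).symm
    exact (inf_eq_right.2 (((prodC f Λ).basicOpen_le _).trans (sigma_preimage f Λ U).le)).symm
  have hr (c : Γ(prodC f Λ, prX f Λ ⁻¹ᵁ U)) :
      rres hσ (sigmaOn f Λ U c) = (sigma f Λ).app D (rres h' c) := by
    have e : (sigma f Λ).appLE (prX f Λ ⁻¹ᵁ U) (prX f Λ ⁻¹ᵁ U) (sigma_preimage f Λ U).ge ≫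
        (prodC f Λ).presheaf.map (homOfLE hσ).op =
          (prodC f Λ).presheaf.map (homOfLE h').op ≫ (sigma f Λ).app D := by
      rw [Scheme.Hom.appLE_map, Scheme.Hom.app_eq_appLE, Scheme.Hom.map_appLE]
    exact congr($e c)
  obtain ⟨k, t₁, e₁⟩ := (hV U hU (sigmaOn f Λ U a) _ hb hσ).2
    (rres hσ (sigmaOn f Λ U r) • res V.a hσW s)
  obtain ⟨l, hl⟩ := hs U hU (sigmaOn f Λ U a) (sigmaOn f Λ U a ^ k * sigmaOn f Λ U r) _ hb hσ hσW t₁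
    (by rw [e₁, map_mul, map_pow, mul_smul])
  have hl' := kappaOn_mem_nilSub V U n hl
  rw [← map_pow, isKappa_kappaOn V U] at hl'
  obtain ⟨m, hm⟩ := (hV U hU).exists_pow_smul_eq a hD h' (t := kappaOn f Λ V U t₁)
    (t' := a ^ k • t) (by
      have h1 : res V.a h' (kappaOn f Λ V U t₁) = V.str.app D (res V.a hσ t₁) := by
        refine (app_res V.str h' _).symm.trans (congrArg (V.str.app D) ?_)
        exact res_res V.a _ _ t₁
      have h2 : V.str.app D (res V.a hσW s) = res V.a h (V.str.app W s) := app_res V.str h s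
      have h3 (c : Γ(prodC f Λ, D)) (x : Γ(V.a, sigma f Λ ⁻¹ᵁ D)) :
          V.str.app D ((sigma f Λ).app D c • x) = c • V.str.app D x := V.str.app_smul c x
      rw [h1, e₁, hr, hr, ← map_pow, h3, h3, h2, res_smul, ht, map_pow])
  refine ⟨l + m + k, ?_⟩
  have e : a ^ (l + m + k) • t = a ^ m • a ^ l • kappaOn f Λ V U t₁ := by
    rw [smul_comm, hm, smul_smul, smul_smul, pow_add, pow_add]
  rw [e]
  exact Submodule.smul_mem _ _ hl'

/-- The structure map on the largest submodule killed by the `n`-th iterate, with values in the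
ambient module. -/
def nilStr : (Scheme.Modules.pushforward (sigma f Λ)).obj
    (sub V.a (nilAt V hV n) (res_mem_nilAt hV n) (mem_nilAt_of_locally hV n)) ⟶ V.a :=
  (Scheme.Modules.pushforward (sigma f Λ)).map (subι V.a (nilAt V hV n) (res_mem_nilAt hV n)
      (mem_nilAt_of_locally hV n)) ≫ V.str

lemma nilStr_mem (W : (prodC f Λ).Opens) (m) : (nilStr hV n).app W m ∈ nilAt V hV n W :=
  str_mem_nilAt hV n W _ (subι_mem V.a _ (res_mem_nilAt hV n) (mem_nilAt_of_locally hV n) m)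

/-- The largest submodule killed by the `n`-th iterate of the structure map. -/
def nilMod : KappaMod f Λ where
  a := sub V.a (nilAt V hV n) (res_mem_nilAt hV n) (mem_nilAt_of_locally hV n)
  str := subLift (res_mem_nilAt hV n) (mem_nilAt_of_locally hV n) (nilStr hV n) (nilStr_mem hV n)

/-- The inclusion of the largest submodule killed by the `n`-th iterate. -/
def nilModι : nilMod hV n ⟶ V where
  f := subι V.a (nilAt V hV n) (res_mem_nilAt hV n) (mem_nilAt_of_locally hV n)
  h := (subLift_ι (res_mem_nilAt hV n) (mem_nilAt_of_locally hV n) (nilStr hV n)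
    (nilStr_mem hV n)).symm

lemma nilModι_injective (W : (prodC f Λ).Opens) :
    Function.Injective ((nilModι hV n).f.app W) :=
  subι_injective V.a _ (res_mem_nilAt hV n) (mem_nilAt_of_locally hV n) W

lemma nilModι_mem {W : (prodC f Λ).Opens} (m) :
    (nilModι hV n).f.app W m ∈ nilAt V hV n W :=
  subι_mem V.a _ (res_mem_nilAt hV n) (mem_nilAt_of_locally hV n) m

lemma exists_nilModι {W : (prodC f Λ).Opens} {s : Γ(V.a, W)} (hs : s ∈ nilAt V hV n W) :
    ∃ m, (nilModι hV n).f.app W m = s :=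
  exists_subι V.a _ (res_mem_nilAt hV n) (mem_nilAt_of_locally hV n) hs

lemma qcAt_nilMod (hQ : QK V) {U : X.Opens} (hU : IsAffineOpen U) :
    QCAt (nilMod hV n).a (prX f Λ ⁻¹ᵁ U) := by
  intro a D hD h
  refine ⟨fun m hm => ?_, fun m => ?_⟩
  · obtain ⟨k, hk⟩ := (hV U hU a D hD h).1 ((nilModι hV n).f.app _ m) (by
      rw [← app_res, hm, map_zero])
    refine ⟨k, nilModι_injective hV n _ ?_⟩
    rw [Scheme.Modules.Hom.app_smul, hk, map_zero]
  · obtain ⟨k, t, e⟩ := (hV U hU a D hD h).2 ((nilModι hV n).f.app _ m)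
    obtain ⟨l, hl⟩ := nilModι_mem hV n m U hU a (a ^ k) D hD h le_rfl t (by
      rw [e, map_pow, res_self])
    obtain ⟨m', hm'⟩ := exists_nilModι hV n ((mem_nilAt_iff hV n hQ hU _).2 hl)
    refine ⟨l + k, m', nilModι_injective hV n _ ?_⟩
    rw [app_res, hm', res_smul, e, Scheme.Modules.Hom.app_smul, map_pow, smul_smul, pow_add]

lemma kpow_nilMod (hQ : QK V) : kpow (nilMod hV n) n = 0 := by
  refine kpow_eq_zero (fun U hU => qcAt_nilMod hV n hQ hU) fun U hU v => ?_
  refine nilModι_injective hV n _ ?_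
  rw [← iterate_kappaOn_app, map_zero]
  have := (mem_nilAt_iff hV n hQ hU _).1 (nilModι_mem hV n v) 1
  rwa [one_smul] at this

/-- A module all of whose sections over preimages of affine opens are locally nilpotent is locally
nilpotent. -/
theorem isLocNil_of_ln (hV : ∀ U, IsAffineOpen U → QCAt V.a (prX f Λ ⁻¹ᵁ U)) (hQ : QK V)
    (hN : ∀ U, IsAffineOpen U → ∀ v, LN Γ(prodC f Λ, prX f Λ ⁻¹ᵁ U) (kappaOn f Λ V U) v) :
    IsLocNil f Λ V := by
  intro W s z hz
  obtain ⟨U, hU, a, hza, haW⟩ := exists_basicOpen_preimage hz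
  -- The section t extends a^k s to the preimage of U. Its exponent n selects the subsheaf, and as a
  -- is invertible on its basic open set, s itself lies in that subsheaf there.
  obtain ⟨k, t, e⟩ := (hV U hU a _ rfl ((prodC f Λ).basicOpen_le a)).2 (res V.a haW s)
  obtain ⟨n, hn⟩ := hN U hU t
  refine ⟨_, haW, nilMod hV n, nilModι hV n, hza, ?_, ⟨n, kpow_nilMod hV n hQ⟩, ?_,
    exists_nilModι hV n ?_⟩
  · refine isQuasicoherent_of_qcAt _ fun y => ?_
    obtain ⟨_, ⟨U, hU, rfl⟩, hx, -⟩ :=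
      X.isBasis_affineOpens.exists_subset_of_mem_open (Set.mem_univ (prX f Λ y)) isOpen_univ
    exact ⟨_, hx, isAffineOpen_preimage f Λ hU, qcAt_nilMod hV n hQ hU⟩
  · exact inferInstanceAs (Mono (subι V.a (nilAt V hV n) (res_mem_nilAt hV n)
      (mem_nilAt_of_locally hV n)))
  · have h1 := res_mem_nilAt hV n _ _ ((prodC f Λ).basicOpen_le a) t
      ((mem_nilAt_iff hV n hQ hU t).2 hn)
    have hu : IsUnit (rres ((prodC f Λ).basicOpen_le a) a) := RingedSpace.isUnit_res_basicOpen _ a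
    rw [e] at h1
    obtain ⟨c, hc⟩ := hu.pow k
    have := Submodule.smul_mem _ (↑c⁻¹ : Γ(prodC f Λ, _)) h1
    rwa [← hc, smul_smul, Units.inv_mul, one_smul] at this

end
end CartierSheaf

/-! ### Passing between affine sections and stalks along X -/

namespace CartierSheaf
noncomputable section
open Scheme.Modules

set_option linter.unusedSectionVars false

section Localization

variable {A A' P E E' : Type*} [CommRing A] [CommRing A'] [AddCommGroup P] [Module A P]
  [AddCommGroup E] [Module A E] [AddCommGroup E'] [Module A' E']

/-- The ring `A'`, with its Frobenius lift, is obtained from `A` by inverting the elements of `T`,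
on which the Frobenius lift is the `q`-power map. -/
structure IsFrobLoc (φ' : A' →+* A') (ρ : A →+* A') (T : Set A) (q : ℕ) : Prop where
  pos : 0 < q
  unit : ∀ s ∈ T, IsUnit (ρ s)
  pow : ∀ s ∈ T, φ' (ρ s) = ρ s ^ q
  den : ∀ y, ∃ s ∈ T, ∃ a, ρ s * y = ρ a

/-- The map `g` identifies the `T`-localization of the image of `p` with its own image, compatibly
with `κ`-structures. -/
structure IsKappaLoc (ρ : A →+* A') (T : Set A) (kP : P →+ P) (k : E →+ E) (k' : E' →+ E')
    (p : P →ₗ[A] E) (g : P →+ E') : Prop where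
  p_kap : ∀ v, p (kP v) = k (p v)
  g_kap : ∀ v, g (kP v) = k' (g v)
  g_smul : ∀ a v, g (a • v) = ρ a • g v
  of_eq_zero : ∀ v, p v = 0 → g v = 0
  exists_smul : ∀ v, g v = 0 → ∃ s ∈ T, s • p v = 0

variable {φ : A →+* A} {φ' : A' →+* A'} {ρ : A →+* A'} {T : Set A} {q : ℕ} {kP : P →+ P} {k : E →+ E}
  {k' : E' →+ E'} {p : P →ₗ[A] E} {g : P →+ E'}

lemma IsFrobLoc.iterate (h : IsFrobLoc φ' ρ T q) {s : A} (hs : s ∈ T) (n : ℕ) :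
    φ'^[n] (ρ s) = ρ s ^ q ^ n := by
  induction n with
  | zero => simp
  | succ n ih => rw [Function.iterate_succ_apply', ih, map_pow, h.pow s hs, ← pow_mul, pow_succ']

/-- With s a denominator of y, s k'^n(y g(z)) = k'^n(s^(q^n) y g(z)), and s^(q^n) y comes from A
because s y does. -/
lemma IsKappaLoc.exists_iterate (hl : IsKappaLoc ρ T kP k k' p g) (h : IsFrobLoc φ' ρ T q)
    (hk' : IsKappa φ' k') (n : ℕ) (y : A') (z : P) :
    ∃ s ∈ T, ∃ c : A, ρ s • k'^[n] (y • g z) = g (kP^[n] (c • z)) := by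
  obtain ⟨s, hs, a, e⟩ := h.den y
  have hq : 0 < q ^ n := pow_pos h.pos n
  refine ⟨s, hs, s ^ (q ^ n - 1) * a, ?_⟩
  rw [iterate_comm_apply g hl.g_kap, ← hk'.iterate_smul, h.iterate hs, hl.g_smul, smul_smul, map_mul,
    map_pow, ← e, ← mul_assoc, ← pow_succ, Nat.sub_add_cancel hq]

lemma IsKappaLoc.ln (hl : IsKappaLoc ρ T kP k k' p g) (h : IsFrobLoc φ' ρ T q)
    (hk' : IsKappa φ' k') {z : P} (hz : LN A k (p z)) : LN A' k' (g z) := by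
  obtain ⟨n, hn⟩ := hz
  refine ⟨n, fun y => ?_⟩
  obtain ⟨s, hs, c, e⟩ := hl.exists_iterate h hk' n y z
  rw [← (h.unit s hs).smul_eq_zero, e]
  refine hl.of_eq_zero _ ?_
  rw [iterate_comm_apply p hl.p_kap, _root_.map_smul, hn]

lemma IsKappaLoc.powSpan_fg (hl : IsKappaLoc ρ T kP k k' p g) (h : IsFrobLoc φ' ρ T q)
    (hk : IsKappa φ k) (hk' : IsKappa φ' k') {z : P} {n : ℕ} (hz : (hk.powSpan n (p z)).FG) :
    (hk'.powSpan n (g z)).FG := by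
  obtain ⟨S, hS⟩ := hz
  have hS' (w) (hw : w ∈ S) : ∃ a : A, p (kP^[n] (a • z)) = w := by
    have : w ∈ hk.powSpan n (p z) := hS ▸ Submodule.subset_span hw
    obtain ⟨a, rfl⟩ := hk.mem_powSpan.1 this
    exact ⟨a, by rw [iterate_comm_apply p hl.p_kap, _root_.map_smul]⟩
  choose! a ha using hS'
  classical
  let f : E → E' := fun w => g (kP^[n] (a w • z))
  refine ⟨S.image f, le_antisymm ?_ fun x hx => ?_⟩
  · rw [Submodule.span_le]
    intro x hx
    obtain ⟨w, -, rfl⟩ := Finset.mem_image.1 hx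
    exact hk'.mem_powSpan.2 ⟨ρ (a w), by
      rw [← hl.g_smul]
      exact (iterate_comm_apply g hl.g_kap n _).symm⟩
  · obtain ⟨y, rfl⟩ := hk'.mem_powSpan.1 hx
    obtain ⟨s, hs, c, e⟩ := hl.exists_iterate h hk' n y z
    have key (v : P) (hv : p v ∈ Submodule.span A (S : Set E)) :
        g v ∈ Submodule.span A' ((S.image f : Finset E') : Set E') := by
      obtain ⟨b, hb⟩ := Submodule.mem_span_finset.1 hv
      have : g v = g (∑ w ∈ S, b w • kP^[n] (a w • z)) := by
        rw [← sub_eq_zero, ← map_sub]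
        refine hl.of_eq_zero _ ?_
        rw [map_sub, ← hb.2, map_sum, sub_eq_zero]
        exact Finset.sum_congr rfl fun w hw => by rw [_root_.map_smul, ha w hw]
      rw [this, map_sum]
      refine Submodule.sum_mem _ fun w hw => ?_
      rw [hl.g_smul]
      exact Submodule.smul_mem _ _ (Submodule.subset_span (Finset.mem_image_of_mem f hw))
    have h1 := key (kP^[n] (c • z)) (by
      rw [hS]
      exact hk.mem_powSpan.2 ⟨c, by rw [iterate_comm_apply p hl.p_kap, _root_.map_smul]⟩)
    rw [← e] at h1
    obtain ⟨u, hu⟩ := h.unit s hs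
    have := Submodule.smul_mem _ (↑u⁻¹ : A') h1
    rwa [← hu, smul_smul, Units.inv_mul, one_smul] at this

/-- The exponent is uniform while the denominator depends on a, which is exactly what
`LN.of_forall_prime` asks for. -/
lemma IsKappaLoc.exists_of_ln (hl : IsKappaLoc ρ T kP k k' p g) {z : P} (hz : LN A' k' (g z)) :
    ∃ n : ℕ, ∀ a : A, ∃ s ∈ T, s • k^[n] (a • p z) = 0 := by
  obtain ⟨n, hn⟩ := hz
  refine ⟨n, fun a => ?_⟩
  obtain ⟨s, hs, e⟩ := hl.exists_smul (kP^[n] (a • z)) (by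
    rw [iterate_comm_apply g hl.g_kap, hl.g_smul, hn])
  exact ⟨s, hs, by rwa [iterate_comm_apply p hl.p_kap, _root_.map_smul] at e⟩

lemma LN.of_unit_smul {y : A} (hy : IsUnit y) {v : E} (h : LN A k (y • v)) : LN A k v := by
  obtain ⟨u, rfl⟩ := hy
  have := (lnSub A k).smul_mem (↑u⁻¹ : A) h
  rwa [smul_smul, Units.inv_mul, one_smul] at this

lemma IsKappa.powSpan_fg_of_unit_smul (hk : IsKappa φ k) {y : A} (hy : IsUnit y) {v : E} {n : ℕ}
    (h : (hk.powSpan n (y • v)).FG) : (hk.powSpan n v).FG := by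
  unfold IsKappa.powSpan at h
  rwa [Submodule.span_singleton_smul_eq hy] at h

end Localization

variable {F : Type u} [Field F] [Finite F] {X : Scheme.{u}} {f : X ⟶ Spec (CommRingCat.of F)}
variable {Λ : Type u} [CommRing Λ] [Algebra F Λ]

lemma germAt_res (M : (prodC f Λ).Modules) (x : X) {U U' : X.Opens} (h : U' ≤ U) (hx : x ∈ U')
    (m : Γ(M, prX f Λ ⁻¹ᵁ U)) :
    germAt f Λ M x U' hx (res M (preimage_le f Λ h) m) = germAt f Λ M x U (h hx) m :=
  TopCat.Presheaf.germ_res_apply (C := Ab.{u}) (modX f Λ M).presheaf (homOfLE h) x hx m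

lemma exists_smul_eq_zero_of_germAt {M : (prodC f Λ).Modules} {x : X} {U : X.Opens}
    (hU : IsAffineOpen U) (hx : x ∈ U) (hM : QCAt M (prX f Λ ⁻¹ᵁ U)) {m : Γ(M, prX f Λ ⁻¹ᵁ U)}
    (hm : germAt f Λ M x U hx m = 0) :
    ∃ s : Γ(X, U), x ∈ X.basicOpen s ∧ prS f Λ U s • m = 0 := by
  obtain ⟨V, hV, i, i', e⟩ := TopCat.Presheaf.germ_eq (C := Ab.{u}) (modX f Λ M).presheaf x hx hx m 0
    (hm.trans (map_zero (germAt f Λ M x U hx)).symm)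
  have e' : res M (preimage_le f Λ (leOfHom i)) m = 0 :=
    Eq.trans e (map_zero (res M (preimage_le f Λ (leOfHom i'))))
  obtain ⟨r, hr, hxr⟩ := exists_basicOpen hU (leOfHom i) hV
  obtain ⟨k, hk⟩ := (hM _ _ (basicOpen_prS f Λ r) (preimage_le f Λ (X.basicOpen_le r))).1 m (by
    rw [← res_res M (preimage_le f Λ hr) (preimage_le f Λ (leOfHom i)), e', map_zero])
  exact ⟨r ^ k, mem_basicOpen_pow hxr k, by rwa [map_pow]⟩

lemma exists_smul_eq_germAt {M : (prodC f Λ).Modules} {x : X} {U : X.Opens}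
    (hU : IsAffineOpen U) (hx : x ∈ U) (hM : QCAt M (prX f Λ ⁻¹ᵁ U)) (m : stalkMod f Λ M x) :
    ∃ (s : Γ(X, U)) (v : Γ(M, prX f Λ ⁻¹ᵁ U)), x ∈ X.basicOpen s ∧
      gm f Λ x U hx (prS f Λ U s) • m = germAt f Λ M x U hx v := by
  obtain ⟨V, hV, -, m', -, rfl⟩ := exists_germAt f Λ M x 0 m
  obtain ⟨r, hr, hxr⟩ := exists_basicOpen hU (W' := U ⊓ V) inf_le_left ⟨hx, hV⟩
  obtain ⟨k, v, e⟩ := (hM _ _ (basicOpen_prS f Λ r) (preimage_le f Λ (X.basicOpen_le r))).2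
    (res M (preimage_le f Λ (hr.trans inf_le_right)) m')
  refine ⟨r ^ k, v, mem_basicOpen_pow hxr k, ?_⟩
  rw [← germAt_res M x (X.basicOpen_le r) hxr, e, germAt_smul,
    germAt_res M x (hr.trans inf_le_right) hxr, ← prS_rres f Λ (X.basicOpen_le r), ← map_pow,
    ← map_pow, prS_rres f Λ (X.basicOpen_le r)]
  refine congrArg (fun y => y • germAt f Λ M x V hV m') ?_
  exact (gm_rres f Λ x (X.basicOpen_le r) hxr _).symm

/-- The functions on `U` that are invertible at `x`, pulled back to the product. -/
def invAt (f : X ⟶ Spec (CommRingCat.of F)) (Λ : Type u) [CommRing Λ] [Algebra F Λ] (x : X)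
    (U : X.Opens) : Set Γ(prodC f Λ, prX f Λ ⁻¹ᵁ U) := {a | ∃ s, x ∈ X.basicOpen s ∧ prS f Λ U s = a}

lemma isFrobLoc_gm {x : X} {U : X.Opens} (hU : IsAffineOpen U) (hx : x ∈ U) :
    IsFrobLoc (frobAt f Λ x) (gm f Λ x U hx) (invAt f Λ x U) (Nat.card F) where
  pos := Nat.card_pos
  unit := by
    rintro _ ⟨s, hs, rfl⟩
    exact isUnit_gm_prS f Λ hx hs
  pow := by
    rintro _ ⟨s, hs, rfl⟩
    rw [← toRingAt_germ, frobAt_toRingAt]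
  den y := by
    obtain ⟨s, a, hs, e⟩ := exists_gm f Λ hU hx y
    exact ⟨_, ⟨s, hs, rfl⟩, a, e⟩

lemma isKappaLoc_germAt (V : KappaMod f Λ) {x : X} {U : X.Opens} (hU : IsAffineOpen U) (hx : x ∈ U)
    (hV : QCAt V.a (prX f Λ ⁻¹ᵁ U)) :
    IsKappaLoc (gm f Λ x U hx) (invAt f Λ x U) (kappaOn f Λ V U) (kappaOn f Λ V U)
      (kapM (stalkK f Λ V x)) LinearMap.id (germAt f Λ V.a x U hx) where
  p_kap _ := rfl
  g_kap v := (kappaAt_germ f Λ V x U hx v).symm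
  g_smul a v := germAt_smul f Λ V.a x U hx a v
  of_eq_zero v hv := by
    rw [LinearMap.id_apply] at hv
    rw [hv]
    exact map_zero (germAt f Λ V.a x U hx)
  exists_smul v hv := by
    obtain ⟨s, hs, e⟩ := exists_smul_eq_zero_of_germAt hU hx hV hv
    exact ⟨_, ⟨s, hs, rfl⟩, e⟩

lemma exists_affine (x : X) : ∃ U : X.Opens, IsAffineOpen U ∧ x ∈ U := by
  obtain ⟨_, ⟨U, hU, rfl⟩, hx, -⟩ :=
    X.isBasis_affineOpens.exists_subset_of_mem_open (Set.mem_univ x) isOpen_univ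
  exact ⟨U, hU, hx⟩

lemma powSpan_stalk_fg {V : KappaMod f Λ} (hV : ∀ U, IsAffineOpen U → QCAt V.a (prX f Λ ⁻¹ᵁ U))
    (hQ : QK V) (x : X) (m) (n : ℕ) : ((isKappa_kapM (stalkK f Λ V x)).powSpan n m).FG := by
  obtain ⟨U, hU, hx⟩ := exists_affine x
  obtain ⟨s, v, hs, e⟩ := exists_smul_eq_germAt hU hx (hV U hU) m
  refine IsKappa.powSpan_fg_of_unit_smul _ (isUnit_gm_prS f Λ hx hs) ?_
  have := (isKappaLoc_germAt V hU hx (hV U hU)).powSpan_fg (isFrobLoc_gm hU hx)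
    (isKappa_kappaOn V U) (isKappa_kapM (stalkK f Λ V x)) (hQ U hU v n)
  exact (congrArg (fun w : (stalkK f Λ V x).a =>
    ((isKappa_kapM (stalkK f Λ V x)).powSpan n w).FG) e).mpr this

lemma ln_stalk {V : KappaMod f Λ} (hV : ∀ U, IsAffineOpen U → QCAt V.a (prX f Λ ⁻¹ᵁ U))
    (hN : ∀ U, IsAffineOpen U → ∀ v, LN Γ(prodC f Λ, prX f Λ ⁻¹ᵁ U) (kappaOn f Λ V U) v)
    (x : X) (m) : LN (ringAt f Λ x) (kapM (stalkK f Λ V x)) m := by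
  obtain ⟨U, hU, hx⟩ := exists_affine x
  obtain ⟨s, v, hs, e⟩ := exists_smul_eq_germAt hU hx (hV U hU) m
  refine LN.of_unit_smul (isUnit_gm_prS f Λ hx hs) ?_
  have := (isKappaLoc_germAt V hU hx (hV U hU)).ln (isFrobLoc_gm hU hx)
    (isKappa_kapM (stalkK f Λ V x)) (hN U hU v)
  exact (congrArg (fun w : (stalkK f Λ V x).a => LN (ringAt f Λ x) (kapM (stalkK f Λ V x)) w)
    e).mpr this

/-- Elements killed by the maximal ideal on `X` up to denominators are killed by the ideal of
`x × C`. -/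
lemma idealAt_smul_eq_zero {x : X} {U : X.Opens} (hU : IsAffineOpen U) (hx : x ∈ U) {E' : Type*}
    [AddCommGroup E'] [Module (ringAt f Λ x) E'] {e : E'}
    (H : ∀ r : Γ(X, U), x ∉ X.basicOpen r → ∃ s : Γ(X, U), x ∈ X.basicOpen s ∧
      gm f Λ x U hx (prS f Λ U s) • gm f Λ x U hx (prS f Λ U r) • e = 0)
    {y : ringAt f Λ x} (hy : y ∈ idealAt f Λ x) : y • e = 0 := by
  suffices idealAt f Λ x ≤ LinearMap.ker (LinearMap.toSpanSingleton (ringAt f Λ x) E' e) from this hy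
  rw [idealAt, Ideal.map_le_iff_le_comap]
  intro z hz
  obtain ⟨s, a, hs, e1⟩ := exists_germ_mul hU hx z
  have ha : x ∉ X.basicOpen a := by
    rw [X.mem_basicOpen a x hx]
    intro hu
    rw [← e1] at hu
    exact (IsLocalRing.mem_maximalIdeal _).1 hz (isUnit_of_mul_isUnit_right hu)
  obtain ⟨s', hs', e2⟩ := H a ha
  change toRingAt f Λ x z • e = 0
  rw [(isUnit_gm_prS f Λ hx hs').smul_eq_zero, ← toRingAt_germ, ← e1, map_mul, toRingAt_germ,
    mul_smul, (isUnit_gm_prS f Λ hx hs).smul_eq_zero] at e2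
  exact e2

/-- Local nilpotence of a section can be checked at the points of the open subset. -/
theorem ln_of_forall_point [IsLocallyNoetherian X] {V : KappaMod f Λ} (hQ : QK V) {U : X.Opens}
    (hU : IsAffineOpen U) (v : Γ(V.a, prX f Λ ⁻¹ᵁ U))
    (H : ∀ x ∈ U, ∀ w : Γ(V.a, prX f Λ ⁻¹ᵁ U), (∀ r : Γ(X, U), x ∉ X.basicOpen r →
      ∃ s : Γ(X, U), x ∈ X.basicOpen s ∧ prS f Λ U s • prS f Λ U r • w = 0) →
      ∃ n : ℕ, ∀ a : Γ(prodC f Λ, prX f Λ ⁻¹ᵁ U), ∃ s ∈ invAt f Λ x U, s • (kappaOn f Λ V U)^[n] (a • w) = 0) :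
    LN Γ(prodC f Λ, prX f Λ ⁻¹ᵁ U) (kappaOn f Λ V U) v := by
  let : Algebra Γ(X, U) Γ(prodC f Λ, prX f Λ ⁻¹ᵁ U) := (prS f Λ U).toAlgebra
  let : Module Γ(X, U) Γ(V.a, prX f Λ ⁻¹ᵁ U) := Module.compHom _ (prS f Λ U)
  have : IsScalarTower Γ(X, U) Γ(prodC f Λ, prX f Λ ⁻¹ᵁ U) Γ(V.a, prX f Λ ⁻¹ᵁ U) :=
    ⟨fun r a m => mul_smul (prS f Λ U r) a m⟩
  have : IsNoetherianRing Γ(X, U) := IsLocallyNoetherian.component_noetherian ⟨U, hU⟩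
  have hq : 1 < Nat.card F := Finite.one_lt_card
  refine LN.of_forall_prime (R := Γ(X, U)) hq (sigmaOn_prS f Λ U) (isKappa_kappaOn V U) (hQ U hU v)
    fun p hp w hw => ?_
  obtain ⟨x, hx, hxp⟩ := exists_mem_iff_basicOpen hU p
  obtain ⟨n, hn⟩ := H x hx w fun r hr => by
    obtain ⟨s, hs, e⟩ := hw r (by rwa [hxp, not_not] at hr)
    exact ⟨s, (hxp s).2 hs, e⟩
  refine ⟨n, fun a => ?_⟩
  obtain ⟨_, ⟨s, hs, rfl⟩, e⟩ := hn a
  exact ⟨s, (hxp s).1 hs, e⟩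

end
end CartierSheaf

/-! ### The stalk of a complex and its cohomology -/

namespace CartierSheaf
noncomputable section
open Scheme.Modules

set_option linter.unusedSectionVars false

variable {F : Type u} [Field F] [Finite F] {X : Scheme.{u}} {f : X ⟶ Spec (CommRingCat.of F)}
variable {Λ : Type u} [CommRing Λ] [Algebra F Λ]

/-- The stalk at `x` of a complex of `κ`-modules. -/
abbrev stalkCx (V : CochainComplex (KappaMod f Λ) ℤ) (x : X) :
    CochainComplex (KMod (frobAt f Λ x)) ℤ :=
  ((stalkKFunctor f Λ x).mapHomologicalComplex _).obj V

variable (V : CochainComplex (KappaMod f Λ) ℤ) (x : X)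

/-- Germs of chains, as elements of the stalk complex. -/
def germC (i : ℤ) (U : X.Opens) (hx : x ∈ U) :
    Γ((V.X i).a, prX f Λ ⁻¹ᵁ U) →+ (underlying (stalkCx V x)).X i :=
  germAt f Λ (V.X i).a x U hx

lemma germC_smul (i : ℤ) (U : X.Opens) (hx : x ∈ U) (a : Γ(prodC f Λ, prX f Λ ⁻¹ᵁ U)) (m) :
    germC V x i U hx (a • m) = gm f Λ x U hx a • germC V x i U hx m :=
  germAt_smul f Λ (V.X i).a x U hx a m

/-- The differential on sections over the preimage of `U`. -/
def dC (i j : ℤ) (U : X.Opens) :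
    Γ((V.X i).a, prX f Λ ⁻¹ᵁ U) →+ Γ((V.X j).a, prX f Λ ⁻¹ᵁ U) :=
  ((V.d i j).f.app (prX f Λ ⁻¹ᵁ U)).hom

lemma dC_smul (i j : ℤ) (U : X.Opens) (a : Γ(prodC f Λ, prX f Λ ⁻¹ᵁ U)) (m) :
    dC V i j U (a • m) = a • dC V i j U m :=
  Scheme.Modules.Hom.app_smul (V.d i j).f a m

lemma d_germC (i j : ℤ) (U : X.Opens) (hx : x ∈ U) (m) :
    (underlying (stalkCx V x)).d i j (germC V x i U hx m) =
      germC V x j U hx (dC V i j U m) :=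
  stalkModMap_germ f Λ (V.d i j).f x U hx m

lemma exists_cycI {i : ℤ} {U : X.Opens} {v : Γ((V.X i).a, prX f Λ ⁻¹ᵁ U)}
    (hv : dC V i (i + 1) U v = 0) : ∃ z, (cycI V i).f.app (prX f Λ ⁻¹ᵁ U) z = v :=
  mem_rangeAt_iCycles (underlying V) i hv

lemma exists_cycI_eq_dC (i j : ℤ) (U : X.Opens) (n : Γ((V.X j).a, prX f Λ ⁻¹ᵁ U)) :
    ∃ z, (cycI V i).f.app (prX f Λ ⁻¹ᵁ U) z = dC V j i U n ∧
      (cycP V i).f.app (prX f Λ ⁻¹ᵁ U) z = 0 :=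
  ⟨((underlying V).toCycles j i).app (prX f Λ ⁻¹ᵁ U) n, iCycles_toCycles (underlying V) i j _ n,
    homologyπ_toCycles (underlying V) i j _ n⟩

lemma cycI_injective (i : ℤ) (U : X.Opens) :
    Function.Injective ((cycI V i).f.app (prX f Λ ⁻¹ᵁ U)) :=
  iCycles_injective (underlying V) i _

lemma exists_dC_of_cycP (hV : ∀ i, IsKappaSheaf f Λ (V.X i)) {i : ℤ} {U : X.Opens}
    (hU : IsAffineOpen U) {z : Γ((cycAlg V i).a, prX f Λ ⁻¹ᵁ U)}
    (hz : (cycP V i).f.app (prX f Λ ⁻¹ᵁ U) z = 0) :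
    ∃ n, (cycI V i).f.app (prX f Λ ⁻¹ᵁ U) z = dC V (i - 1) i U n := by
  obtain ⟨n, hn⟩ := mem_rangeAt_toCycles (L := underlying V) i hV (isAffineOpen_preimage f Λ hU) hz
  refine ⟨n, ?_⟩
  rw [← hn]
  exact iCycles_toCycles (underlying V) i (i - 1) (prX f Λ ⁻¹ᵁ U) n

lemma cycP_surjective (hV : ∀ i, IsKappaSheaf f Λ (V.X i)) (i : ℤ) {U : X.Opens}
    (hU : IsAffineOpen U) : Function.Surjective ((cycP V i).f.app (prX f Λ ⁻¹ᵁ U)) :=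
  mem_rangeAt_homologyπ (L := underlying V) i hV (isAffineOpen_preimage f Λ hU)

lemma qcAt_of_isKappaSheaf {V : KappaMod f Λ} (hV : IsKappaSheaf f Λ V) {U : X.Opens}
    (hU : IsAffineOpen U) : QCAt V.a (prX f Λ ⁻¹ᵁ U) :=
  have : V.a.IsQuasicoherent := hV
  qcAt_of_isQuasicoherent _ (isAffineOpen_preimage f Λ hU)

lemma qcAt_cohomologyAlg (hV : ∀ i, IsKappaSheaf f Λ (V.X i)) (i : ℤ) {U : X.Opens}
    (hU : IsAffineOpen U) : QCAt (cohomologyAlg V i).a (prX f Λ ⁻¹ᵁ U) :=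
  qcAt_homology (L := underlying V) i hV (isAffineOpen_preimage f Λ hU)

lemma kapAt_germC (i : ℤ) (U : X.Opens) (hx : x ∈ U) (m) :
    kapAt (strHom (stalkCx V x)) i (germC V x i U hx m) =
      germC V x i U hx (kappaOn f Λ (V.X i) U m) :=
  kappaAt_germ f Λ (V.X i) x U hx m

/-- The class modulo boundaries of the germ of a cycle. -/
def clsC (i : ℤ) (U : X.Opens) (hx : x ∈ U) : Γ((cycAlg V i).a, prX f Λ ⁻¹ᵁ U) →+
    ((underlying (stalkCx V x)).X i ⧸ bd (underlying (stalkCx V x)) i) :=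
  (bd (underlying (stalkCx V x)) i).mkQ.toAddMonoidHom.comp ((germC V x i U hx).comp
    ((cycI V i).f.app (prX f Λ ⁻¹ᵁ U)).hom)

lemma clsC_apply (i : ℤ) (U : X.Opens) (hx : x ∈ U) (z) :
    clsC V x i U hx z = (bd (underlying (stalkCx V x)) i).mkQ
      (germC V x i U hx ((cycI V i).f.app (prX f Λ ⁻¹ᵁ U) z)) := rfl

variable {V x}

/-- The cohomology of the stalk complex is never identified with the stalk of the cohomology sheaf.
Both receive the cycles over the preimage of U, and it suffices that the kernels agree up to
denominators invertible at x. -/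
lemma isKappaLoc_clsC (hV : ∀ i, IsKappaSheaf f Λ (V.X i)) (i : ℤ) {U : X.Opens}
    (hU : IsAffineOpen U) (hx : x ∈ U) :
    IsKappaLoc (gm f Λ x U hx) (invAt f Λ x U) (kappaOn f Λ (cycAlg V i) U)
      (kappaOn f Λ (cohomologyAlg V i) U) (kapQ (strHom (stalkCx V x)) i)
      (appLin (cycP V i).f (prX f Λ ⁻¹ᵁ U)) (clsC V x i U hx) where
  p_kap v := (kappaOn_naturality f Λ (cycP V i) U v).symm
  g_kap v := by
    rw [clsC_apply, clsC_apply, ← mkQ_kapAt, kapAt_germC, kappaOn_naturality]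
  g_smul a v := by
    rw [clsC_apply, Scheme.Modules.Hom.app_smul, germC_smul, _root_.map_smul, clsC_apply]
  of_eq_zero v hv := by
    obtain ⟨n, hn⟩ := exists_dC_of_cycP V hV hU hv
    rw [clsC_apply, hn, ← d_germC, Submodule.mkQ_apply, Submodule.Quotient.mk_eq_zero]
    exact d_mem_bd _ _ _
  exists_smul v hv := by
    rw [clsC_apply, Submodule.mkQ_apply, Submodule.Quotient.mk_eq_zero] at hv
    obtain ⟨j, m, hm⟩ := mem_bd.1 hv
    -- Write the stalk chain m bounding v as n/s. Then sv and dn have the same germ, so they agree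
    -- after multiplication by a further s', and s's v is a boundary over U.
    obtain ⟨s, n, hs, e⟩ : ∃ (s : Γ(X, U)) (n : Γ((V.X j).a, prX f Λ ⁻¹ᵁ U)), x ∈ X.basicOpen s ∧
      gm f Λ x U hx (prS f Λ U s) • m = germC V x j U hx n :=
        exists_smul_eq_germAt hU hx (qcAt_of_isKappaSheaf (hV j) hU) m
    have h0 : germC V x i U hx (prS f Λ U s • (cycI V i).f.app _ v - dC V j i U n) = 0 := by
      rw [map_sub, germC_smul, ← hm, ← d_germC, ← e, _root_.map_smul, sub_self]
    obtain ⟨s', hs', e'⟩ := exists_smul_eq_zero_of_germAt hU hx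
      (qcAt_of_isKappaSheaf (hV i) hU) h0
    obtain ⟨z, hz, hz'⟩ := exists_cycI_eq_dC V i j U (prS f Λ U s' • n)
    refine ⟨prS f Λ U s' * prS f Λ U s, ⟨s' * s, ?_, map_mul _ _ _⟩, ?_⟩
    · rw [Scheme.basicOpen_mul]
      exact ⟨hs', hs⟩
    · refine Eq.trans ?_ hz'
      rw [← _root_.map_smul]
      refine congrArg ((cycP V i).f.app (prX f Λ ⁻¹ᵁ U)) (cycI_injective V i U ?_)
      rw [hz, Scheme.Modules.Hom.app_smul, dC_smul, mul_smul]
      rwa [smul_sub, sub_eq_zero] at e'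

/-- A stalk cycle is a fraction n/s whose dn has zero germ; a further denominator makes n a genuine
cycle. -/
lemma exists_clsC (hV : ∀ i, IsKappaSheaf f Λ (V.X i)) (i : ℤ) {U : X.Opens}
    (hU : IsAffineOpen U) (hx : x ∈ U) {c : (underlying (stalkCx V x)).X i}
    (hc : (underlying (stalkCx V x)).d i (i + 1) c = 0) :
    ∃ (s : Γ(X, U)) (z : _), x ∈ X.basicOpen s ∧ gm f Λ x U hx (prS f Λ U s) •
      (bd (underlying (stalkCx V x)) i).mkQ c = clsC V x i U hx z := by
  obtain ⟨s, n, hs, e⟩ : ∃ (s : Γ(X, U)) (n : Γ((V.X i).a, prX f Λ ⁻¹ᵁ U)), x ∈ X.basicOpen s ∧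
    gm f Λ x U hx (prS f Λ U s) • c = germC V x i U hx n :=
      exists_smul_eq_germAt hU hx (qcAt_of_isKappaSheaf (hV i) hU) c
  have h0 : germC V x (i + 1) U hx (dC V i (i + 1) U n) = 0 := by
    rw [← d_germC, ← e, _root_.map_smul, hc, smul_zero]
  obtain ⟨s', hs', e'⟩ := exists_smul_eq_zero_of_germAt hU hx
    (qcAt_of_isKappaSheaf (hV (i + 1)) hU) h0
  rw [← dC_smul] at e'
  obtain ⟨z, hz⟩ := exists_cycI V e'
  refine ⟨s' * s, z, ?_, ?_⟩
  · rw [Scheme.basicOpen_mul]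
    exact ⟨hs', hs⟩
  · rw [clsC_apply, hz, germC_smul, ← e, _root_.map_smul, _root_.map_smul, map_mul, map_mul, mul_smul]

variable (V x) in
lemma isZero_cohomologyAlg_app {i : ℤ} (h : (underlying V).ExactAt i) (W : (prodC f Λ).Opens)
    (v : Γ((cohomologyAlg V i).a, W)) : v = 0 := by
  have h1 : 𝟙 ((underlying V).homology i) = 0 := h.isZero_homology.eq_of_src _ _
  exact congr(Scheme.Modules.Hom.app $h1 W v)

lemma exactAt_stalkCx (hV : ∀ i, IsKappaSheaf f Λ (V.X i)) {i : ℤ} (h : (underlying V).ExactAt i) :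
    (underlying (stalkCx V x)).ExactAt i := by
  rw [exactAt_iff_bd]
  intro c hc
  obtain ⟨U, hU, hx⟩ := exists_affine x
  obtain ⟨s, z, hs, e⟩ := exists_clsC hV i hU hx hc
  rw [(isKappaLoc_clsC hV i hU hx).of_eq_zero z (isZero_cohomologyAlg_app V h _ _),
    (isUnit_gm_prS f Λ hx hs).smul_eq_zero, Submodule.mkQ_apply, Submodule.Quotient.mk_eq_zero] at e
  exact e

lemma ln_stalkCx (hV : ∀ i, IsKappaSheaf f Λ (V.X i)) (i : ℤ)
    (hN : ∀ U, IsAffineOpen U → ∀ v, LN Γ(prodC f Λ, prX f Λ ⁻¹ᵁ U)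
      (kappaOn f Λ (cohomologyAlg V i) U) v) {c : (underlying (stalkCx V x)).X i}
    (hc : (underlying (stalkCx V x)).d i (i + 1) c = 0) :
    LN (ringAt f Λ x) (kapQ (strHom (stalkCx V x)) i)
      ((bd (underlying (stalkCx V x)) i).mkQ c) := by
  obtain ⟨U, hU, hx⟩ := exists_affine x
  obtain ⟨s, z, hs, e⟩ := exists_clsC hV i hU hx hc
  refine LN.of_unit_smul (isUnit_gm_prS f Λ hx hs) ?_
  rw [e]
  exact (isKappaLoc_clsC hV i hU hx).ln (isFrobLoc_gm hU hx) (isKappa_kapQ _ i) (hN U hU _)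

lemma powSpan_stalkCx_fg (hV : ∀ i, IsKappaSheaf f Λ (V.X i)) (i : ℤ)
    (hQ : QK (cohomologyAlg V i)) {c : (underlying (stalkCx V x)).X i}
    (hc : (underlying (stalkCx V x)).d i (i + 1) c = 0) (n : ℕ) :
    ((isKappa_kapQ (strHom (stalkCx V x)) i).powSpan n
      ((bd (underlying (stalkCx V x)) i).mkQ c)).FG := by
  obtain ⟨U, hU, hx⟩ := exists_affine x
  obtain ⟨s, z, hs, e⟩ := exists_clsC hV i hU hx hc
  refine IsKappa.powSpan_fg_of_unit_smul _ (isUnit_gm_prS f Λ hx hs) ?_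
  rw [e]
  exact (isKappaLoc_clsC hV i hU hx).powSpan_fg (isFrobLoc_gm hU hx)
    (isKappa_kappaOn (cohomologyAlg V i) U) (isKappa_kapQ _ i) (hQ U hU _ n)

end
end CartierSheaf

/-! ### The comparison of sheaves and complexes with their pullbacks to points -/

namespace CartierSheaf
noncomputable section
open Scheme.Modules

set_option linter.unusedSectionVars false

variable {F : Type u} [Field F] [Finite F] {X : Scheme.{u}} {f : X ⟶ Spec (CommRingCat.of F)}
variable {Λ : Type u} [CommRing Λ] [Algebra F Λ] [Algebra.EssFiniteType F Λ]

lemma QK.of_isKappaSheaf [IsLocallyNoetherian X] {V : KappaMod f Λ}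
    (hq : ∀ U, IsAffineOpen U → QCAt V.a (prX f Λ ⁻¹ᵁ U))
    (h : IsIndCoh f Λ V ∨ IsFinite (frob f)) : QK V := by
  rcases h with h | h
  · refine QK.of_isIndCoh (fun N hN U hU => ?_) h hq
    have := hN.1
    have := hN.2
    exact finite_sections N.a (isAffineOpen_preimage f Λ hU)
  · exact QK.of_isFinite h V

/-- For a class represented by a cycle z, k^n(Av) is a quotient of k^n(Az), and cycles embed into
the term of the complex, where finiteness is known. -/
lemma QK.cohomologyAlg [IsLocallyNoetherian X] {V : CochainComplex (KappaMod f Λ) ℤ}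
    (hV : ∀ i, IsKappaSheaf f Λ (V.X i)) (i : ℤ) (hQ : QK (V.X i)) : QK (cohomologyAlg V i) := by
  intro U hU v n
  have := isNoetherianRing_sections f Λ hU
  obtain ⟨z, rfl⟩ := cycP_surjective V hV i hU v
  have hZ := isKappa_kappaOn (cycAlg V i) U
  have h1 := hZ.powMap_map (isKappa_kappaOn (V.X i) U) (appLin (cycI V i).f (prX f Λ ⁻¹ᵁ U))
    (fun w => (kappaOn_naturality f Λ (cycI V i) U w).symm) n z
  have h2 := hZ.powMap_map (isKappa_kappaOn (CartierSheaf.cohomologyAlg V i) U)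
    (appLin (cycP V i).f (prX f Λ ⁻¹ᵁ U))
    (fun w => (kappaOn_naturality f Λ (cycP V i) U w).symm) n z
  refine h2.symm ▸ fg_map_of_fg_map (appLin (cycI V i).f (prX f Λ ⁻¹ᵁ U)) _ (fun w hw => ?_)
    (h1 ▸ hQ U hU _ n)
  rw [cycI_injective V i U (hw.trans (LinearMap.map_zero
    (appLin (cycI V i).f (prX f Λ ⁻¹ᵁ U))).symm), map_zero]

/-- Local nilpotence of the cohomology implies local nilpotence of the `!`-pullbacks to points. -/
theorem complexLocNilAt_of_isCohNil [IsLocallyNoetherian X] {V : CochainComplex (KappaMod f Λ) ℤ}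
    (hV : IsKappaComplex f Λ V) (hQ : ∀ i, QK (V.X i)) (h : IsCohNil f Λ V) (x : X) (a : ℤ) :
    ComplexLocNilAt f Λ V x a := by
  have := isNoetherianRing_ringAt f Λ x
  obtain ⟨n₀, hn₀⟩ := hV.2
  refine locNilMap_kappaRHom (strHom (stalkCx V x)) (idealAt_le_comap f Λ x) (n₀ := n₀)
    (fun i hi => exactAt_stalkCx hV.1 (hn₀ i hi)) (fun i z hz => ln_stalkCx hV.1 i
      (fun U hU v => (h i).ln hU (qcAt_cohomologyAlg V hV.1 i hU) v) hz) (fun i z n => ?_) a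
  exact powSpan_stalk_fg (fun U hU => qcAt_of_isKappaSheaf (hV.1 i) hU) (hQ i) x z n

/-- Only classes killed by the maximal ideal of x locally at x need to be treated. Their images in
the cohomology of the stalk complex are killed by the ideal of x × C, lower cohomology is already
nilpotent there, and so nilpotence of R^i applies. -/
lemma ln_cohomologyAlg [IsLocallyNoetherian X] {V : CochainComplex (KappaMod f Λ) ℤ}
    (hV : IsKappaComplex f Λ V) (i : ℤ) (hQ : QK (cohomologyAlg V i))
    (hN : ∀ j < i, ∀ U, IsAffineOpen U → ∀ v, LN Γ(prodC f Λ, prX f Λ ⁻¹ᵁ U)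
      (kappaOn f Λ (cohomologyAlg V j) U) v)
    (h : ∀ x, ComplexLocNilAt f Λ V x i) {U : X.Opens} (hU : IsAffineOpen U) (v) :
    LN Γ(prodC f Λ, prX f Λ ⁻¹ᵁ U) (kappaOn f Λ (cohomologyAlg V i) U) v := by
  refine ln_of_forall_point hQ hU v fun x hx w hw => ?_
  obtain ⟨n₀, hn₀⟩ := hV.2
  obtain ⟨z, rfl⟩ := cycP_surjective V hV.1 i hU w
  have hl := isKappaLoc_clsC hV.1 i hU hx
  have := isNoetherianRing_ringAt f Λ x
  refine hl.exists_of_ln (z := z) ?_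
  rw [clsC_apply]
  refine ln_of_locNilMap_kappaRHom (strHom (stalkCx V x)) (idealAt_le_comap f Λ x) (n₀ := n₀)
    (fun i hi => exactAt_stalkCx hV.1 (hn₀ i hi)) i
    (fun j hj c hc => ln_stalkCx hV.1 j (hN j hj) hc) (h x)
    (fun c hc n => powSpan_stalkCx_fg hV.1 i hQ hc n) ?_ fun y hy => ?_
  · rw [d_germC]
    refine (congrArg (germC V x (i + 1) U hx) ?_).trans (map_zero (germC V x (i + 1) U hx))
    exact d_iCycles (underlying V) i (i + 1) _ z
  · rw [← Submodule.Quotient.mk_eq_zero, ← Submodule.mkQ_apply, _root_.map_smul]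
    refine idealAt_smul_eq_zero hU hx (fun r hr => ?_) hy
    obtain ⟨s, hs, e⟩ := hw r hr
    refine ⟨s, hs, ?_⟩
    rw [← clsC_apply, ← hl.g_smul, ← hl.g_smul]
    refine hl.of_eq_zero _ ?_
    rw [_root_.map_smul, _root_.map_smul]
    exact e

/-- Local nilpotence of the `!`-pullbacks to points implies local nilpotence of the cohomology. -/
theorem isCohNil_of_complexLocNilAt [IsLocallyNoetherian X]
    {V : CochainComplex (KappaMod f Λ) ℤ} (hV : IsKappaComplex f Λ V)
    (hQ : ∀ i, QK (cohomologyAlg V i)) (h : ∀ x a, ComplexLocNilAt f Λ V x a) :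
    IsCohNil f Λ V := by
  obtain ⟨n₀, hn₀⟩ := hV.2
  -- Induction on the degree, starting below n₀ where the cohomology vanishes.
  have key (k : ℕ) : ∀ i < n₀ + k, ∀ U, IsAffineOpen U → ∀ v, LN Γ(prodC f Λ, prX f Λ ⁻¹ᵁ U)
      (kappaOn f Λ (cohomologyAlg V i) U) v := by
    induction k with
    | zero =>
      intro i hi U hU v
      rw [isZero_cohomologyAlg_app V (hn₀ i (by simpa using hi)) _ v]
      exact (lnSub _ _).zero_mem
    | succ k ih =>
      intro i hi U hU v
      exact ln_cohomologyAlg hV i (hQ i) (fun j hj => ih j (by push_cast at hi; lia))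
        (fun x => h x i) hU v
  intro i
  exact isLocNil_of_ln (fun U hU => qcAt_cohomologyAlg V hV.1 i hU) (hQ i)
    (key (i - n₀ + 1).toNat i (by lia))

theorem locNilAt_of_isLocNil [IsLocallyNoetherian X] {V : KappaMod f Λ}
    (hV : IsKappaSheaf f Λ V) (hQ : QK V) (h : IsLocNil f Λ V) (x : X) (a : ℤ) :
    LocNilAt f Λ V x a := by
  have := isNoetherianRing_ringAt f Λ x
  have hq := fun U (hU : IsAffineOpen U) => qcAt_of_isKappaSheaf hV hU
  exact locNilMap_kappaRHom_single (idealAt_le_comap f Λ x) (stalkK f Λ V x)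
    (ln_stalk hq (fun U hU v => h.ln hU (hq U hU) v) x) (powSpan_stalk_fg hq hQ x) a

/-- The reduction to points leaves only sections killed by the maximal ideal of x. Their germs are
elements of Hom(B_x, V_x), so R^0 alone decides. -/
theorem isLocNil_of_locNilAt [IsLocallyNoetherian X] {V : KappaMod f Λ}
    (hV : IsKappaSheaf f Λ V) (hQ : QK V) (h : ∀ x, LocNilAt f Λ V x 0) : IsLocNil f Λ V := by
  have hq := fun U (hU : IsAffineOpen U) => qcAt_of_isKappaSheaf hV hU
  refine isLocNil_of_ln hq hQ fun U hU v => ln_of_forall_point hQ hU v fun x hx w hw => ?_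
  have hl := isKappaLoc_germAt V hU hx (hq U hU)
  have := isNoetherianRing_ringAt f Λ x
  refine hl.exists_of_ln (z := w) ?_
  refine ln_of_locNilMap_kappaRHom_single (idealAt_le_comap f Λ x) (stalkK f Λ V x)
    (powSpan_stalk_fg hq hQ x) (h x) fun y hy => idealAt_smul_eq_zero hU hx (fun r hr => ?_) hy
  obtain ⟨s, hs, e⟩ := hw r hr
  refine ⟨s, hs, ?_⟩
  have e1 := congrArg (germAt f Λ V.a x U hx) e
  rw [germAt_smul, germAt_smul, map_zero] at e1
  exact e1

end
end CartierSheaf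

theorem corollary4p3p3 {F : Type u} [Field F] [Finite F]
    (Λ : Type u) [CommRing Λ] [Algebra F Λ] [Algebra.EssFiniteType F Λ]
    {X : Scheme.{u}} [IsNoetherian X] (f : X ⟶ Spec (CommRingCat.of F)) :
    (∀ V : CartierSheaf.KappaMod f Λ, CartierSheaf.IsKappaSheaf f Λ V →
      (CartierSheaf.IsIndCoh f Λ V ∨ IsFinite (CartierSheaf.frob f)) →
      List.TFAE [
        CartierSheaf.IsLocNil f Λ V,
        ∀ x : X, CartierSheaf.LocNilAt f Λ V x 0,
        ∀ (x : X) (a : ℤ), CartierSheaf.LocNilAt f Λ V x a]) ∧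
    (∀ V : CochainComplex (CartierSheaf.KappaMod f Λ) ℤ, CartierSheaf.IsKappaComplex f Λ V →
      ((∀ i, CartierSheaf.IsIndCoh f Λ (V.X i)) ∨ IsFinite (CartierSheaf.frob f)) →
      (CartierSheaf.IsCohNil f Λ V ↔
        ∀ (x : X) (a : ℤ), CartierSheaf.ComplexLocNilAt f Λ V x a)) ∧
    (∀ V : CochainComplex (CartierSheaf.KappaMod f Λ) ℤ, CartierSheaf.IsKappaComplex f Λ V →
      (∀ i, CartierSheaf.IsIndCoh f Λ (CartierSheaf.cohomologyAlg V i)) →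
      (∀ (x : X) (a : ℤ), CartierSheaf.ComplexLocNilAt f Λ V x a) →
      CartierSheaf.IsCohNil f Λ V) := by
  refine ⟨fun V hV h => ?_, fun V hV h => ?_, fun V hV h => ?_⟩
  · have hQ := CartierSheaf.QK.of_isKappaSheaf
      (fun U hU => CartierSheaf.qcAt_of_isKappaSheaf hV hU) h
    tfae_have 1 → 3 := fun h x a => CartierSheaf.locNilAt_of_isLocNil hV hQ h x a
    tfae_have 3 → 2 := fun h x => h x 0
    tfae_have 2 → 1 := CartierSheaf.isLocNil_of_locNilAt hV hQ
    tfae_finish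
  · have hQ (i : ℤ) : CartierSheaf.QK (V.X i) := CartierSheaf.QK.of_isKappaSheaf
      (fun U hU => CartierSheaf.qcAt_of_isKappaSheaf (hV.1 i) hU) (h.imp_left fun h => h i)
    exact ⟨CartierSheaf.complexLocNilAt_of_isCohNil hV hQ,
      CartierSheaf.isCohNil_of_complexLocNilAt hV fun i => (hQ i).cohomologyAlg hV.1 i⟩
  · exact CartierSheaf.isCohNil_of_complexLocNilAt hV fun i => CartierSheaf.QK.of_isKappaSheaf
      (fun U hU => CartierSheaf.qcAt_cohomologyAlg V hV.1 i hU) (Or.inl (h i))
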